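/- Let $c>0$, let $dW$ be a real Gaussian space-time white noise on $(0,\infty)_t\times\mathbb R_y$, and let $\varphi\in\mathcal S(\mathbb R)$ be real-valued, even, not identically zero, with $\int_{\mathbb R}\varphi\,dx=0$. Put $f(t,x)=\int_{\mathbb R}\varphi(x-y)\,dW(t,y)$ and consider $$\partial_t u+2\pi c\,x\,\mathcal H(u)=f\quad (t>0,\ x\in\mathbb R),\qquad u|_{t=0}=0,\qquad \int_{\mathbb R}u\,dx=0,$$ where $\mathcal Hg(x)=\frac1\pi\,\mathrm{p.v.}\!\int\frac{g(y)}{x-y}\,dy$ is the Hilbert transform. A (global weak) solution is a real process $u$, a.s. in $L^1_{\rm loc}([0,\infty)\times\mathbb R)$, with a.s. $u(0,\cdot)=0$, such that * for every $t\ge 0$, a.s. $u(t,\cdot)g$ is integrable for all $g\in\mathcal S(\mathbb R)$; * for every $t>0$ and every smooth $g(s,x)$ that is Schwartz in $x$ (locally uniformly in $s\ge0$, with all derivatives) and satisfies $\int x\,g(s,x)\,dx=0$ for all $s\ge 0$, a.s. $u\,(-\partial_s+A^*)g$ is integrable on $(0,t)\times\mathbb R$ and $$\int u(t,x)g(t,x)\,dx+\int_0^t\!\!\int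 u(s,x)\,(-\partial_s+A^*)g(s,x)\,dx\,ds=\int_0^t\!\!\int\Big(\int\varphi(x-y)g(s,x)\,dx\Big)dW(s,y),$$ where $A^*g=-2\pi c\,\mathcal H(xg)$ is the adjoint of $u\mapsto 2\pi c\,x\mathcal H(u)$; * for every $t\ge 0$ and $\chi\in\mathcal S(\mathbb R)$, $\int u(t,x)\chi(x/R)\,dx\to 0$ in $L^2(\Omega)$ as $R\to\infty$ (zero spatial integral). Then there is such a solution $u$ with the following properties. (i) $u$ is a Gaussian process on $[0,\infty)\times\mathbb R$; almost surely $u(t,\cdot)\in C^\infty(\mathbb R)$ for every $t\ge 0$, and $t\mapsto u(t,x)$ is $\alpha$-Hölder continuous on $[0,T]$ for every $x\in\mathbb R$, $0<\alpha<1/2$ and $T>0$. (ii) As $t\to\infty$, $u(t)$ converges in $\mathcal S'(\mathbb R)$ to a real zero-mean Gaussian random measure $u_\infty$ acting on $\mathcal S(\mathbb R)$: $u_\infty$ is a random tempered distribution such that, for every complex-valued $g\in\mathcal S(\mathbb R)$, $\langle u_\infty,g\rangle$ is a Gaussian random variable with $\mathbb E\langle u_\infty,g\rangle=0$, and $\langle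 u(t),g\rangle=\int u(t,x)g(x)\,dx$ is square integrable over $\Omega$ and converges in law to $\langle u_\infty,g\rangle$. (iii) For all $g_1,g_2\in\mathcal S(\mathbb R)$, $$\mathbb E[\langle u_\infty,g_1\rangle\langle u_\infty,g_2\rangle]=\lim_{t\to\infty}\mathbb E[\langle u(t),g_1\rangle\langle u(t),g_2\rangle]=C\int g_1g_2\,dx-\iint\mathcal I(x-y)\,g_1(x)g_2(y)\,dx\,dy,$$ where, with $C_f=\varphi*\varphi$ and $\widehat\varphi(k)=\int e^{-2\pi ikx}\varphi(x)\,dx$, $$C=\frac{C_f(0)}{2c}=\frac1{2c}\int\varphi^2\,dx>0,\qquad \mathcal I(z)=\int_{\mathbb R}\Psi(|k|)\,e^{2\pi ikz}\,dk,\qquad \Psi(r)=\frac1c\int_r^\infty|\widehat\varphi(s)|^2\,ds,$$ and $\mathcal I$ is a continuous, even, $C^\infty$ function. Thus the limit covariance is that of a real white noise plus a smooth correction. -/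

import Mathlib

open MeasureTheory ProbabilityTheory Filter Topology Set
open scoped SchwartzMap FourierTransform NNReal ENNReal

noncomputable section

namespace DynWhiteNoise

/-- Lebesgue measure on the space-time half plane `(0, ∞)_t × ℝ_y`. -/
def spaceTime : Measure (ℝ × ℝ) := (volume.restrict (Ioi (0 : ℝ))).prod volume

/-- A real Gaussian space-time white noise `dW` on `(0, ∞) × ℝ`: the centred Gaussian family
`W f = ∫ f dW`, `f ∈ L²((0, ∞) × ℝ)`, with `E[W f * W g] = ∫ f g`. (The values of `W` at functions
that are not square integrable carry no information.) -/
structure IsWhiteNoise {Ω : Type*} [MeasurableSpace Ω] (P : Measure Ω)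
    (W : (ℝ × ℝ → ℝ) → Ω → ℝ) : Prop where
  gaussian : IsGaussianProcess (fun f : {f : ℝ × ℝ → ℝ // MemLp f 2 spaceTime} => W f.1) P
  mean_zero : ∀ f, MemLp f 2 spaceTime → ∫ ω, W f ω ∂P = 0
  covariance : ∀ f g, MemLp f 2 spaceTime → MemLp g 2 spaceTime →
    ∫ ω, W f ω * W g ω ∂P = ∫ p, f p * g p ∂spaceTime

/-- The Hilbert transform
`H f(x) = (1/π) p.v. ∫ f(y) / (x - y) dy = - (1/π) lim_{ε → 0+} ∫_ε^∞ (f(x+y) - f(x-y)) / y dy`. -/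
def hilbert (f : ℝ → ℝ) (x : ℝ) : ℝ :=
  limUnder (𝓝[>] (0 : ℝ))
    (fun ε : ℝ => -(1 / Real.pi) * ∫ y in Ioi ε, (f (x + y) - f (x - y)) / y)

/-- The formal adjoint `A* g = -2πc H(x g)` of the operator `A u = 2πc x H(u)`
(the Hilbert transform is skew-adjoint). -/
def adjointOp (c : ℝ) (g : ℝ → ℝ) (x : ℝ) : ℝ :=
  -(2 * Real.pi * c) * hilbert (fun z => z * g z) x

/-- Test functions for the weak formulation: smooth functions `g(t, x)` on `ℝ × ℝ` that are Schwartz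
in `x`, locally uniformly in `t ≥ 0` together with all their derivatives, and satisfy
`∫ x g(t, x) dx = 0`. The last condition makes `A* g(t, ·)` decay like `x⁻²`, so that it can be
integrated against a process that does not decay in `x`. It holds in particular if the Fourier
transform of `g(t, ·)` vanishes near the origin. -/
structure IsTestFunction (g : ℝ → ℝ → ℝ) : Prop where
  smooth : ContDiff ℝ (⊤ : ℕ∞) (fun p : ℝ × ℝ => g p.1 p.2)
  decay : ∀ (k n : ℕ) (T : ℝ), ∃ B : ℝ, ∀ t ∈ Icc 0 T, ∀ x : ℝ,
    |x| ^ k * ‖iteratedFDeriv ℝ n (fun p : ℝ × ℝ => g p.1 p.2) (t, x)‖ ≤ B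
  moment_zero : ∀ t, 0 ≤ t → ∫ x, x * g t x = 0

/-- The function `(-∂_s + A*) g (s, x)`. -/
def backwardOp (c : ℝ) (g : ℝ → ℝ → ℝ) (s x : ℝ) : ℝ :=
  -deriv (fun r => g r x) s + adjointOp c (g s) x

/-- The function `(s, y) ↦ 1_{(0, t]}(s) ∫ φ(x - y) g(s, x) dx`; its Wiener integral is the forcing
`f(s, x) = ∫ φ(x - y) dW(s, y)` tested against `g` on the time interval `(0, t]`. -/
def forcingKernel (φ : ℝ → ℝ) (g : ℝ → ℝ → ℝ) (t : ℝ) (p : ℝ × ℝ) : ℝ :=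
  (Ioc 0 t).indicator (fun s => ∫ x, φ (x - p.2) * g s x) p.1

/-- `u` is a global weak solution of
`∂_t u + 2πc x H(u) = f`, `u|_{t=0} = 0`, `∫ u dx = 0`, where `f(t, x) = ∫ φ(x - y) dW(t, y)`. -/
structure IsWeakSolution {Ω : Type*} [MeasurableSpace Ω] (P : Measure Ω)
    (W : (ℝ × ℝ → ℝ) → Ω → ℝ) (c : ℝ) (φ : ℝ → ℝ) (u : ℝ → ℝ → Ω → ℝ) : Prop where
  locallyIntegrable : ∀ᵐ ω ∂P,
    LocallyIntegrableOn (fun p : ℝ × ℝ => u p.1 p.2 ω) (Ici 0 ×ˢ univ)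
  /-- `u(t, ·)` can be paired with all Schwartz functions. -/
  integrable : ∀ t, 0 ≤ t → ∀ᵐ ω ∂P, ∀ g : 𝓢(ℝ, ℂ), Integrable (fun x => (u t x ω : ℂ) * g x)
  integrable_backward : ∀ g, IsTestFunction g → ∀ t, 0 < t → ∀ᵐ ω ∂P,
    Integrable (fun p : ℝ × ℝ => u p.1 p.2 ω * backwardOp c g p.1 p.2)
      ((volume.restrict (Ioc 0 t)).prod volume)
  initial : ∀ᵐ ω ∂P, ∀ x, u 0 x ω = 0
  weak : ∀ g, IsTestFunction g → ∀ t, 0 < t → ∀ᵐ ω ∂P,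
    (∫ x, u t x ω * g t x) + ∫ s in Ioc 0 t, ∫ x, u s x ω * backwardOp c g s x
      = W (forcingKernel φ g t) ω
  /-- The constraint `∫ u(t, x) dx = 0`. As `u(t, ·)` does not decay, the integral is the mean-square
  limit of the integrals `∫ u(t, x) χ(x / R) dx` as `R → ∞`, for arbitrary Schwartz `χ`. -/
  zero_mean : ∀ t, 0 ≤ t → ∀ χ : 𝓢(ℝ, ℝ),
    Tendsto (fun R : ℝ => eLpNorm (fun ω => ∫ x, u t x ω * χ (x / R)) 2 P) atTop (𝓝 0)

/-- A Gaussian random measure acting on `𝓢(ℝ)`: a random tempered distribution `μ` such that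
`⟨μ, g⟩` is a centred Gaussian random variable for every test function `g`. -/
structure IsGaussianRandomMeasure {Ω : Type*} [MeasurableSpace Ω] (P : Measure Ω)
    (μ : Ω → 𝓢'(ℝ, ℂ)) : Prop where
  gaussian : ∀ g : 𝓢(ℝ, ℂ), HasGaussianLaw (fun ω => μ ω g) P
  mean_zero : ∀ g : 𝓢(ℝ, ℂ), ∫ ω, μ ω g ∂P = 0

/-- The pairing `⟨u(t), g⟩ = ∫ u(t, x) g(x) dx`. -/
def pairing {Ω : Type*} (u : ℝ → ℝ → Ω → ℝ) (t : ℝ) (g : 𝓢(ℝ, ℂ)) (ω : Ω) : ℂ :=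
  ∫ x, (u t x ω : ℂ) * g x

/-- The spatial correlation function `C_f = φ ∗ φ` of the forcing. -/
def forcingCorrelation (φ : ℝ → ℝ) (z : ℝ) : ℝ := ∫ y, φ (z - y) * φ y

/-- `Ψ(r) = (1/c) ∫_r^∞ |φ̂(s)|² ds`. -/
def spectralTail (c : ℝ) (φ : ℝ → ℝ) (r : ℝ) : ℝ :=
  (1 / c) * ∫ s in Ioi r, ‖𝓕 (fun x : ℝ => (φ x : ℂ)) s‖ ^ 2

/-- The correction `I = 𝓕⁻¹[Ψ(|k|)]`. As `k ↦ Ψ(|k|)` is real and even, its inverse Fourier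
transform is the cosine integral `I(z) = ∫ Ψ(|k|) cos(2πkz) dk`. -/
def correction (c : ℝ) (φ : ℝ → ℝ) (z : ℝ) : ℝ :=
  ∫ k : ℝ, spectralTail c φ |k| * Real.cos (2 * Real.pi * k * z)

/-- The limiting covariance form
`(C_f(0) / (2c)) ∫ g₁ g₂ - ∫∫ I(x - y) g₁(x) g₂(y) dx dy`. -/
def limitCovariance (c : ℝ) (φ : ℝ → ℝ) (g₁ g₂ : 𝓢(ℝ, ℂ)) : ℂ :=
  ((forcingCorrelation φ 0 / (2 * c) : ℝ) : ℂ) * (∫ x, g₁ x * g₂ x)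
    - ∫ p : ℝ × ℝ, (correction c φ (p.1 - p.2) : ℂ) * g₁ p.1 * g₂ p.2

end DynWhiteNoise

end

/-! On the Fourier side the equation is a transport equation. Multiplication by x becomes a
k-derivative and the Hilbert transform becomes -i sgn(k), so 2πc x H(u) turns into c ∂_k(sgn(k) û).
Every frequency moves away from the origin at speed c, and a wave injected by the noise at time s
with frequency k has frequency k + c(t-s) sgn k at time t (`freq`). Duhamel's formula then gives
u(t, x) as a white noise integral whose kernel is the Fourier transform in k of the amplitude 1_{0 <
s ≤ t} φ̂(k) e^{2πixξ}, where ξ is the transported frequency (`solutionAmplitude` with multiplier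
`wave 0 x`). Pairing u(t) with g replaces the plane wave by 𝓕⁻g.

The Wiener isometry and Plancherel's theorem turn every second moment into an integral over (s, k)
(`integral_spectralNoise_mul_conj`). The stochastic Fubini theorem `integral_eq_spectralNoise`
reduces identities between random integrals to pointwise identities between amplitudes.

Regularity: φ̂ decays rapidly, so the amplitudes of all x-derivatives are square integrable, and the
squared L² norm of their increments is locally linear in the distance of the space-time points.
Gaussian moments scale accordingly, and Kolmogorov–Chentsov gives versions that are Hölder of every
order below 1/2. Fubini identifies each field as the x-derivative of the preceding one.

Equation: along the characteristics, 𝓕⁻g has derivative minus 𝓕⁻ of (-∂_s + A*)g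
(`hasDerivAt_fourierInv`). The weak formulation is therefore the fundamental theorem of calculus,
one amplitude at a time (`integral_backwardAmplitude`). This uses the multiplier of the principal
value Hilbert transform (`fourierInv_hilbert`). The vanishing spatial integral follows from φ̂(0) =
0, because frequencies never move closer to the origin.

Limit: after time reversal the covariance at time t is the integral over 0 < s < t and k of |φ̂(k)|²
m(k + cs sgn k), with m(ξ) = 𝓕⁻g₁(ξ) 𝓕⁻g₂(-ξ). It converges because m decays while the frequency
grows. Substituting ξ = k + cs and integrating in s first leaves the weight Ψ(0) - Ψ(|ξ|) against m
(`integral_Ioi_integral_powerSpectrum`): Ψ(0) = C is the white noise and Ψ(|ξ|) is the smooth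
correction. The limit itself lives on the same probability space as (1 - ∂_x²)V, with V a continuous
Gaussian field whose amplitude extends over all s > 0. Centred complex Gaussians converge in law
once their covariances and pseudo-covariances do. -/

noncomputable section

namespace DynWhiteNoise

section

/-! ### The Kolmogorov–Chentsov theorem for processes indexed by the plane -/

/-- The point of the dyadic grid of mesh `2⁻ⁿ` with integer coordinates `z`. -/
def gridPoint (n : ℕ) (z : ℤ × ℤ) : ℝ × ℝ := (z.1 / 2 ^ n, z.2 / 2 ^ n)

/-- Integer coordinates of the lower left corner of the dyadic square containing `p`. -/
def gridFloor (n : ℕ) (p : ℝ × ℝ) : ℤ × ℤ := (⌊2 ^ n * p.1⌋, ⌊2 ^ n * p.2⌋)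

/-- The grid coordinates of the square `[-N, N]²`. -/
def gridBox (N n : ℕ) : Finset (ℤ × ℤ) :=
  Finset.Icc (-(N * 2 ^ n : ℤ)) (N * 2 ^ n) ×ˢ Finset.Icc (-(N * 2 ^ n : ℤ)) (N * 2 ^ n)

/-- The offsets to neighbouring grid points. -/
def gridSteps : Finset (ℤ × ℤ) := Finset.Icc (-1) 1 ×ˢ Finset.Icc (-1) 1

lemma floor_mem_gridInterval {N n : ℕ} {x : ℝ} (hx : |x| ≤ N) :
    ⌊2 ^ n * x⌋ ∈ Finset.Icc (-(N * 2 ^ n : ℤ)) (N * 2 ^ n) := by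
  have h2 : (0 : ℝ) < 2 ^ n := by positivity
  obtain ⟨h1, h3⟩ := abs_le.1 hx
  rw [Finset.mem_Icc]
  constructor
  · rw [Int.le_floor]; push_cast; nlinarith
  · have : (⌊2 ^ n * x⌋ : ℝ) ≤ N * 2 ^ n := (Int.floor_le _).trans (by nlinarith)
    exact_mod_cast this

lemma gridFloor_mem_gridBox {N n : ℕ} {p : ℝ × ℝ} (hp : ‖p‖ ≤ N) :
    gridFloor n p ∈ gridBox N n := by
  rw [Prod.norm_def, max_le_iff] at hp
  exact Finset.mem_product.2 ⟨floor_mem_gridInterval hp.1, floor_mem_gridInterval hp.2⟩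

lemma floor_sub_floor_mem {a b : ℝ} (h : |a - b| ≤ 1) : ⌊b⌋ - ⌊a⌋ ∈ Finset.Icc (-1 : ℤ) 1 := by
  obtain ⟨h1, h2⟩ := abs_le.1 h
  rw [Finset.mem_Icc]
  have := Int.floor_le a
  have := Int.lt_floor_add_one a
  have := Int.floor_le b
  have := Int.lt_floor_add_one b
  constructor
  · have : ((-2 : ℤ) : ℝ) < (⌊b⌋ - ⌊a⌋ : ℤ) := by push_cast; linarith
    have := Int.cast_lt.1 this
    omega
  · have : ((⌊b⌋ - ⌊a⌋ : ℤ) : ℝ) < (2 : ℤ) := by push_cast; linarith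
    have := Int.cast_lt.1 this
    omega

lemma gridFloor_sub_mem_gridSteps {n : ℕ} {p q : ℝ × ℝ} (h : ‖p - q‖ ≤ (1 / 2) ^ n) :
    gridFloor n q - gridFloor n p ∈ gridSteps := by
  rw [Prod.norm_def, max_le_iff] at h
  have h2 : (0 : ℝ) < 2 ^ n := by positivity
  have key : ∀ a b : ℝ, ‖a - b‖ ≤ (1 / 2) ^ n → |2 ^ n * a - 2 ^ n * b| ≤ 1 := by
    intro a b hab
    rw [← mul_sub, abs_mul, abs_of_pos h2]
    rw [Real.norm_eq_abs, one_div, inv_pow] at hab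
    calc _ ≤ 2 ^ n * (2 ^ n : ℝ)⁻¹ := by gcongr
      _ = 1 := by field_simp
  exact Finset.mem_product.2 ⟨floor_sub_floor_mem (key _ _ h.1), floor_sub_floor_mem (key _ _ h.2)⟩

/-- Since ⌊2x⌋ - 2⌊x⌋ is 0 or 1, the corner of the coarse square is a neighbour of the corner of the
fine square inside the fine grid. This is the link of the chaining argument: consecutive dyadic
approximations of p differ by one grid increment. -/
lemma gridFloor_succ (n : ℕ) (p : ℝ × ℝ) :
    ∃ e ∈ gridSteps, gridPoint n (gridFloor n p) = gridPoint (n + 1) (gridFloor (n + 1) p + e) := by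
  have key : ∀ x : ℝ, 2 * ⌊x⌋ - ⌊2 * x⌋ ∈ Finset.Icc (-1 : ℤ) 1 := by
    intro x
    rw [Finset.mem_Icc]
    have := Int.floor_le x
    have := Int.lt_floor_add_one x
    have := Int.floor_le (2 * x)
    have := Int.lt_floor_add_one (2 * x)
    constructor
    · have : ((-2 : ℤ) : ℝ) < (2 * ⌊x⌋ - ⌊2 * x⌋ : ℤ) := by push_cast; linarith
      have := Int.cast_lt.1 this
      omega
    · have : ((2 * ⌊x⌋ - ⌊2 * x⌋ : ℤ) : ℝ) < (2 : ℤ) := by push_cast; linarith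
      have := Int.cast_lt.1 this
      omega
  have e1 : ∀ x : ℝ, (2 : ℝ) ^ (n + 1) * x = 2 * (2 ^ n * x) := fun x => by ring
  refine ⟨(2 * ⌊2 ^ n * p.1⌋ - ⌊2 * (2 ^ n * p.1)⌋, 2 * ⌊2 ^ n * p.2⌋ - ⌊2 * (2 ^ n * p.2)⌋),
    Finset.mem_product.2 ⟨key _, key _⟩, ?_⟩
  simp only [gridPoint, gridFloor, e1, Prod.mk_add_mk, Prod.mk.injEq]
  constructor <;> (push_cast; rw [pow_succ]; field_simp; ring)

lemma norm_gridPoint_gridFloor_sub_le (n : ℕ) (p : ℝ × ℝ) :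
    ‖gridPoint n (gridFloor n p) - p‖ ≤ (1 / 2) ^ n := by
  have h2 : (0 : ℝ) < 2 ^ n := by positivity
  have key : ∀ x : ℝ, ‖(⌊2 ^ n * x⌋ : ℝ) / 2 ^ n - x‖ ≤ (1 / 2) ^ n := by
    intro x
    have := Int.floor_le (2 ^ n * x)
    have := Int.lt_floor_add_one (2 ^ n * x)
    have e : (⌊2 ^ n * x⌋ : ℝ) / 2 ^ n - x = (⌊2 ^ n * x⌋ - 2 ^ n * x) / 2 ^ n := by field_simp
    rw [e, norm_div, Real.norm_eq_abs, Real.norm_eq_abs, abs_of_pos h2, one_div, inv_pow,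
      div_eq_mul_inv]
    refine mul_le_of_le_one_left (by positivity) (abs_le.2 ⟨by linarith, by linarith⟩)
  rw [Prod.norm_def]
  exact max_le (key _) (key _)

/-- A bound on the increments of `x` between neighbouring grid points of `[-N, N]²`. -/
def GridHolder (x : ℝ × ℝ → ℝ) (N : ℕ) (γ : ℝ) : Prop :=
  ∃ K : ℝ, ∀ n, ∀ z ∈ gridBox N n, ∀ e ∈ gridSteps,
    |x (gridPoint n z) - x (gridPoint n (z + e))| ≤ K * ((1 / 2 : ℝ) ^ γ) ^ n

lemma GridHolder.dist_succ_le {x : ℝ × ℝ → ℝ} {N : ℕ} {r K : ℝ}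
    (hK : ∀ n, ∀ z ∈ gridBox N n, ∀ e ∈ gridSteps,
      |x (gridPoint n z) - x (gridPoint n (z + e))| ≤ K * r ^ n)
    {p : ℝ × ℝ} (hp : ‖p‖ ≤ N) (n : ℕ) :
    dist (x (gridPoint n (gridFloor n p))) (x (gridPoint (n + 1) (gridFloor (n + 1) p)))
      ≤ K * r * r ^ n := by
  obtain ⟨e, he, h⟩ := gridFloor_succ n p
  rw [dist_comm, Real.dist_eq, h, mul_assoc, ← pow_succ']
  exact hK _ _ (gridFloor_mem_gridBox hp) e he

lemma half_rpow_lt_one {γ : ℝ} (hγ : 0 < γ) : (1 / 2 : ℝ) ^ γ < 1 :=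
  Real.rpow_lt_one (by norm_num) (by norm_num) hγ

lemma GridHolder.exists_tendsto {x : ℝ × ℝ → ℝ} {N : ℕ} {γ : ℝ} (hγ : 0 < γ)
    (h : GridHolder x N γ) {p : ℝ × ℝ} (hp : ‖p‖ ≤ N) :
    ∃ y, Tendsto (fun n => x (gridPoint n (gridFloor n p))) atTop (𝓝 y) := by
  obtain ⟨K, hK⟩ := h
  exact cauchySeq_tendsto_of_complete
    (cauchySeq_of_le_geometric _ _ (half_rpow_lt_one hγ) (GridHolder.dist_succ_le hK hp))

/-- Choose the scale n with 2⁻⁽ⁿ⁺¹⁾ < ‖p - q‖ ≤ 2⁻ⁿ. At that scale the corners of p and q are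
neighbours, and each limit is within a geometric tail of the value at its corner. -/
lemma GridHolder.holder_limit {x y : ℝ × ℝ → ℝ} {N : ℕ} {γ : ℝ} (hγ : 0 < γ)
    (h : GridHolder x N γ)
    (hy : ∀ p, ‖p‖ ≤ N → Tendsto (fun n => x (gridPoint n (gridFloor n p))) atTop (𝓝 (y p))) :
    ∃ C : ℝ, ∀ p q, ‖p‖ ≤ N → ‖q‖ ≤ N → ‖p - q‖ ≤ 1 → |y p - y q| ≤ C * ‖p - q‖ ^ γ := by
  obtain ⟨K, hK⟩ := h
  set r : ℝ := (1 / 2 : ℝ) ^ γ with hr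
  have hr0 : 0 < r := by positivity
  have hr1 : r < 1 := half_rpow_lt_one hγ
  have hr2 : 0 < 1 - r := by linarith
  have hK0 : 0 ≤ K := by
    have := hK 0 0 (by simp [gridBox]) 0 (by simp [gridSteps])
    simpa using this
  have hlim : ∀ p, ‖p‖ ≤ N → ∀ n, |x (gridPoint n (gridFloor n p)) - y p|
      ≤ K * r * r ^ n / (1 - r) := fun p hp n =>
    dist_le_of_le_geometric_of_tendsto _ _ hr1 (GridHolder.dist_succ_le hK hp) (hy p hp) n
  -- One increment between the corners plus two geometric tails. The division by `r` pays for ‖p -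
  -- q‖ being comparable to 2⁻ⁿ only up to a factor 2.
  refine ⟨(K + 2 * (K * r / (1 - r))) / r, fun p q hp hq hpq => ?_⟩
  have hC : 0 ≤ (K + 2 * (K * r / (1 - r))) / r := by positivity
  rcases (norm_nonneg (p - q)).eq_or_lt with h0 | h0
  · rw [eq_comm, norm_eq_zero, sub_eq_zero] at h0
    subst h0
    simp only [sub_self, abs_zero]
    positivity
  obtain ⟨n, hn1, hn2⟩ := exists_nat_pow_near_of_lt_one h0 hpq (y := (1 / 2 : ℝ)) (by norm_num)
    (by norm_num)
  have h1 : |x (gridPoint n (gridFloor n p)) - x (gridPoint n (gridFloor n q))| ≤ K * r ^ n := by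
    have := hK n _ (gridFloor_mem_gridBox hp) _ (gridFloor_sub_mem_gridSteps hn2)
    simpa using this
  have h2 := hlim p hp n
  have h3 := hlim q hq n
  have h4 : |y p - y q| ≤ (K + 2 * (K * r / (1 - r))) * r ^ n := by
    have e : (K + 2 * (K * r / (1 - r))) * r ^ n
      = K * r ^ n + K * r * r ^ n / (1 - r) + K * r * r ^ n / (1 - r) := by ring
    rw [e]
    rw [abs_le] at *
    constructor <;> linarith [h1.1, h1.2, h2.1, h2.2, h3.1, h3.2]
  have h5 : r ^ n * r ≤ ‖p - q‖ ^ γ := by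
    rw [← pow_succ, hr, ← Real.rpow_natCast, ← Real.rpow_mul (by norm_num), mul_comm,
      Real.rpow_mul (by norm_num), Real.rpow_natCast]
    exact Real.rpow_le_rpow (by positivity) hn1.le hγ.le
  refine h4.trans ?_
  rw [div_mul_eq_mul_div, le_div_iff₀ hr0, mul_assoc]
  gcongr

lemma continuous_of_forall_local_holder {y : ℝ × ℝ → ℝ}
    (h : ∀ N : ℕ, ∃ γ : ℝ, 0 < γ ∧ ∃ C : ℝ, ∀ p q, ‖p‖ ≤ N → ‖q‖ ≤ N → ‖p - q‖ ≤ 1 →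
      |y p - y q| ≤ C * ‖p - q‖ ^ γ) : Continuous y := by
  rw [continuous_iff_continuousAt]
  intro p
  obtain ⟨N, hN⟩ := exists_nat_ge (‖p‖ + 1)
  obtain ⟨γ, hγ, C, hC⟩ := h N
  rw [ContinuousAt, tendsto_iff_norm_sub_tendsto_zero]
  have h1 : Tendsto (fun q : ℝ × ℝ => C * ‖q - p‖ ^ γ) (𝓝 p) (𝓝 0) := by
    have : Tendsto (fun q : ℝ × ℝ => C * ‖q - p‖ ^ γ) (𝓝 p) (𝓝 (C * ‖p - p‖ ^ γ)) := by
      apply Tendsto.const_mul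
      exact ((continuous_id.sub continuous_const).norm.rpow_const fun _ => Or.inr hγ.le).tendsto p
    simpa [Real.zero_rpow hγ.ne'] using this
  refine squeeze_zero' (Eventually.of_forall fun _ => norm_nonneg _) ?_ h1
  filter_upwards [Metric.ball_mem_nhds p one_pos] with q hq
  rw [Metric.mem_ball, dist_eq_norm] at hq
  refine hC q p ?_ (by linarith) hq.le
  linarith [norm_le_norm_add_norm_sub' q p]

lemma holder_of_local_holder {y : ℝ × ℝ → ℝ} (hy : Continuous y) {N : ℕ} {γ C : ℝ} (hγ : 0 ≤ γ)
    (h : ∀ p q, ‖p‖ ≤ N → ‖q‖ ≤ N → ‖p - q‖ ≤ 1 → |y p - y q| ≤ C * ‖p - q‖ ^ γ) :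
    ∃ C' : ℝ, ∀ p q, ‖p‖ ≤ N → ‖q‖ ≤ N → |y p - y q| ≤ C' * ‖p - q‖ ^ γ := by
  obtain ⟨M, hM⟩ := (isCompact_closedBall (0 : ℝ × ℝ) N).exists_bound_of_continuousOn hy.continuousOn
  simp only [mem_closedBall_zero_iff, Real.norm_eq_abs] at hM
  refine ⟨max C (2 * M), fun p q hp hq => ?_⟩
  rcases le_total ‖p - q‖ 1 with h1 | h1
  · exact (h p q hp hq h1).trans (by gcongr; exact le_max_left _ _)
  · have h2 := Real.one_le_rpow h1 hγ
    have h3 := hM p hp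
    have h4 := hM q hq
    calc |y p - y q| ≤ |y p| + |y q| := abs_sub _ _
      _ ≤ 2 * M := by linarith
      _ ≤ max C (2 * M) * 1 := by rw [mul_one]; exact le_max_right _ _
      _ ≤ _ := by
        gcongr
        exact le_trans (by linarith [abs_nonneg (y p)]) (le_max_right C (2 * M))

/-- The exponent `(m - 3) / (2m)` obtained from moments of order `2m`. -/
def holderExponent (m : ℕ) : ℝ := (m - 3) / (2 * m)

lemma holderExponent_pos {m : ℕ} (hm : 4 ≤ m) : 0 < holderExponent m := by
  have : (4 : ℝ) ≤ m := by exact_mod_cast hm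
  exact div_pos (by linarith) (by linarith)

lemma exists_le_holderExponent {α : ℝ} (hα : α < 1 / 2) : ∃ m : ℕ, 4 ≤ m ∧ α ≤ holderExponent m := by
  obtain ⟨m, hm⟩ := exists_nat_ge (max 4 (3 / (1 - 2 * α)))
  rw [max_le_iff] at hm
  refine ⟨m, by exact_mod_cast hm.1, ?_⟩
  rw [holderExponent, le_div_iff₀ (by linarith)]
  have := hm.2
  rw [div_le_iff₀ (by linarith)] at this
  linarith

/-! ### Moment bounds on dyadic grids and the continuous modification -/

section

variable {Ω : Type*} [MeasurableSpace Ω]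

/-- The sum of the `2m`-th powers of the increments over the grid. -/
def gridSum (X : ℝ × ℝ → Ω → ℝ) (N m n : ℕ) (ω : Ω) : ℝ≥0∞ :=
  ∑ z ∈ gridBox N n, ∑ e ∈ gridSteps, ‖X (gridPoint n z) ω - X (gridPoint n (z + e)) ω‖ₑ ^ (2 * m)

/-- The weighted sum of the increments over all grids. -/
def gridSeries (X : ℝ × ℝ → Ω → ℝ) (N m : ℕ) (ω : Ω) : ℝ≥0∞ :=
  ∑' n, (2 : ℝ≥0∞) ^ (n * (m - 3)) * gridSum X N m n ω

lemma measurable_gridSum {X : ℝ × ℝ → Ω → ℝ} (hX : ∀ p, Measurable (X p)) (N m n : ℕ) :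
    Measurable (gridSum X N m n) := by
  unfold gridSum
  refine Finset.measurable_fun_sum _ fun z _ => Finset.measurable_fun_sum _ fun e _ => ?_
  exact (((hX _).sub (hX _)).enorm).pow_const _

lemma measurable_gridSeries {X : ℝ × ℝ → Ω → ℝ} (hX : ∀ p, Measurable (X p)) (N m : ℕ) :
    Measurable (gridSeries X N m) :=
  Measurable.tsum fun n => (measurable_gridSum hX N m n).const_mul _

-- A single term of the series bounds the 2m-th power of each increment by S 2^{-n(m-3)}. Its 2m-th
-- root decays with the rate `holderExponent m` per dyadic level.
omit [MeasurableSpace Ω] in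
lemma gridHolder_of_gridSeries_ne_top {X : ℝ × ℝ → Ω → ℝ} {N m : ℕ} (hm : 4 ≤ m) {ω : Ω}
    (h : gridSeries X N m ω ≠ ∞) : GridHolder (fun p => X p ω) N (holderExponent m) := by
  set S := gridSeries X N m ω with hS
  have hm0 : (0 : ℝ) < 2 * m := by positivity
  refine ⟨S.toReal ^ (1 / (2 * m : ℝ)), fun n z hz e he => ?_⟩
  set d := |X (gridPoint n z) ω - X (gridPoint n (z + e)) ω| with hd
  have h1 : (2 : ℝ≥0∞) ^ (n * (m - 3)) * ‖X (gridPoint n z) ω - X (gridPoint n (z + e)) ω‖ₑ ^ (2 * m)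
      ≤ S := by
    refine le_trans ?_ (ENNReal.le_tsum n)
    gcongr
    refine le_trans ?_ (Finset.single_le_sum (f := fun z => ∑ e ∈ gridSteps,
      ‖X (gridPoint n z) ω - X (gridPoint n (z + e)) ω‖ₑ ^ (2 * m)) (fun _ _ => zero_le) hz)
    exact Finset.single_le_sum (f := fun e =>
      ‖X (gridPoint n z) ω - X (gridPoint n (z + e)) ω‖ₑ ^ (2 * m)) (fun _ _ => zero_le) he
  have h2 : (2 : ℝ) ^ (n * (m - 3)) * d ^ (2 * m) ≤ S.toReal := by
    have := ENNReal.toReal_mono h h1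
    simpa [ENNReal.toReal_mul, ENNReal.toReal_pow] using this
  have h3 : d ^ (2 * m) ≤ S.toReal * ((1 / 2 : ℝ) ^ (n * (m - 3))) := by
    rw [one_div, inv_pow, ← div_eq_mul_inv, le_div_iff₀ (by positivity)]
    linarith
  have h4 : d = (d ^ (2 * m)) ^ (1 / (2 * m : ℝ)) := by
    rw [← Real.rpow_natCast, ← Real.rpow_mul (abs_nonneg _)]
    push_cast
    rw [mul_one_div_cancel hm0.ne', Real.rpow_one]
  rw [h4]
  refine (Real.rpow_le_rpow (by positivity) h3 (by positivity)).trans (le_of_eq ?_)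
  rw [Real.mul_rpow ENNReal.toReal_nonneg (by positivity)]
  congr 1
  rw [← Real.rpow_natCast, ← Real.rpow_natCast, ← Real.rpow_mul (by norm_num),
    ← Real.rpow_mul (by norm_num), holderExponent, Nat.cast_mul, Nat.cast_sub (by omega)]
  congr 1
  push_cast
  ring

lemma card_gridBox (N n : ℕ) : ((gridBox N n).card : ℝ≥0∞) ≤ (2 * N + 1) ^ 2 * 4 ^ n := by
  have h : (gridBox N n).card ≤ (2 * N + 1) ^ 2 * 4 ^ n := by
    rw [gridBox, Finset.card_product, Int.card_Icc, ← sq]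
    have e : ((N * 2 ^ n : ℤ) + 1 - -(N * 2 ^ n)).toNat = 2 * N * 2 ^ n + 1 := by
      have : (N * 2 ^ n : ℤ) + 1 - -(N * 2 ^ n) = ((2 * N * 2 ^ n + 1 : ℕ) : ℤ) := by
        push_cast; ring
      rw [this, Int.toNat_natCast]
    rw [e]
    have e2 : (4 : ℕ) ^ n = (2 ^ n) ^ 2 := by rw [← pow_mul, mul_comm, pow_mul]; norm_num
    rw [e2, ← mul_pow]
    refine Nat.pow_le_pow_left ?_ 2
    have : 1 ≤ 2 ^ n := Nat.one_le_two_pow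
    nlinarith
  exact_mod_cast h

lemma norm_gridPoint_le {N n : ℕ} {z e : ℤ × ℤ} (hz : z ∈ gridBox N n) (he : e ∈ gridSteps) :
    ‖gridPoint n (z + e)‖ ≤ ((N + 1 : ℕ) : ℝ) := by
  have key : ∀ a b : ℤ, a ∈ Finset.Icc (-(N * 2 ^ n : ℤ)) (N * 2 ^ n) → b ∈ Finset.Icc (-1 : ℤ) 1 →
      ‖((a + b : ℤ) : ℝ) / 2 ^ n‖ ≤ ((N + 1 : ℕ) : ℝ) := by
    intro a b ha hb
    rw [Finset.mem_Icc] at ha hb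
    have h1 : (1 : ℤ) ≤ 2 ^ n := one_le_pow₀ (by norm_num)
    have h2 : |a + b| ≤ (N + 1) * 2 ^ n := abs_le.2 ⟨by nlinarith, by nlinarith⟩
    have h3 : |((a + b : ℤ) : ℝ)| ≤ (N + 1) * 2 ^ n := by exact_mod_cast h2
    rw [norm_div, Real.norm_eq_abs, Real.norm_eq_abs, abs_of_pos (by positivity : (0 : ℝ) < 2 ^ n),
      div_le_iff₀ (by positivity)]
    push_cast at h3 ⊢
    exact h3
  obtain ⟨h1, h2⟩ := Finset.mem_product.1 hz
  obtain ⟨h3, h4⟩ := Finset.mem_product.1 he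
  rw [Prod.norm_def]
  exact max_le (key _ _ h1 h3) (key _ _ h2 h4)

lemma norm_gridPoint_sub_le (n : ℕ) (z : ℤ × ℤ) {e : ℤ × ℤ} (he : e ∈ gridSteps) :
    ‖gridPoint n z - gridPoint n (z + e)‖ ≤ (1 / 2) ^ n := by
  have key : ∀ a b : ℤ, b ∈ Finset.Icc (-1 : ℤ) 1 →
      ‖(a : ℝ) / 2 ^ n - ((a + b : ℤ) : ℝ) / 2 ^ n‖ ≤ (1 / 2) ^ n := by
    intro a b hb
    rw [Finset.mem_Icc] at hb
    have h2 : |b| ≤ 1 := abs_le.2 hb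
    have h3 : |(b : ℝ)| ≤ 1 := by exact_mod_cast h2
    have e : (a : ℝ) / 2 ^ n - ((a + b : ℤ) : ℝ) / 2 ^ n = - (b / 2 ^ n) := by push_cast; ring
    rw [e, norm_neg, norm_div, Real.norm_eq_abs, Real.norm_eq_abs,
      abs_of_pos (by positivity : (0 : ℝ) < 2 ^ n), one_div, inv_pow, div_eq_mul_inv]
    exact mul_le_of_le_one_left (by positivity) h3
  obtain ⟨h3, h4⟩ := Finset.mem_product.1 he
  rw [Prod.norm_def]
  exact max_le (key _ _ h3) (key _ _ h4)

/-- The moment condition of Kolmogorov's criterion, of all orders and locally in the plane. -/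
def KolmogorovMoments (P : Measure Ω) (X : ℝ × ℝ → Ω → ℝ) : Prop :=
  ∀ N m : ℕ, ∃ C : ℝ≥0, ∀ p q : ℝ × ℝ, ‖p‖ ≤ N → ‖q‖ ≤ N →
    ∫⁻ ω, ‖X p ω - X q ω‖ₑ ^ (2 * m) ∂P ≤ C * ENNReal.ofReal ‖p - q‖ ^ m

/-- Level n has of order 4ⁿ increments, each with 2m-th moment of order 2^{-nm}. The weight
2^{n(m-3)} leaves the summable factor 2⁻ⁿ, and this is why the exponent has m - 3 and not m - 2. -/
lemma lintegral_gridSeries_ne_top {P : Measure Ω} {X : ℝ × ℝ → Ω → ℝ} (hX : ∀ p, Measurable (X p))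
    (hK : KolmogorovMoments P X) {N m : ℕ} (hm : 4 ≤ m) : ∫⁻ ω, gridSeries X N m ω ∂P ≠ ∞ := by
  -- A neighbour of a grid point of [-N, N]² may lie outside that square, hence the larger radius.
  obtain ⟨C, hC⟩ := hK (N + 1) m
  have hS : ∀ n, ∫⁻ ω, gridSum X N m n ω ∂P
      ≤ (2 * N + 1) ^ 2 * 4 ^ n * (9 * (C * (2⁻¹ : ℝ≥0∞) ^ (n * m))) := by
    intro n
    unfold gridSum
    have hmeas : ∀ z e : ℤ × ℤ, Measurable fun ω =>
        ‖X (gridPoint n z) ω - X (gridPoint n (z + e)) ω‖ₑ ^ (2 * m) := fun z e =>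
      (((hX _).sub (hX _)).enorm).pow_const _
    rw [lintegral_finsetSum _ fun z _ => Finset.measurable_fun_sum _ fun e _ => hmeas z e]
    refine (Finset.sum_le_card_nsmul _ _ (9 * (C * (2⁻¹ : ℝ≥0∞) ^ (n * m))) fun z hz => ?_).trans ?_
    · rw [lintegral_finsetSum _ fun e _ => hmeas z e]
      refine (Finset.sum_le_card_nsmul _ _ (C * (2⁻¹ : ℝ≥0∞) ^ (n * m)) fun e he => ?_).trans ?_
      · have h0 : (0 : ℤ × ℤ) ∈ gridSteps := by simp [gridSteps]
        have h1 : ‖gridPoint n z‖ ≤ ((N + 1 : ℕ) : ℝ) := by simpa using norm_gridPoint_le hz h0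
        refine (hC _ _ h1 (norm_gridPoint_le hz he)).trans ?_
        rw [pow_mul]
        gcongr
        refine (ENNReal.ofReal_le_ofReal (norm_gridPoint_sub_le n z he)).trans (le_of_eq ?_)
        rw [ENNReal.ofReal_pow (by norm_num), one_div, ENNReal.ofReal_inv_of_pos (by norm_num)]
        simp
      · have : gridSteps.card = 9 := by rfl
        rw [this, nsmul_eq_mul]
        norm_num
    · rw [nsmul_eq_mul]
      gcongr
      exact card_gridBox N n
  have hT : ∫⁻ ω, gridSeries X N m ω ∂P
      ≤ ∑' n : ℕ, ((2 * N + 1) ^ 2 * 9 * C : ℝ≥0∞) * (2⁻¹ : ℝ≥0∞) ^ n := by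
    unfold gridSeries
    rw [lintegral_tsum fun n => ((measurable_gridSum hX N m n).const_mul _).aemeasurable]
    refine ENNReal.tsum_le_tsum fun n => ?_
    rw [lintegral_const_mul _ (measurable_gridSum hX N m n)]
    refine (mul_le_mul_right (hS n) _).trans (le_of_eq ?_)
    obtain ⟨j, rfl⟩ : ∃ j, m = j + 3 := ⟨m - 3, by omega⟩
    have e4 : (4 : ℝ≥0∞) ^ n = 2 ^ (n * 2) := by rw [mul_comm, pow_mul]; norm_num
    have e5 : n * (j + 3) = n * j + n * 2 + n := by ring
    have hc : ∀ i : ℕ, (2 : ℝ≥0∞) ^ i * (2⁻¹) ^ i = 1 := fun i => by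
      rw [← mul_pow, ENNReal.mul_inv_cancel (by norm_num) (by norm_num), one_pow]
    rw [Nat.add_sub_cancel, e4, e5, pow_add _ (n * j + n * 2) n, pow_add _ (n * j) (n * 2)]
    calc _ = ((2 : ℝ≥0∞) ^ (n * j) * (2⁻¹) ^ (n * j)) * ((2 : ℝ≥0∞) ^ (n * 2) * (2⁻¹) ^ (n * 2))
          * ((2 * N + 1) ^ 2 * 9 * C * (2⁻¹ : ℝ≥0∞) ^ n) := by ring
      _ = _ := by rw [hc, hc, one_mul, one_mul]
  refine ne_top_of_le_ne_top ?_ hT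
  rw [ENNReal.tsum_mul_left, ENNReal.tsum_geometric]
  refine ENNReal.mul_ne_top (ENNReal.mul_ne_top ?_ (by simp)) (by simp)
  exact ENNReal.mul_ne_top (ENNReal.pow_ne_top (by finiteness)) (by norm_num)

/-- The values at `p` of a modification are in probability limits along the grid. -/
lemma ae_eq_of_tendsto_grid {P : Measure Ω} [IsFiniteMeasure P] {X : ℝ × ℝ → Ω → ℝ}
    (hX : ∀ p, Measurable (X p)) (hK : KolmogorovMoments P X) {p : ℝ × ℝ} {Y : Ω → ℝ}
    (hY : ∀ᵐ ω ∂P, Tendsto (fun n => X (gridPoint n (gridFloor n p)) ω) atTop (𝓝 (Y ω))) :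
    Y =ᵐ[P] X p := by
  obtain ⟨N, hN⟩ := exists_nat_ge (‖p‖ + 1)
  obtain ⟨C, hC⟩ := hK N 1
  have h1 : TendstoInMeasure P (fun n => X (gridPoint n (gridFloor n p))) atTop Y :=
    tendstoInMeasure_of_tendsto_ae (fun n => (hX _).aestronglyMeasurable) hY
  have h2 : TendstoInMeasure P (fun n => X (gridPoint n (gridFloor n p))) atTop (X p) := by
    refine tendstoInMeasure_of_tendsto_eLpNorm (p := 2) (by norm_num)
      (fun n => (hX _).aestronglyMeasurable) (hX p).aestronglyMeasurable ?_
    have e : ∀ n, eLpNorm (X (gridPoint n (gridFloor n p)) - X p) 2 P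
        ≤ (C * ENNReal.ofReal ((1 / 2) ^ n)) ^ (1 / 2 : ℝ) := by
      intro n
      have hd := norm_gridPoint_gridFloor_sub_le n p
      rw [eLpNorm_eq_lintegral_rpow_enorm_toReal (by norm_num) (by norm_num)]
      simp only [ENNReal.toReal_ofNat]
      gcongr
      refine le_trans (le_of_eq ?_) ((hC (gridPoint n (gridFloor n p)) p ?_ (by linarith)).trans ?_)
      · refine lintegral_congr fun ω => ?_
        rw [Pi.sub_apply, mul_one, ← ENNReal.rpow_natCast]
        norm_num
      · have : ((1 : ℝ) / 2) ^ n ≤ 1 := pow_le_one₀ (by norm_num) (by norm_num)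
        linarith [norm_le_norm_add_norm_sub' (gridPoint n (gridFloor n p)) p]
      · rw [pow_one]
        gcongr
    refine tendsto_of_tendsto_of_tendsto_of_le_of_le tendsto_const_nhds ?_ (fun _ => zero_le) e
    have h3 : Tendsto (fun n : ℕ => (C : ℝ≥0∞) * ENNReal.ofReal ((1 / 2 : ℝ) ^ n)) atTop (𝓝 0) := by
      have h4 : Tendsto (fun n : ℕ => ENNReal.ofReal ((1 / 2 : ℝ) ^ n)) atTop (𝓝 0) := by
        rw [← ENNReal.ofReal_zero]
        exact ENNReal.tendsto_ofReal
          (tendsto_pow_atTop_nhds_zero_of_lt_one (by norm_num) (by norm_num))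
      simpa using ENNReal.Tendsto.const_mul h4 (Or.inr ENNReal.coe_ne_top)
    have h5 := ((ENNReal.continuous_rpow_const (y := (1 / 2 : ℝ))).tendsto 0).comp h3
    rw [ENNReal.zero_rpow_of_pos (by norm_num)] at h5
    exact h5
  exact tendstoInMeasure_ae_unique h1 h2

/-- **Kolmogorov–Chentsov**: a process on the plane with the moment bounds `KolmogorovMoments` has
a continuous modification that is locally Hölder of every order below `1 / 2`. -/
theorem exists_holder_modification {P : Measure Ω} [IsFiniteMeasure P] {X : ℝ × ℝ → Ω → ℝ}
    (hX : ∀ p, Measurable (X p)) (hK : KolmogorovMoments P X) :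
    ∃ Y : ℝ × ℝ → Ω → ℝ, (∀ p, Measurable (Y p)) ∧ (∀ p, Y p =ᵐ[P] X p) ∧
      (∀ ω, Continuous fun p => Y p ω) ∧
      ∀ ω, ∀ α : ℝ, 0 ≤ α → α < 1 / 2 → ∀ N : ℕ, ∃ C : ℝ, ∀ p q, ‖p‖ ≤ N → ‖q‖ ≤ N →
        |Y p ω - Y q ω| ≤ C * ‖p - q‖ ^ α := by
  set G : Set Ω := {ω | ∀ N m : ℕ, 4 ≤ m → gridSeries X N m ω ≠ ∞} with hG
  have hGm : MeasurableSet G := by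
    simp only [hG, Set.ofPred_forall]
    exact MeasurableSet.iInter fun N => MeasurableSet.iInter fun m => MeasurableSet.iInter fun _ =>
      (measurable_gridSeries hX N m) (measurableSet_singleton ∞).compl
  have hGae : ∀ᵐ ω ∂P, ω ∈ G := by
    simp only [hG, Set.mem_ofPred_eq, ae_all_iff]
    intro N m hm
    filter_upwards [ae_lt_top (measurable_gridSeries hX N m) (lintegral_gridSeries_ne_top hX hK hm)]
      with ω h using h.ne
  -- Putting the process to zero off the full-measure event G makes the dyadic limits exist for
  -- every ω, so the modification is continuous everywhere and not just almost surely.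
  set X' : ℝ × ℝ → Ω → ℝ := fun p => G.indicator (X p) with hX'
  have hgrid : ∀ ω, ∀ N m : ℕ, 4 ≤ m → GridHolder (fun p => X' p ω) N (holderExponent m) := by
    intro ω N m hm
    by_cases hω : ω ∈ G
    · simp only [hX', indicator_of_mem hω]
      exact gridHolder_of_gridSeries_ne_top hm (hω N m hm)
    · simp only [hX', indicator_of_notMem hω]
      exact ⟨0, by simp⟩
  have hlim : ∀ p ω, ∃ y, Tendsto (fun n => X' (gridPoint n (gridFloor n p)) ω) atTop (𝓝 y) := by
    intro p ω
    obtain ⟨N, hN⟩ := exists_nat_ge ‖p‖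
    exact (hgrid ω N 4 le_rfl).exists_tendsto (holderExponent_pos le_rfl) hN
  choose Y hY using hlim
  have hloc : ∀ ω (N m : ℕ), 4 ≤ m → ∃ C : ℝ, ∀ p q, ‖p‖ ≤ N → ‖q‖ ≤ N → ‖p - q‖ ≤ 1 →
      |Y p ω - Y q ω| ≤ C * ‖p - q‖ ^ holderExponent m := fun ω N m hm =>
    (hgrid ω N m hm).holder_limit (holderExponent_pos hm) fun p _ => hY p ω
  have hcont : ∀ ω, Continuous fun p => Y p ω := fun ω =>
    continuous_of_forall_local_holder fun N =>
      ⟨_, holderExponent_pos le_rfl, hloc ω N 4 le_rfl⟩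
  refine ⟨Y, fun p => ?_, fun p => ?_, hcont, fun ω α hα0 hα N => ?_⟩
  · exact measurable_of_tendsto_metrizable (fun n => (hX _).indicator hGm)
      (tendsto_pi_nhds.2 fun ω => hY p ω)
  · refine ae_eq_of_tendsto_grid hX hK ?_
    filter_upwards [hGae] with ω hω
    have := hY p ω
    simpa only [hX', indicator_of_mem hω] using this
  · obtain ⟨m, hm, hαm⟩ := exists_le_holderExponent hα
    obtain ⟨C, hC⟩ := hloc ω N m hm
    refine holder_of_local_holder (C := max C 0) (hcont ω) hα0 fun p q hp hq hpq => ?_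
    refine (hC p q hp hq hpq).trans ?_
    calc C * ‖p - q‖ ^ holderExponent m ≤ max C 0 * ‖p - q‖ ^ holderExponent m := by
          gcongr; exact le_max_left _ _
      _ ≤ max C 0 * ‖p - q‖ ^ α := by
          refine mul_le_mul_of_nonneg_left ?_ (le_max_right _ _)
          rcases (norm_nonneg (p - q)).eq_or_lt with h0 | h0
          · rw [← h0]
            rcases hα0.eq_or_lt with h1 | h1
            · rw [← h1, Real.rpow_zero, Real.zero_rpow (holderExponent_pos hm).ne']
              exact zero_le_one
            · rw [Real.zero_rpow h1.ne', Real.zero_rpow (holderExponent_pos hm).ne']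
          · exact Real.rpow_le_rpow_of_exponent_ge h0 hpq hαm

end

end

section

/-! ### The Fourier transform on `L¹ ∩ L²` -/

lemma integral_fourier_mul_eq {f g : ℝ → ℂ} (hf : Integrable f) (hg : Integrable g) :
    ∫ ξ, 𝓕 f ξ * g ξ = ∫ x, f x * 𝓕 g x := by
  have := VectorFourier.integral_fourierIntegral_smul_eq_flip (L := innerₗ ℝ) (μ := volume)
    (ν := volume) Real.continuous_fourierChar continuous_inner hf hg
  rwa [flip_innerₗ] at this

lemma continuous_fourier {f : ℝ → ℂ} (hf : Integrable f) : Continuous (𝓕 f) :=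
  VectorFourier.fourierIntegral_continuous (L := innerₗ ℝ) Real.continuous_fourierChar
    continuous_inner hf

lemma fourier_eq_integral (f : ℝ → ℂ) (w : ℝ) :
    𝓕 f w = ∫ v, Complex.exp (((-2 * Real.pi * v * w : ℝ) : ℂ) * Complex.I) * f v := by
  rw [Real.fourier_real_eq_integral_exp_smul]
  simp only [smul_eq_mul]

lemma fourierInv_eq_integral (f : ℝ → ℂ) (w : ℝ) :
    𝓕⁻ f w = ∫ v, Complex.exp (((2 * Real.pi * v * w : ℝ) : ℂ) * Complex.I) * f v := by
  rw [Real.fourierInv_eq_fourier_neg, fourier_eq_integral]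
  congr 1
  ext v
  congr 4
  ring

/-- The L² transform and the integral transform agree as distributions: against a test function both
become, by duality, the integral of f against the transform of the test function. -/
lemma coe_fourier_toLp_ae_eq {f : ℝ → ℂ} (hf : Integrable f) (hf2 : MemLp f 2) :
    ((𝓕 (hf2.toLp f) : Lp ℂ 2 (volume : Measure ℝ)) : ℝ → ℂ) =ᵐ[volume] 𝓕 f := by
  refine ae_eq_of_integral_contDiff_smul_eq
    ((Lp.memLp _).locallyIntegrable (by norm_num)) (continuous_fourier hf).locallyIntegrable ?_
  intro g hg hgc
  have hg₁ : HasCompactSupport (Complex.ofRealCLM ∘ g) := hgc.comp_left rfl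
  have hg₂ : ContDiff ℝ (⊤ : ℕ∞) (Complex.ofRealCLM ∘ g) := by fun_prop
  set G : 𝓢(ℝ, ℂ) := hg₁.toSchwartzMap hg₂ with hG
  have hGx : ∀ x, G x = (g x : ℂ) := fun x => rfl
  have h1 : ∫ x, G x • (𝓕 (hf2.toLp f) : Lp ℂ 2 (volume : Measure ℝ)) x
      = ∫ x, (𝓕 G : 𝓢(ℝ, ℂ)) x • (hf2.toLp f : ℝ → ℂ) x := by
    rw [← Lp.toTemperedDistribution_apply, ← Lp.toTemperedDistribution_apply,
      ← Lp.fourier_toTemperedDistribution_eq, TemperedDistribution.fourier_apply]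
  have h2 : ∫ x, (𝓕 G : 𝓢(ℝ, ℂ)) x • (hf2.toLp f : ℝ → ℂ) x = ∫ x, 𝓕 (G : ℝ → ℂ) x * f x := by
    refine integral_congr_ae ?_
    filter_upwards [hf2.coeFn_toLp] with x hx
    rw [hx, SchwartzMap.fourier_coe, smul_eq_mul]
  rw [h2, integral_fourier_mul_eq G.integrable hf] at h1
  simpa only [hGx, smul_eq_mul, Complex.real_smul] using h1

lemma eLpNorm_fourier {f : ℝ → ℂ} (hf : Integrable f) (hf2 : MemLp f 2) :
    eLpNorm (𝓕 f) 2 volume = eLpNorm f 2 volume := by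
  rw [← eLpNorm_congr_ae (coe_fourier_toLp_ae_eq hf hf2), ← eLpNorm_congr_ae hf2.coeFn_toLp,
    ← ENNReal.toReal_eq_toReal_iff' (Lp.memLp _).2.ne (Lp.memLp _).2.ne, ← Lp.norm_def,
    ← Lp.norm_def, Lp.norm_fourier_eq]

lemma integral_fourier_mul_conj {f g : ℝ → ℂ} (hf : Integrable f) (hf2 : MemLp f 2)
    (hg : Integrable g) (hg2 : MemLp g 2) :
    ∫ y, 𝓕 f y * starRingEnd ℂ (𝓕 g y) = ∫ k, f k * starRingEnd ℂ (g k) := by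
  have h := Lp.inner_fourier_eq (hg2.toLp g) (hf2.toLp f)
  rw [L2.inner_def, L2.inner_def] at h
  simp only [RCLike.inner_apply] at h
  have h1 : ∫ y, (𝓕 (hf2.toLp f) : Lp ℂ 2 (volume : Measure ℝ)) y
      * starRingEnd ℂ ((𝓕 (hg2.toLp g) : Lp ℂ 2 (volume : Measure ℝ)) y)
      = ∫ y, 𝓕 f y * starRingEnd ℂ (𝓕 g y) := by
    refine integral_congr_ae ?_
    filter_upwards [coe_fourier_toLp_ae_eq hf hf2, coe_fourier_toLp_ae_eq hg hg2] with x h1 h2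
    rw [h1, h2]
  have h2 : ∫ y, (hf2.toLp f : ℝ → ℂ) y * starRingEnd ℂ ((hg2.toLp g : ℝ → ℂ) y)
      = ∫ k, f k * starRingEnd ℂ (g k) := by
    refine integral_congr_ae ?_
    filter_upwards [hf2.coeFn_toLp, hg2.coeFn_toLp] with x h1 h2
    rw [h1, h2]
  rw [← h1, ← h2]
  exact h

/-! ### Spectral amplitudes -/

instance : SFinite spaceTime := by unfold spaceTime; infer_instance

/-- A measurable function of time and frequency dominated by a product of square integrable
functions, integrable in frequency. -/
structure IsAmplitude (a : ℝ × ℝ → ℂ) : Prop where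
  measurable : Measurable a
  dominated : ∃ β γ : ℝ → ℝ, MemLp β 2 (volume.restrict (Ioi 0)) ∧ Integrable γ ∧ MemLp γ 2 ∧
    ∀ s, 0 < s → ∀ k, ‖a (s, k)‖ ≤ β s * γ k

/-- The space-time function with spectral amplitude `a`: the Fourier transform in the second
variable. -/
def kernel (a : ℝ × ℝ → ℂ) (p : ℝ × ℝ) : ℂ := 𝓕 (fun k => a (p.1, k)) p.2

lemma measurable_kernel {a : ℝ × ℝ → ℂ} (ha : Measurable a) : Measurable (kernel a) := by
  have : kernel a = fun p => ∫ v : ℝ,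
      Complex.exp (((-2 * Real.pi * v * p.2 : ℝ) : ℂ) * Complex.I) * a (p.1, v) := by
    ext p
    rw [kernel, fourier_eq_integral]
  rw [this]
  refine (StronglyMeasurable.integral_prod_right
    (f := fun (p : ℝ × ℝ) (v : ℝ) =>
      Complex.exp (((-2 * Real.pi * v * p.2 : ℝ) : ℂ) * Complex.I) * a (p.1, v)) ?_).measurable
  apply Measurable.stronglyMeasurable
  unfold Function.uncurry
  fun_prop

lemma ae_spaceTime_pos : ∀ᵐ p ∂spaceTime, 0 < p.1 := by
  unfold spaceTime
  exact Measure.quasiMeasurePreserving_fst.ae (ae_restrict_mem measurableSet_Ioi)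

lemma memLp_two_prod {α β : Type*} [MeasurableSpace α] [MeasurableSpace β] {μ : Measure α}
    {ν : Measure β} [SFinite ν] {f : α × β → ℂ} (hf : Measurable f) {g : α → ℝ≥0∞}
    (hfg : ∀ᵐ x ∂μ, eLpNorm (fun y => f (x, y)) 2 ν = g x) (hg : ∫⁻ x, g x ^ 2 ∂μ < ∞) :
    MemLp f 2 (μ.prod ν) := by
  refine ⟨hf.aestronglyMeasurable, ?_⟩
  rw [eLpNorm_lt_top_iff_lintegral_rpow_enorm_lt_top (by norm_num) (by norm_num)]
  simp only [ENNReal.toReal_ofNat]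
  rw [lintegral_prod _ (hf.enorm.pow_const _).aemeasurable]
  refine lt_of_eq_of_lt (lintegral_congr_ae ?_) hg
  filter_upwards [hfg] with x hx
  rw [← hx, eLpNorm_eq_lintegral_rpow_enorm_toReal (by norm_num) (by norm_num),
    ← ENNReal.rpow_natCast, ← ENNReal.rpow_mul]
  simp

namespace IsAmplitude

variable {a b : ℝ × ℝ → ℂ}

lemma integrable_slice (ha : IsAmplitude a) {s : ℝ} (hs : 0 < s) :
    Integrable (fun k => a (s, k)) := by
  obtain ⟨β, γ, -, h1, -, h⟩ := ha.dominated
  exact (h1.const_mul (β s)).mono' (ha.measurable.comp measurable_prodMk_left).aestronglyMeasurable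
    (Eventually.of_forall (h s hs))

lemma memLp_slice (ha : IsAmplitude a) {s : ℝ} (hs : 0 < s) : MemLp (fun k => a (s, k)) 2 := by
  obtain ⟨β, γ, -, -, h2, h⟩ := ha.dominated
  exact (h2.const_mul (β s)).mono (ha.measurable.comp measurable_prodMk_left).aestronglyMeasurable
    (Eventually.of_forall fun k => (h s hs k).trans (le_abs_self _))

lemma memLp (ha : IsAmplitude a) : MemLp a 2 spaceTime := by
  obtain ⟨β, γ, hβ, -, h2, h⟩ := ha.dominated
  refine MemLp.mono (f := a) (g := fun p : ℝ × ℝ => β p.1 * γ p.2) ?_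
    ha.measurable.aestronglyMeasurable ?_
  · unfold spaceTime
    refine (memLp_two_iff_integrable_sq (hβ.1.comp_fst.mul h2.1.comp_snd)).2 ?_
    simp only [Pi.mul_apply, mul_pow]
    exact hβ.integrable_sq.mul_prod h2.integrable_sq
  · filter_upwards [ae_spaceTime_pos] with p hp
    exact (h p.1 hp p.2).trans (le_abs_self _)

lemma memLp_kernel (ha : IsAmplitude a) : MemLp (kernel a) 2 spaceTime := by
  unfold spaceTime
  refine memLp_two_prod (measurable_kernel ha.measurable)
    (g := fun s => eLpNorm (fun k => a (s, k)) 2 volume) ?_ ?_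
  · filter_upwards [ae_restrict_mem measurableSet_Ioi] with s hs
    have e : (fun y => kernel a (s, y)) = 𝓕 (fun k => a (s, k)) := by ext y; rfl
    rw [e]
    exact eLpNorm_fourier (ha.integrable_slice hs) (ha.memLp_slice hs)
  · have h := ha.memLp.2
    rw [eLpNorm_lt_top_iff_lintegral_rpow_enorm_lt_top (by norm_num) (by norm_num), spaceTime,
      lintegral_prod _ (ha.measurable.enorm.pow_const _).aemeasurable] at h
    refine lt_of_eq_of_lt (lintegral_congr fun s => ?_) h
    rw [eLpNorm_eq_lintegral_rpow_enorm_toReal (by norm_num) (by norm_num),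
      ← ENNReal.rpow_natCast, ← ENNReal.rpow_mul]
    simp

lemma mul_conj_integrable {f g : ℝ × ℝ → ℂ} (hf : MemLp f 2 spaceTime) (hg : MemLp g 2 spaceTime) :
    Integrable (fun p => f p * starRingEnd ℂ (g p)) spaceTime :=
  hf.integrable_mul hg.star

/-- Plancherel on each time slice. The product domination in `IsAmplitude` puts every slice with s >
0 in both L¹ and L², so the transform is a genuine integral and also an isometry. -/
lemma integral_kernel_mul_conj (ha : IsAmplitude a) (hb : IsAmplitude b) :
    ∫ p, kernel a p * starRingEnd ℂ (kernel b p) ∂spaceTime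
      = ∫ p, a p * starRingEnd ℂ (b p) ∂spaceTime := by
  have h1 := mul_conj_integrable ha.memLp_kernel hb.memLp_kernel
  have h2 := mul_conj_integrable ha.memLp hb.memLp
  unfold spaceTime at *
  rw [integral_prod _ h1, integral_prod _ h2]
  refine integral_congr_ae ?_
  filter_upwards [ae_restrict_mem measurableSet_Ioi] with s hs
  exact integral_fourier_mul_conj (ha.integrable_slice hs) (ha.memLp_slice hs)
    (hb.integrable_slice hs) (hb.memLp_slice hs)

lemma add (ha : IsAmplitude a) (hb : IsAmplitude b) : IsAmplitude (fun p => a p + b p) := by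
  obtain ⟨β, γ, h1, h2, h3, h4⟩ := ha.dominated
  obtain ⟨β', γ', h1', h2', h3', h4'⟩ := hb.dominated
  refine ⟨ha.measurable.add hb.measurable, fun s => |β s| + |β' s|, fun k => |γ k| + |γ' k|,
    h1.abs.add h1'.abs, h2.abs.add h2'.abs, h3.abs.add h3'.abs, fun s hs k => ?_⟩
  refine (norm_add_le _ _).trans ?_
  have e1 := (h4 s hs k).trans (le_abs_self _)
  have e2 := (h4' s hs k).trans (le_abs_self _)
  rw [abs_mul] at e1 e2
  nlinarith [abs_nonneg (β s), abs_nonneg (β' s), abs_nonneg (γ k), abs_nonneg (γ' k),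
    mul_nonneg (abs_nonneg (β s)) (abs_nonneg (γ' k)),
    mul_nonneg (abs_nonneg (β' s)) (abs_nonneg (γ k))]

lemma of_norm_le (hb : IsAmplitude b) (ha : Measurable a) (C : ℝ)
    (h : ∀ p : ℝ × ℝ, 0 < p.1 → ‖a p‖ ≤ C * ‖b p‖) : IsAmplitude a := by
  obtain ⟨β, γ, h1, h2, h3, h4⟩ := hb.dominated
  refine ⟨ha, fun s => |C| * β s, γ, h1.const_mul _, h2, h3, fun s hs k => ?_⟩
  calc ‖a (s, k)‖ ≤ C * ‖b (s, k)‖ := h (s, k) hs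
    _ ≤ |C| * ‖b (s, k)‖ := by gcongr; exact le_abs_self _
    _ ≤ |C| * (β s * γ k) := by gcongr; exact h4 s hs k
    _ = _ := by ring

lemma const_mul (ha : IsAmplitude a) (c : ℂ) : IsAmplitude (fun p => c * a p) :=
  ha.of_norm_le (ha.measurable.const_mul c) ‖c‖ fun _ _ => norm_mul_le _ _

lemma neg (ha : IsAmplitude a) : IsAmplitude (fun p => -a p) :=
  ha.of_norm_le ha.measurable.neg 1 fun _ _ => by simp

lemma sub (ha : IsAmplitude a) (hb : IsAmplitude b) : IsAmplitude (fun p => a p - b p) := by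
  simpa only [sub_eq_add_neg] using ha.add hb.neg

/-- Restricted to positive times because `IsAmplitude` says nothing about integrability of the
slices at s ≤ 0. -/
lemma kernel_sub (ha : IsAmplitude a) (hb : IsAmplitude b) {p : ℝ × ℝ} (hp : 0 < p.1) :
    kernel (fun p => a p - b p) p = kernel a p - kernel b p := by
  simp only [kernel, fourier_eq_integral, mul_sub]
  have hi : ∀ {c : ℝ × ℝ → ℂ}, IsAmplitude c → Integrable fun v : ℝ =>
      Complex.exp (((-2 * Real.pi * v * p.2 : ℝ) : ℂ) * Complex.I) * c (p.1, v) := by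
    intro c hc
    refine (hc.integrable_slice hp).bdd_mul (c := 1) (by fun_prop) (Eventually.of_forall fun v => ?_)
    rw [Complex.norm_exp_ofReal_mul_I]
  exact integral_sub (hi ha) (hi hb)

end IsAmplitude

/-- Used to recognise real kernels: they are those whose amplitude is invariant under conjugation
combined with k ↦ -k. -/
lemma kernel_conj_reflect (a : ℝ × ℝ → ℂ) (p : ℝ × ℝ) :
    kernel (fun p => starRingEnd ℂ (a (p.1, -p.2))) p = starRingEnd ℂ (kernel a p) := by
  simp only [kernel, fourier_eq_integral]
  rw [← integral_conj, ← integral_neg_eq_self]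
  congr 1
  ext v
  simp only [map_mul, neg_neg, ← Complex.exp_conj, Complex.conj_I, Complex.conj_ofReal]
  congr 2
  push_cast
  ring

end

section

/-! ### White noise integrals -/

variable {Ω : Type*} [MeasurableSpace Ω] {P : Measure Ω}

lemma integrable_fun_sub {α E : Type*} [MeasurableSpace α] {μ : Measure α} [NormedAddCommGroup E]
    {f g : α → E} (hf : Integrable f μ) (hg : Integrable g μ) : Integrable (fun x => f x - g x) μ :=
  hf.sub hg

lemma integrable_fun_add {α E : Type*} [MeasurableSpace α] {μ : Measure α} [NormedAddCommGroup E]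
    {f g : α → E} (hf : Integrable f μ) (hg : Integrable g μ) : Integrable (fun x => f x + g x) μ :=
  hf.add hg

lemma ae_eq_of_integral_sq_sub_eq_zero {X Y : Ω → ℝ} (hX : MemLp X 2 P) (hY : MemLp Y 2 P)
    (h : ∫ ω, (X ω - Y ω) ^ 2 ∂P = 0) : X =ᵐ[P] Y := by
  have h1 := (integral_eq_zero_iff_of_nonneg (fun ω => sq_nonneg (X ω - Y ω))
    (hX.sub hY).integrable_sq).1 h
  filter_upwards [h1] with ω hω
  simpa [sub_eq_zero] using hω

namespace IsWhiteNoise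

variable {W : (ℝ × ℝ → ℝ) → Ω → ℝ} {f g h : ℝ × ℝ → ℝ}

lemma hasGaussianLaw (hW : IsWhiteNoise P W) (hf : MemLp f 2 spaceTime) :
    HasGaussianLaw (W f) P :=
  hW.gaussian.hasGaussianLaw_eval ⟨f, hf⟩

lemma memLp (hW : IsWhiteNoise P W) (hf : MemLp f 2 spaceTime) : MemLp (W f) 2 P :=
  (hW.hasGaussianLaw hf).memLp_two

/-- `IsWhiteNoise` does not postulate that W is linear. The square is expanded and each term
evaluated by the covariance, after which it is reassembled inside the space-time integral. -/
lemma integral_sub_sq (hW : IsWhiteNoise P W) (hf : MemLp f 2 spaceTime)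
    (hg : MemLp g 2 spaceTime) :
    ∫ ω, (W f ω - W g ω) ^ 2 ∂P = ∫ p, (f p - g p) ^ 2 ∂spaceTime := by
  have i1 := (hW.memLp hf).integrable_mul (hW.memLp hf)
  have i2 := (hW.memLp hf).integrable_mul (hW.memLp hg)
  have i3 := (hW.memLp hg).integrable_mul (hW.memLp hg)
  have j1 := hf.integrable_mul hf
  have j2 := hf.integrable_mul hg
  have j3 := hg.integrable_mul hg
  have e1 : ∀ ω, (W f ω - W g ω) ^ 2 = (W f * W f) ω - 2 * (W f * W g) ω + (W g * W g) ω := by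
    intro ω; simp only [Pi.mul_apply]; ring
  have e2 : ∀ p, (f p - g p) ^ 2 = (f * f) p - 2 * (f * g) p + (g * g) p := by
    intro p; simp only [Pi.mul_apply]; ring
  simp only [e1, e2]
  rw [integral_add (integrable_fun_sub i1 (i2.const_mul 2)) i3, integral_sub i1 (i2.const_mul 2),
    integral_add (integrable_fun_sub j1 (j2.const_mul 2)) j3, integral_sub j1 (j2.const_mul 2),
    integral_const_mul, integral_const_mul]
  simp only [Pi.mul_apply]
  rw [hW.covariance f f hf hf, hW.covariance f g hf hg, hW.covariance g g hg hg]

lemma map_zero (hW : IsWhiteNoise P W) : W (fun _ => 0) =ᵐ[P] fun _ => 0 := by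
  have h0 : MemLp (fun _ : ℝ × ℝ => (0 : ℝ)) 2 spaceTime := MemLp.zero
  refine ae_eq_of_integral_sq_sub_eq_zero (hW.memLp h0) MemLp.zero ?_
  have := hW.covariance _ _ h0 h0
  simpa [sq] using this

/-- The difference is centred Gaussian with variance v equal to the squared L² distance of the
kernels, that is, √v times a standard normal in law. Its 2m-th moment is thus vᵐ times that of N(0,
1), and the constant depends on m alone. -/
lemma lintegral_enorm_sub_pow_le (hW : IsWhiteNoise P W) (m : ℕ) :
    ∃ C : ℝ≥0, ∀ f g : ℝ × ℝ → ℝ, MemLp f 2 spaceTime → MemLp g 2 spaceTime →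
      ∫⁻ ω, ‖W f ω - W g ω‖ₑ ^ (2 * m) ∂P
        ≤ C * ENNReal.ofReal (∫ p, (f p - g p) ^ 2 ∂spaceTime) ^ m := by
  have hC : ∫⁻ x, ‖x‖ₑ ^ (2 * m) ∂(gaussianReal 0 1) ≠ ∞ := by
    rcases Nat.eq_zero_or_pos m with rfl | hm
    · simp
    have h := (memLp_id_gaussianReal (μ := 0) (v := 1) ((2 * m : ℕ) : ℝ≥0)).2
    rw [eLpNorm_lt_top_iff_lintegral_rpow_enorm_lt_top (by simp [hm.ne'])
      ENNReal.coe_ne_top] at h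
    refine ne_of_eq_of_ne (lintegral_congr fun x => ?_) h.ne
    rw [← ENNReal.rpow_natCast]
    simp
  refine ⟨(∫⁻ x, ‖x‖ₑ ^ (2 * m) ∂(gaussianReal 0 1)).toNNReal, fun f g hf hg => ?_⟩
  rw [ENNReal.coe_toNNReal hC]
  have hG : HasGaussianLaw (fun ω => W f ω - W g ω) P := by
    exact hW.gaussian.hasGaussianLaw_fun_sub (s := ⟨f, hf⟩) (t := ⟨g, hg⟩)
  have hmean : ∫ ω, (W f ω - W g ω) ∂P = 0 := by
    rw [integral_sub (hW.hasGaussianLaw hf).integrable (hW.hasGaussianLaw hg).integrable,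
      hW.mean_zero f hf, hW.mean_zero g hg, sub_zero]
  have hvar : Var[fun ω => W f ω - W g ω; P] = ∫ p, (f p - g p) ^ 2 ∂spaceTime := by
    rw [variance_of_integral_eq_zero hG.aemeasurable hmean, hW.integral_sub_sq hf hg]
  have hlaw := hG.map_eq_gaussianReal
  rw [hmean, hvar] at hlaw
  set v := ∫ p, (f p - g p) ^ 2 ∂spaceTime with hv
  have hv0 : 0 ≤ v := integral_nonneg fun p => sq_nonneg _
  have hscale : gaussianReal 0 v.toNNReal = (gaussianReal 0 1).map (fun x => √v * x) := by
    rw [gaussianReal_map_const_mul]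
    congr 1
    · simp
    · ext
      simp [Real.sq_sqrt hv0, hv0]
  have hmeas : Measurable fun x : ℝ => ‖x‖ₑ ^ (2 * m) := by fun_prop
  rw [← lintegral_map' hmeas.aemeasurable hG.aemeasurable, hlaw, hscale,
    lintegral_map hmeas (by fun_prop)]
  simp only [enorm_mul, mul_pow]
  rw [lintegral_const_mul _ hmeas, mul_comm, pow_mul ‖√v‖ₑ 2 m]
  gcongr
  rw [Real.enorm_eq_ofReal (Real.sqrt_nonneg _), ← ENNReal.ofReal_pow (Real.sqrt_nonneg _),
    Real.sq_sqrt hv0]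

/-- A family of kernels that is locally `1/2`-Hölder continuous in `L²` has white noise integrals
with a continuous modification, locally Hölder of every order below `1 / 2`. -/
theorem exists_holder_modification [IsProbabilityMeasure P] (hW : IsWhiteNoise P W)
    {f : ℝ × ℝ → ℝ × ℝ → ℝ} (hf : ∀ p, MemLp (f p) 2 spaceTime)
    (hC : ∀ N : ℕ, ∃ C : ℝ, ∀ p q : ℝ × ℝ, ‖p‖ ≤ N → ‖q‖ ≤ N →
      ∫ x, (f p x - f q x) ^ 2 ∂spaceTime ≤ C * ‖p - q‖) :
    ∃ Y : ℝ × ℝ → Ω → ℝ, (∀ p, Measurable (Y p)) ∧ (∀ p, Y p =ᵐ[P] W (f p)) ∧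
      (∀ ω, Continuous fun p => Y p ω) ∧
      ∀ ω, ∀ α : ℝ, 0 ≤ α → α < 1 / 2 → ∀ N : ℕ, ∃ C : ℝ, ∀ p q, ‖p‖ ≤ N → ‖q‖ ≤ N →
        |Y p ω - Y q ω| ≤ C * ‖p - q‖ ^ α := by
  have hae : ∀ p, AEMeasurable (W (f p)) P := fun p => (hW.hasGaussianLaw (hf p)).aemeasurable
  have hK : KolmogorovMoments P fun p => (hae p).mk (W (f p)) := by
    intro N m
    obtain ⟨C, hC⟩ := hC N
    obtain ⟨D, hD⟩ := hW.lintegral_enorm_sub_pow_le m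
    refine ⟨D * C.toNNReal ^ m, fun p q hp hq => ?_⟩
    have e : ∫⁻ ω, ‖(hae p).mk (W (f p)) ω - (hae q).mk (W (f q)) ω‖ₑ ^ (2 * m) ∂P
        = ∫⁻ ω, ‖W (f p) ω - W (f q) ω‖ₑ ^ (2 * m) ∂P := by
      refine lintegral_congr_ae ?_
      filter_upwards [(hae p).ae_eq_mk, (hae q).ae_eq_mk] with ω h1 h2
      rw [h1, h2]
    rw [e]
    refine (hD _ _ (hf p) (hf q)).trans ?_
    rw [ENNReal.coe_mul, ENNReal.coe_pow, mul_assoc, ← mul_pow]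
    gcongr
    refine (ENNReal.ofReal_le_ofReal ((hC p q hp hq).trans
      (mul_le_mul_of_nonneg_right (le_max_left C 0) (norm_nonneg _)))).trans (le_of_eq ?_)
    rw [ENNReal.ofReal_mul (le_max_right _ _)]
    congr 1
    rw [ENNReal.ofReal, Real.toNNReal_of_nonneg (le_max_right _ _)]
    rw [ENNReal.coe_inj]
    ext
    simp
  obtain ⟨Y, h1, h2, h3, h4⟩ := DynWhiteNoise.exists_holder_modification
    (fun p => (hae p).measurable_mk) hK
  exact ⟨Y, h1, fun p => (h2 p).trans (hae p).ae_eq_mk.symm, h3, h4⟩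

end IsWhiteNoise

lemma memLp_re {α : Type*} [MeasurableSpace α] {μ : Measure α} {F : α → ℂ} (hF : MemLp F 2 μ) :
    MemLp (fun p => (F p).re) 2 μ := hF.re

lemma memLp_im {α : Type*} [MeasurableSpace α] {μ : Measure α} {F : α → ℂ} (hF : MemLp F 2 μ) :
    MemLp (fun p => (F p).im) 2 μ := hF.im

lemma integral_mul_conj_eq {α : Type*} [MeasurableSpace α] {μ : Measure α} {a b c d : α → ℝ}
    (ha : MemLp a 2 μ) (hb : MemLp b 2 μ) (hc : MemLp c 2 μ) (hd : MemLp d 2 μ) :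
    ∫ x, ((a x : ℂ) + b x * Complex.I) * starRingEnd ℂ ((c x : ℂ) + d x * Complex.I) ∂μ
      = ((∫ x, (a x : ℂ) * c x ∂μ) + ∫ x, (b x : ℂ) * d x ∂μ)
        + ((∫ x, (b x : ℂ) * c x ∂μ) - ∫ x, (a x : ℂ) * d x ∂μ) * Complex.I := by
  have i : ∀ {u v : α → ℝ}, MemLp u 2 μ → MemLp v 2 μ →
      Integrable (fun x => (u x : ℂ) * v x) μ := fun hu hv =>
    (hu.ofReal (K := ℂ)).integrable_mul (hv.ofReal (K := ℂ))
  have e : ∀ x, ((a x : ℂ) + b x * Complex.I) * starRingEnd ℂ ((c x : ℂ) + d x * Complex.I)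
      = (a x * c x + b x * d x) + (b x * c x - a x * d x) * Complex.I := by
    intro x
    simp only [map_add, map_mul, Complex.conj_ofReal, Complex.conj_I]
    linear_combination (-(b x : ℂ) * d x) * Complex.I_sq
  simp only [e]
  rw [integral_add (integrable_fun_add (i ha hc) (i hb hd)) ((integrable_fun_sub (i hb hc) (i ha hd)).mul_const Complex.I),
    integral_add (i ha hc) (i hb hd), integral_mul_const, integral_sub (i hb hc) (i ha hd)]

/-- The white noise integral of a complex function. -/
def complexNoise (W : (ℝ × ℝ → ℝ) → Ω → ℝ) (F : ℝ × ℝ → ℂ) (ω : Ω) : ℂ :=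
  W (fun p => (F p).re) ω + W (fun p => (F p).im) ω * Complex.I

/-- The white noise integral of the space-time function with spectral amplitude `a`. -/
def spectralNoise (W : (ℝ × ℝ → ℝ) → Ω → ℝ) (a : ℝ × ℝ → ℂ) : Ω → ℂ := complexNoise W (kernel a)

namespace IsWhiteNoise

variable {W : (ℝ × ℝ → ℝ) → Ω → ℝ}

section complex

variable {F G : ℝ × ℝ → ℂ}

lemma memLp_complexNoise (hW : IsWhiteNoise P W) (hF : MemLp F 2 spaceTime) :
    MemLp (complexNoise W F) 2 P := by
  have h1 := (hW.memLp (memLp_re hF)).ofReal (K := ℂ)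
  have h2 := ((hW.memLp (memLp_im hF)).ofReal (K := ℂ)).mul_const Complex.I
  exact h1.add h2

lemma hasGaussianLaw_complexNoise (hW : IsWhiteNoise P W) (hF : MemLp F 2 spaceTime) :
    HasGaussianLaw (complexNoise W F) P := by
  have h : HasGaussianLaw (fun ω => (W (fun p => (F p).re) ω, W (fun p => (F p).im) ω)) P :=
    hW.gaussian.hasGaussianLaw_prodMk (s := ⟨_, (memLp_re hF)⟩) (t := ⟨_, (memLp_im hF)⟩)
  exact h.map_fun (Complex.equivRealProdCLM.symm : ℝ × ℝ →L[ℝ] ℂ) |>.congr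
    (Eventually.of_forall fun ω => by simp [complexNoise, Complex.equivRealProdCLM_symm_apply])

lemma integral_complexNoise (hW : IsWhiteNoise P W) (hF : MemLp F 2 spaceTime) :
    ∫ ω, complexNoise W F ω ∂P = 0 := by
  have h1 := hW.mean_zero _ (memLp_re hF)
  have h2 := hW.mean_zero _ (memLp_im hF)
  have i1 : Integrable (fun ω => (W (fun p => (F p).re) ω : ℂ)) P :=
    ((hW.hasGaussianLaw (memLp_re hF)).integrable).ofReal
  have i2 : Integrable (fun ω => (W (fun p => (F p).im) ω : ℂ) * Complex.I) P :=
    (((hW.hasGaussianLaw (memLp_im hF)).integrable).ofReal (𝕜 := ℂ)).mul_const Complex.I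
  unfold complexNoise
  rw [integral_add i1 i2, integral_mul_const]
  have e1 : ∫ ω, (W (fun p => (F p).re) ω : ℂ) ∂P = 0 := by
    rw [integral_complex_ofReal]; exact_mod_cast h1
  have e2 : ∫ ω, (W (fun p => (F p).im) ω : ℂ) ∂P = 0 := by
    rw [integral_complex_ofReal]; exact_mod_cast h2
  rw [e1, e2]
  simp

lemma covariance_complex (hW : IsWhiteNoise P W) {f g : ℝ × ℝ → ℝ} (hf : MemLp f 2 spaceTime)
    (hg : MemLp g 2 spaceTime) :
    ∫ ω, (W f ω : ℂ) * W g ω ∂P = ∫ p, (f p : ℂ) * g p ∂spaceTime := by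
  have := hW.covariance f g hf hg
  simp only [← Complex.ofReal_mul]
  rw [integral_complex_ofReal, integral_complex_ofReal, this]

lemma integral_complexNoise_mul_conj (hW : IsWhiteNoise P W) (hF : MemLp F 2 spaceTime)
    (hG : MemLp G 2 spaceTime) :
    ∫ ω, complexNoise W F ω * starRingEnd ℂ (complexNoise W G ω) ∂P
      = ∫ p, F p * starRingEnd ℂ (G p) ∂spaceTime := by
  have hF' : ∀ p, F p = ((F p).re : ℂ) + (F p).im * Complex.I := fun p => (Complex.re_add_im _).symm
  have hG' : ∀ p, G p = ((G p).re : ℂ) + (G p).im * Complex.I := fun p => (Complex.re_add_im _).symm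
  unfold complexNoise
  rw [integral_mul_conj_eq (hW.memLp (memLp_re hF)) (hW.memLp (memLp_im hF)) (hW.memLp (memLp_re hG)) (hW.memLp (memLp_im hG))]
  conv_rhs =>
    enter [2, p]
    rw [hF' p, hG' p]
  rw [integral_mul_conj_eq (memLp_re hF) (memLp_im hF) (memLp_re hG) (memLp_im hG)]
  have c := fun {f g : ℝ × ℝ → ℝ} (hf : MemLp f 2 spaceTime) (hg : MemLp g 2 spaceTime) =>
    hW.covariance_complex hf hg
  rw [c (memLp_re hF) (memLp_re hG), c (memLp_im hF) (memLp_im hG), c (memLp_im hF) (memLp_re hG),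
    c (memLp_re hF) (memLp_im hG)]

end complex

variable {a b : ℝ × ℝ → ℂ}

lemma memLp_spectralNoise (hW : IsWhiteNoise P W) (ha : IsAmplitude a) :
    MemLp (spectralNoise W a) 2 P := hW.memLp_complexNoise ha.memLp_kernel

lemma hasGaussianLaw_spectralNoise (hW : IsWhiteNoise P W) (ha : IsAmplitude a) :
    HasGaussianLaw (spectralNoise W a) P := hW.hasGaussianLaw_complexNoise ha.memLp_kernel

lemma integral_spectralNoise (hW : IsWhiteNoise P W) (ha : IsAmplitude a) :
    ∫ ω, spectralNoise W a ω ∂P = 0 := hW.integral_complexNoise ha.memLp_kernel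

/-- The Wiener isometry followed by Plancherel in y. From here on second moments are computed from
amplitudes without mentioning kernels. -/
lemma integral_spectralNoise_mul_conj (hW : IsWhiteNoise P W) (ha : IsAmplitude a)
    (hb : IsAmplitude b) :
    ∫ ω, spectralNoise W a ω * starRingEnd ℂ (spectralNoise W b ω) ∂P
      = ∫ p, a p * starRingEnd ℂ (b p) ∂spaceTime :=
  (hW.integral_complexNoise_mul_conj ha.memLp_kernel hb.memLp_kernel).trans
    (ha.integral_kernel_mul_conj hb)

end IsWhiteNoise

end

section

/-! ### A stochastic Fubini theorem -/

variable {Ω : Type*} [MeasurableSpace Ω] {P : Measure Ω}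

lemma ae_eq_zero_of_integral_mul_conj_eq_zero {D : Ω → ℂ} (hD : MemLp D 2 P)
    (h : ∫ ω, D ω * starRingEnd ℂ (D ω) ∂P = 0) : D =ᵐ[P] 0 := by
  have e : ∀ ω, D ω * starRingEnd ℂ (D ω) = ((‖D ω‖ ^ 2 : ℝ) : ℂ) := fun ω => by
    rw [Complex.mul_conj, Complex.normSq_eq_norm_sq]
  simp only [e] at h
  rw [integral_complex_ofReal, Complex.ofReal_eq_zero] at h
  have h1 := (integral_eq_zero_iff_of_nonneg (fun ω => sq_nonneg ‖D ω‖)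
    ((memLp_two_iff_integrable_sq_norm hD.1).1 hD)).1 h
  filter_upwards [h1] with ω hω
  simpa using hω

lemma integrable_mul_conj {α : Type*} [MeasurableSpace α] {μ : Measure α} {f g : α → ℂ}
    (hf : MemLp f 2 μ) (hg : MemLp g 2 μ) : Integrable (fun x => f x * starRingEnd ℂ (g x)) μ :=
  hf.integrable_mul hg.star

namespace IsWhiteNoise

variable {W : (ℝ × ℝ → ℝ) → Ω → ℝ} {a b c : ℝ × ℝ → ℂ}

/-- Linearity is recovered from the isometry: the defect D is orthogonal to every spectral noise, in
particular to the three of which it is made, so E|D|² = 0. -/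
lemma spectralNoise_add (hW : IsWhiteNoise P W) (ha : IsAmplitude a) (hb : IsAmplitude b)
    (hc : IsAmplitude c) (h : ∀ᵐ p ∂spaceTime, a p + b p = c p) :
    (fun ω => spectralNoise W a ω + spectralNoise W b ω) =ᵐ[P] spectralNoise W c := by
  have ma := hW.memLp_spectralNoise ha
  have mb := hW.memLp_spectralNoise hb
  have mc := hW.memLp_spectralNoise hc
  set D : Ω → ℂ := fun ω => spectralNoise W a ω + spectralNoise W b ω - spectralNoise W c ω with hD
  have mD : MemLp D 2 P := (ma.add mb).sub mc
  have horth : ∀ {e : ℝ × ℝ → ℂ}, IsAmplitude e →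
      ∫ ω, D ω * starRingEnd ℂ (spectralNoise W e ω) ∂P = 0 := by
    intro e he
    have me := hW.memLp_spectralNoise he
    simp only [hD, sub_mul, add_mul]
    rw [integral_sub (integrable_fun_add (integrable_mul_conj ma me) (integrable_mul_conj mb me))
      (integrable_mul_conj mc me), integral_add (integrable_mul_conj ma me)
      (integrable_mul_conj mb me), hW.integral_spectralNoise_mul_conj ha he,
      hW.integral_spectralNoise_mul_conj hb he, hW.integral_spectralNoise_mul_conj hc he,
      ← integral_add (integrable_mul_conj ha.memLp he.memLp)
      (integrable_mul_conj hb.memLp he.memLp), sub_eq_zero]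
    refine integral_congr_ae ?_
    filter_upwards [h] with p hp
    rw [← add_mul, hp]
  have hz : D =ᵐ[P] 0 := by
    refine ae_eq_zero_of_integral_mul_conj_eq_zero mD ?_
    have e : ∀ ω, D ω * starRingEnd ℂ (D ω) = D ω * starRingEnd ℂ (spectralNoise W a ω)
        + D ω * starRingEnd ℂ (spectralNoise W b ω) - D ω * starRingEnd ℂ (spectralNoise W c ω) := by
      intro ω
      rw [← mul_add, ← mul_sub, ← map_add, ← map_sub]
    simp only [e]
    rw [integral_sub (integrable_fun_add (integrable_mul_conj mD ma) (integrable_mul_conj mD mb))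
      (integrable_mul_conj mD mc), integral_add (integrable_mul_conj mD ma)
      (integrable_mul_conj mD mb), horth ha, horth hb, horth hc]
    simp
  filter_upwards [hz] with ω hω
  simpa [hD, sub_eq_zero] using hω

/-- **Stochastic Fubini**: the integral of a measurable family of white noise integrals is the
white noise integral of the integrated amplitude. -/
theorem integral_eq_spectralNoise [IsProbabilityMeasure P] (hW : IsWhiteNoise P W)
    {X : Type*} [MeasurableSpace X] {ν : Measure X} [SFinite ν] {a : X → ℝ × ℝ → ℂ}
    {Y : X → Ω → ℂ} (hY : AEStronglyMeasurable (fun q : X × Ω => Y q.1 q.2) (ν.prod P))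
    (hYa : ∀ᵐ x ∂ν, Y x =ᵐ[P] spectralNoise W (a x))
    (ha : Measurable fun q : X × (ℝ × ℝ) => a q.1 q.2) {w : X → ℝ} (hw : Integrable w ν)
    (hw0 : ∀ x, 0 < w x) (hb : IsAmplitude b)
    (hab : ∀ x, ∀ p : ℝ × ℝ, 0 < p.1 → ‖a x p‖ ≤ w x * ‖b p‖) :
    (∀ᵐ ω ∂P, Integrable (fun x => Y x ω) ν) ∧ IsAmplitude (fun p => ∫ x, a x p ∂ν) ∧
      (fun ω => ∫ x, Y x ω ∂ν) =ᵐ[P] spectralNoise W (fun p => ∫ x, a x p ∂ν) := by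
  have hax : ∀ x, IsAmplitude (a x) := fun x =>
    hb.of_norm_le (ha.comp measurable_prodMk_left) (w x) (hab x)
  have hA : IsAmplitude (fun p => ∫ x, a x p ∂ν) := by
    refine hb.of_norm_le ?_ (∫ x, w x ∂ν) fun p hp => ?_
    · exact (StronglyMeasurable.integral_prod_right (f := fun p x => a x p)
        (ha.comp measurable_swap).stronglyMeasurable).measurable
    · rw [← integral_mul_const]
      exact norm_integral_le_of_norm_le (hw.mul_const _) (Eventually.of_forall fun x => hab x p hp)
  have mY : ∀ᵐ x ∂ν, MemLp (Y x) 2 P := by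
    filter_upwards [hYa] with x hx using (hW.memLp_spectralNoise (hax x)).ae_eq hx.symm
  -- By the isometry E|Y_x|² ≤ w(x)² ‖b‖², so dividing by w(x) leaves something integrable against
  -- ν. This weighted square integrability drives all the exchanges of integrals below.
  have hint : Integrable (fun q : X × Ω => ‖Y q.1 q.2‖ ^ 2 / w q.1) (ν.prod P) := by
    have hm : AEStronglyMeasurable (fun q : X × Ω => ‖Y q.1 q.2‖ ^ 2 / w q.1) (ν.prod P) :=
      (hY.norm.pow 2).mul (hw.1.comp_fst.inv₀)
    rw [integrable_prod_iff hm]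
    constructor
    · filter_upwards [mY] with x hx
      exact ((memLp_two_iff_integrable_sq_norm hx.1).1 hx).div_const _
    · refine (hw.mul_const (∫ p, ‖b p‖ ^ 2 ∂spaceTime)).mono' hm.norm.integral_prod_right' ?_
      filter_upwards [hYa] with x hx
      have e1 : ∫ ω, ‖Y x ω‖ ^ 2 ∂P = ∫ p, ‖a x p‖ ^ 2 ∂spaceTime := by
        have h := hW.integral_spectralNoise_mul_conj (hax x) (hax x)
        simp only [Complex.mul_conj, Complex.normSq_eq_norm_sq] at h
        rw [integral_complex_ofReal, integral_complex_ofReal, Complex.ofReal_inj] at h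
        rw [← h]
        refine integral_congr_ae ?_
        filter_upwards [hx] with ω hω
        rw [hω]
      have e2 : ∫ p, ‖a x p‖ ^ 2 ∂spaceTime ≤ w x ^ 2 * ∫ p, ‖b p‖ ^ 2 ∂spaceTime := by
        rw [← integral_const_mul]
        refine integral_mono_ae ((memLp_two_iff_integrable_sq_norm (hax x).memLp.1).1 (hax x).memLp)
          (((memLp_two_iff_integrable_sq_norm hb.memLp.1).1 hb.memLp).const_mul _) ?_
        filter_upwards [ae_spaceTime_pos] with p hp
        rw [← mul_pow]
        exact pow_le_pow_left₀ (norm_nonneg _) (hab x p hp) 2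
      have e3 : ∀ ω, ‖‖Y x ω‖ ^ 2 / w x‖ = ‖Y x ω‖ ^ 2 / w x := fun ω =>
        Real.norm_of_nonneg (div_nonneg (sq_nonneg _) (hw0 x).le)
      simp only [e3]
      rw [integral_div, e1, Real.norm_of_nonneg (div_nonneg (integral_nonneg fun _ => sq_nonneg _)
        (hw0 x).le), div_le_iff₀ (hw0 x)]
      exact e2.trans (le_of_eq (by ring))
  -- From the inequality 2|Y||U| ≤ |Y|²/w + w|U|², whose right side is integrable on the product.
  have hYint : ∀ {U : Ω → ℂ}, MemLp U 2 P →
      Integrable (fun q : X × Ω => Y q.1 q.2 * U q.2) (ν.prod P) := by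
    intro U hU
    have hU2 := (memLp_two_iff_integrable_sq_norm hU.1).1 hU
    refine (hint.add (hw.mul_prod hU2)).mono' (hY.mul hU.1.comp_snd) (Eventually.of_forall fun q => ?_)
    rw [norm_mul, Pi.add_apply]
    have h0 := hw0 q.1
    have e : ‖Y q.1 q.2‖ ^ 2 / w q.1 + w q.1 * ‖U q.2‖ ^ 2 - 2 * (‖Y q.1 q.2‖ * ‖U q.2‖)
        = (‖Y q.1 q.2‖ - w q.1 * ‖U q.2‖) ^ 2 / w q.1 := by field_simp; ring
    have e' : 0 ≤ (‖Y q.1 q.2‖ - w q.1 * ‖U q.2‖) ^ 2 / w q.1 := by positivity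
    have : 0 ≤ ‖Y q.1 q.2‖ * ‖U q.2‖ := by positivity
    linarith
  have hY1 : Integrable (fun q : X × Ω => Y q.1 q.2) (ν.prod P) := by
    simpa using hYint (U := fun _ => 1) (memLp_const 1)
  set S : Ω → ℂ := fun ω => ∫ x, Y x ω ∂ν with hS
  have hSm : AEStronglyMeasurable S P := hY1.1.prod_swap.integral_prod_right'
  have mS : MemLp S 2 P := by
    rw [memLp_two_iff_integrable_sq_norm hSm]
    have hK := hint.integral_prod_right
    refine (hK.const_mul (∫ x, w x ∂ν)).mono' (hSm.norm.pow 2) ?_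
    filter_upwards [hint.prod_left_ae, hY1.prod_left_ae] with ω h1 h2
    rw [Real.norm_of_nonneg (sq_nonneg _)]
    set I := ∫ x, ‖Y x ω‖ ∂ν with hI
    set V := ∫ x, w x ∂ν with hV
    have hSI : ‖S ω‖ ≤ I := norm_integral_le_integral_norm _
    have hV0 : 0 ≤ V := integral_nonneg fun x => (hw0 x).le
    -- Cauchy–Schwarz in the form of a family of quadratic inequalities in l; the value l = I/V used
    -- below gives I² ≤ V ∫ |Y|²/w.
    have hquad : ∀ l : ℝ, 2 * l * I ≤ l ^ 2 * V + ∫ x, ‖Y x ω‖ ^ 2 / w x ∂ν := by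
      intro l
      rw [hI, hV, ← integral_const_mul, ← integral_const_mul, ← integral_add (hw.const_mul _) h1]
      refine integral_mono (h2.norm.const_mul _) ((hw.const_mul _).add h1) fun x => ?_
      have h0 := hw0 x
      have e : l ^ 2 * w x + ‖Y x ω‖ ^ 2 / w x - 2 * l * ‖Y x ω‖
        = (l * w x - ‖Y x ω‖) ^ 2 / w x := by field_simp; ring
      have e' : 0 ≤ (l * w x - ‖Y x ω‖) ^ 2 / w x := by positivity
      linarith
    refine (pow_le_pow_left₀ (norm_nonneg _) hSI 2).trans ?_
    rcases hV0.eq_or_lt with h0 | h0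
    -- The weight is strictly positive, so zero total weight leaves only the zero measure.
    · have hν : ν = 0 := by
        have := (integral_eq_zero_iff_of_nonneg (fun x => (hw0 x).le) hw).1 h0.symm
        rw [← ae_eq_bot]
        by_contra hne
        rw [← Ne, ← neBot_iff] at hne
        obtain ⟨x, hx⟩ := this.exists
        exact (hw0 x).ne' hx
      simp [hI, hν]
    · have := hquad (I / V)
      have e : 2 * (I / V) * I - (I / V) ^ 2 * V = I ^ 2 / V := by field_simp; ring
      have h3 : I ^ 2 / V ≤ ∫ x, ‖Y x ω‖ ^ 2 / w x ∂ν := by linarith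
      rw [div_le_iff₀ h0] at h3
      linarith
  have hswap : ∀ {U : Ω → ℂ}, MemLp U 2 P → ∫ ω, S ω * starRingEnd ℂ (U ω) ∂P
      = ∫ x, ∫ ω, Y x ω * starRingEnd ℂ (U ω) ∂P ∂ν := by
    intro U hU
    rw [integral_integral_swap (hYint hU.star)]
    simp only [hS, ← integral_mul_const]
  have mA := hW.memLp_spectralNoise hA
  set D : Ω → ℂ := fun ω => S ω - spectralNoise W (fun p => ∫ x, a x p ∂ν) ω with hD
  have mD : MemLp D 2 P := mS.sub mA
  have horth : ∀ {e : ℝ × ℝ → ℂ}, IsAmplitude e →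
      ∫ ω, D ω * starRingEnd ℂ (spectralNoise W e ω) ∂P = 0 := by
    intro e he
    have me := hW.memLp_spectralNoise he
    simp only [hD, sub_mul]
    rw [integral_sub (integrable_mul_conj mS me) (integrable_mul_conj mA me), hswap me,
      hW.integral_spectralNoise_mul_conj hA he, sub_eq_zero]
    have e1 : ∀ᵐ x ∂ν, ∫ ω, Y x ω * starRingEnd ℂ (spectralNoise W e ω) ∂P
        = ∫ p, a x p * starRingEnd ℂ (e p) ∂spaceTime := by
      filter_upwards [hYa] with x hx
      rw [← hW.integral_spectralNoise_mul_conj (hax x) he]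
      refine integral_congr_ae ?_
      filter_upwards [hx] with ω hω
      rw [hω]
    rw [integral_congr_ae e1, integral_integral_swap]
    · simp only [integral_mul_const]
    · have i1 := hw.mul_prod (integrable_mul_conj hb.memLp he.memLp).norm
      refine i1.mono' ?_ ?_
      · exact (ha.mul (Complex.continuous_conj.measurable.comp
          (he.measurable.comp measurable_snd))).aestronglyMeasurable
      · have : ∀ᵐ q ∂(ν.prod spaceTime), 0 < q.2.1 :=
          Measure.quasiMeasurePreserving_snd.ae ae_spaceTime_pos
        filter_upwards [this] with q hq
        simp only [Function.uncurry, norm_mul]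
        rw [← mul_assoc]
        gcongr
        exact hab q.1 q.2 hq
  -- D is orthogonal to every spectral noise. S is a superposition of such noises and the other term
  -- of D is one of them, so D is orthogonal to itself.
  have hz : D =ᵐ[P] 0 := by
    refine ae_eq_zero_of_integral_mul_conj_eq_zero mD ?_
    have e : ∀ ω, D ω * starRingEnd ℂ (D ω) = starRingEnd ℂ (S ω * starRingEnd ℂ (D ω))
        - D ω * starRingEnd ℂ (spectralNoise W (fun p => ∫ x, a x p ∂ν) ω) := by
      intro ω
      rw [map_mul, Complex.conj_conj, mul_comm (starRingEnd ℂ (S ω)), ← mul_sub, ← map_sub]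
    simp only [e]
    have i1 : Integrable (fun ω => starRingEnd ℂ (S ω * starRingEnd ℂ (D ω))) P :=
      Complex.conjCLE.toContinuousLinearMap.integrable_comp (integrable_mul_conj mS mD)
    rw [integral_sub i1 (integrable_mul_conj mD mA), horth hA, sub_zero, integral_conj, hswap mD]
    have e1 : ∀ᵐ x ∂ν, ∫ ω, Y x ω * starRingEnd ℂ (D ω) ∂P = 0 := by
      filter_upwards [hYa] with x hx
      have h := congrArg (starRingEnd ℂ) (horth (hax x))
      rw [← integral_conj, _root_.map_zero] at h
      rw [← h]
      refine integral_congr_ae ?_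
      filter_upwards [hx] with ω hω
      rw [hω, map_mul, Complex.conj_conj, mul_comm]
    rw [integral_congr_ae e1]
    simp
  refine ⟨hY1.prod_left_ae, hA, ?_⟩
  filter_upwards [hz] with ω hω
  simpa [hD, sub_eq_zero] using hω

end IsWhiteNoise

/-- Amplitudes of real space-time functions. -/
def IsHermitian (a : ℝ × ℝ → ℂ) : Prop := ∀ s k, starRingEnd ℂ (a (s, -k)) = a (s, k)

lemma IsHermitian.kernel_im {a : ℝ × ℝ → ℂ} (h : IsHermitian a) (p : ℝ × ℝ) :
    (kernel a p).im = 0 := by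
  have e : (fun p : ℝ × ℝ => starRingEnd ℂ (a (p.1, -p.2))) = a := by
    ext p
    exact h p.1 p.2
  have := kernel_conj_reflect a p
  rw [e] at this
  exact Complex.conj_eq_iff_im.1 this.symm

namespace IsWhiteNoise

variable {W : (ℝ × ℝ → ℝ) → Ω → ℝ}

lemma spectralNoise_of_isHermitian (hW : IsWhiteNoise P W) {a : ℝ × ℝ → ℂ} (h : IsHermitian a) :
    spectralNoise W a =ᵐ[P] fun ω => (W (fun p => (kernel a p).re) ω : ℂ) := by
  filter_upwards [hW.map_zero] with ω hω
  simp [spectralNoise, complexNoise, h.kernel_im, hω]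

/-- Regular versions of the fields with Hermitian amplitudes. -/
theorem exists_holder_spectralNoise [IsProbabilityMeasure P] (hW : IsWhiteNoise P W)
    {a : ℝ × ℝ → ℝ × ℝ → ℂ} (ha : ∀ p, IsAmplitude (a p)) (hH : ∀ p, IsHermitian (a p))
    (hC : ∀ N : ℕ, ∃ C : ℝ, ∀ p q : ℝ × ℝ, ‖p‖ ≤ N → ‖q‖ ≤ N →
      ∫ x, ‖a p x - a q x‖ ^ 2 ∂spaceTime ≤ C * ‖p - q‖) :
    ∃ Y : ℝ × ℝ → Ω → ℝ, (∀ p, Measurable (Y p)) ∧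
      (∀ p, Y p =ᵐ[P] W (fun x => (kernel (a p) x).re)) ∧
      (∀ p, (fun ω => (Y p ω : ℂ)) =ᵐ[P] spectralNoise W (a p)) ∧
      (∀ ω, Continuous fun p => Y p ω) ∧
      ∀ ω, ∀ α : ℝ, 0 ≤ α → α < 1 / 2 → ∀ N : ℕ, ∃ C : ℝ, ∀ p q, ‖p‖ ≤ N → ‖q‖ ≤ N →
        |Y p ω - Y q ω| ≤ C * ‖p - q‖ ^ α := by
  obtain ⟨Y, h1, h2, h3, h4⟩ := hW.exists_holder_modification
    (f := fun p x => (kernel (a p) x).re) (fun p => memLp_re (ha p).memLp_kernel) (by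
      intro N
      obtain ⟨C, hC⟩ := hC N
      refine ⟨C, fun p q hp hq => le_trans ?_ (hC p q hp hq)⟩
      have hd := (ha p).sub (ha q)
      have e : ∫ x, ‖a p x - a q x‖ ^ 2 ∂spaceTime
          = ∫ x, ‖kernel (fun x => a p x - a q x) x‖ ^ 2 ∂spaceTime := by
        have h := hd.integral_kernel_mul_conj hd
        simp only [Complex.mul_conj, Complex.normSq_eq_norm_sq] at h
        rw [integral_complex_ofReal, integral_complex_ofReal, Complex.ofReal_inj] at h
        exact h.symm
      rw [e]
      refine integral_mono_ae ((memLp_re (ha p).memLp_kernel).sub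
        (memLp_re (ha q).memLp_kernel)).integrable_sq
        ((memLp_two_iff_integrable_sq_norm hd.memLp_kernel.1).1 hd.memLp_kernel) ?_
      filter_upwards [ae_spaceTime_pos] with x hx
      rw [(ha p).kernel_sub (ha q) hx, ← Complex.sub_re, ← sq_abs]
      exact pow_le_pow_left₀ (abs_nonneg _) (Complex.abs_re_le_norm _) 2)
  refine ⟨Y, h1, h2, fun p => ?_, h3, h4⟩
  filter_upwards [h2 p, hW.spectralNoise_of_isHermitian (hH p)] with ω e1 e2
  rw [e1, e2]

end IsWhiteNoise

end

section

/-! ### Amplitudes of the solution -/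

lemma exists_schwartz_decay (f : 𝓢(ℝ, ℂ)) (n : ℕ) :
    ∃ C : ℝ, 0 < C ∧ ∀ k, ‖f k‖ * (1 + |k|) ^ n ≤ C * (1 + k ^ 2)⁻¹ := by
  set C := 2 ^ (n + 2) * (Finset.Iic (n + 2, 0)).sup (fun m => SchwartzMap.seminorm ℝ m.1 m.2) f
  refine ⟨max C 1, by positivity, fun k => ?_⟩
  have h := SchwartzMap.one_add_le_sup_seminorm_apply (𝕜 := ℝ) (m := (n + 2, 0)) (k := n + 2)
    (n := 0) le_rfl le_rfl f k
  rw [norm_iteratedFDeriv_zero, Real.norm_eq_abs] at h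
  rw [← div_eq_mul_inv, le_div_iff₀ (by positivity)]
  calc ‖f k‖ * (1 + |k|) ^ n * (1 + k ^ 2) ≤ ‖f k‖ * (1 + |k|) ^ n * (1 + |k|) ^ 2 := by
        gcongr
        nlinarith [abs_nonneg k, sq_abs k]
    _ = (1 + |k|) ^ (n + 2) * ‖f k‖ := by ring
    _ ≤ max C 1 := h.trans (le_max_left _ _)

lemma memLp_inv_one_add_sq : MemLp (fun k : ℝ => (1 + k ^ 2)⁻¹) 2 := by
  have hc : Continuous fun k : ℝ => (1 + k ^ 2)⁻¹ :=
    Continuous.inv₀ (by fun_prop) fun k => by positivity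
  rw [memLp_two_iff_integrable_sq hc.aestronglyMeasurable]
  refine integrable_inv_one_add_sq.mono' (hc.pow 2).aestronglyMeasurable
    (Eventually.of_forall fun k => ?_)
  rw [Real.norm_of_nonneg (by positivity)]
  refine pow_le_of_le_one (by positivity) ?_ (by norm_num)
  exact inv_le_one_of_one_le₀ (by nlinarith [sq_nonneg k])

/-- The Fourier transform of the profile of the forcing. -/
def profileHat (φ : 𝓢(ℝ, ℝ)) : 𝓢(ℝ, ℂ) := 𝓕 (φ.postcompCLM Complex.ofRealCLM)

lemma profileHat_eq (φ : 𝓢(ℝ, ℝ)) : (profileHat φ : ℝ → ℂ) = 𝓕 (fun x => (φ x : ℂ)) := by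
  rw [profileHat, SchwartzMap.fourier_coe]
  rfl

lemma conj_profileHat_neg (φ : 𝓢(ℝ, ℝ)) (k : ℝ) :
    starRingEnd ℂ (profileHat φ (-k)) = profileHat φ k := by
  rw [profileHat_eq, fourier_eq_integral, fourier_eq_integral, ← integral_conj]
  congr 1
  ext v
  simp only [map_mul, ← Complex.exp_conj, Complex.conj_I, Complex.conj_ofReal]
  congr 2
  push_cast
  ring

/-- The frequency at time `τ` of a wave that starts with frequency `k`. -/
def freq (c τ k : ℝ) : ℝ := k + c * τ * Real.sign k

lemma measurable_sign : Measurable Real.sign := by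
  unfold Real.sign
  exact Measurable.ite measurableSet_Iio measurable_const
    (Measurable.ite measurableSet_Ioi measurable_const measurable_const)

lemma measurable_freq (c : ℝ) : Measurable fun p : ℝ × ℝ => freq c p.1 p.2 := by
  unfold freq
  exact measurable_snd.add ((measurable_fst.const_mul c).mul (measurable_sign.comp measurable_snd))

lemma freq_neg (c τ k : ℝ) : freq c τ (-k) = -freq c τ k := by
  simp only [freq, Real.sign_neg]
  ring

lemma freq_zero (c k : ℝ) : freq c 0 k = k := by simp [freq]

lemma abs_sign_le (k : ℝ) : |Real.sign k| ≤ 1 := by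
  rcases Real.sign_apply_eq k with h | h | h <;> simp [h]

lemma abs_freq_le (c τ k : ℝ) : |freq c τ k| ≤ |k| + |c * τ| := by
  refine (abs_add_le _ _).trans ?_
  rw [abs_mul (c * τ)]
  gcongr
  exact mul_le_of_le_one_right (abs_nonneg _) (abs_sign_le k)

lemma abs_freq {c τ k : ℝ} (hcτ : 0 ≤ c * τ) (hk : k ≠ 0) : |freq c τ k| = |k| + c * τ := by
  rcases lt_or_gt_of_ne hk with h | h
  · rw [freq, Real.sign_of_neg h, abs_of_neg h, abs_of_neg (by linarith)]
    ring
  · rw [freq, Real.sign_of_pos h, abs_of_pos h, abs_of_pos (by linarith)]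
    ring

lemma abs_freq_sub_le (c τ τ' k : ℝ) : |freq c τ k - freq c τ' k| ≤ |c| * |τ - τ'| := by
  have : freq c τ k - freq c τ' k = c * (τ - τ') * Real.sign k := by simp only [freq]; ring
  rw [this, abs_mul, abs_mul]
  exact mul_le_of_le_one_right (by positivity) (abs_sign_le k)

/-- The plane wave `e^{2πiξx}` as a function of `ξ`, differentiated `n` times in `x`. -/
def wave (n : ℕ) (x ξ : ℝ) : ℂ :=
  ((2 * Real.pi * ξ : ℝ) * Complex.I) ^ n * Complex.exp ((2 * Real.pi * ξ * x : ℝ) * Complex.I)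

lemma norm_wave (n : ℕ) (x ξ : ℝ) : ‖wave n x ξ‖ = (2 * Real.pi * |ξ|) ^ n := by
  rw [wave, norm_mul, norm_pow, norm_mul, Complex.norm_I, Complex.norm_exp_ofReal_mul_I,
    Complex.norm_real, Real.norm_eq_abs, abs_mul, abs_of_pos Real.two_pi_pos]
  ring

lemma conj_wave_neg (n : ℕ) (x ξ : ℝ) : starRingEnd ℂ (wave n x (-ξ)) = wave n x ξ := by
  simp only [wave, map_mul, map_pow, ← Complex.exp_conj, Complex.conj_I, Complex.conj_ofReal]
  push_cast
  ring_nf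

lemma continuous_wave (n : ℕ) : Continuous fun q : ℝ × ℝ => wave n q.1 q.2 := by
  unfold wave
  fun_prop

lemma hasDerivAt_wave (n : ℕ) (x ξ : ℝ) :
    HasDerivAt (fun x => wave n x ξ) (wave (n + 1) x ξ) x := by
  have h : HasDerivAt (fun x : ℝ => ((2 * Real.pi * ξ * x : ℝ) : ℂ) * Complex.I)
      (((2 * Real.pi * ξ : ℝ) : ℂ) * Complex.I) x := by
    have := ((hasDerivAt_id x).const_mul (2 * Real.pi * ξ)).ofReal_comp.mul_const Complex.I
    simpa using this
  have h2 := h.cexp.const_mul (((2 * Real.pi * ξ : ℝ) * Complex.I : ℂ) ^ n)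
  convert! h2 using 1
  rw [wave]
  ring

lemma norm_pow_sub_pow_le_of_norm_le {z w : ℂ} {Q : ℝ} (hz : ‖z‖ ≤ Q) (hw : ‖w‖ ≤ Q)
    (hQ : 1 ≤ Q) (n : ℕ) : ‖z ^ n - w ^ n‖ ≤ n * Q ^ n * ‖z - w‖ := by
  induction n with
  | zero => simp
  | succ n ih =>
    have e : z ^ (n + 1) - w ^ (n + 1) = z * (z ^ n - w ^ n) + (z - w) * w ^ n := by ring
    rw [e]
    calc _ ≤ ‖z‖ * ‖z ^ n - w ^ n‖ + ‖z - w‖ * ‖w‖ ^ n := by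
          refine (norm_add_le _ _).trans ?_
          rw [norm_mul, norm_mul, norm_pow]
      _ ≤ Q * (n * Q ^ n * ‖z - w‖) + ‖z - w‖ * Q ^ n := by gcongr
      _ ≤ Q * (n * Q ^ n * ‖z - w‖) + ‖z - w‖ * Q ^ (n + 1) := by gcongr; omega
      _ = _ := by push_cast; ring

lemma norm_exp_sub_exp_le (x y : ℝ) :
    ‖Complex.exp (x * Complex.I) - Complex.exp (y * Complex.I)‖ ≤ |x - y| := by
  have e : Complex.exp (x * Complex.I) - Complex.exp (y * Complex.I)
      = Complex.exp (y * Complex.I) * (Complex.exp (Complex.I * ((x - y : ℝ) : ℂ)) - 1) := by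
    rw [mul_sub, ← Complex.exp_add, mul_one]
    congr 2
    push_cast
    ring
  rw [e, norm_mul, Complex.norm_exp_ofReal_mul_I, one_mul]
  exact Real.norm_exp_I_mul_ofReal_sub_one_le

/-- The difference splits into that of the polynomial factors and that of the phases. Moving x costs
one more power of the frequency bound Q than moving ξ. -/
lemma norm_wave_sub_le (n : ℕ) {x y ξ η N Q : ℝ} (hx : |x| ≤ N)
    (hξ : 2 * Real.pi * |ξ| ≤ Q) (hη : 2 * Real.pi * |η| ≤ Q) (hQ : 1 ≤ Q) :
    ‖wave n x ξ - wave n y η‖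
      ≤ ((n + N) * (2 * Real.pi)) * Q ^ n * |ξ - η| + Q ^ (n + 1) * |x - y| := by
  have hpi := Real.two_pi_pos
  set z : ℂ := (2 * Real.pi * ξ : ℝ) * Complex.I with hz
  set w : ℂ := (2 * Real.pi * η : ℝ) * Complex.I with hw
  have nz : ‖z‖ ≤ Q := by
    rw [hz, norm_mul, Complex.norm_I, Complex.norm_real, Real.norm_eq_abs, abs_mul,
      abs_of_pos hpi, mul_one]
    exact hξ
  have nw : ‖w‖ ≤ Q := by
    rw [hw, norm_mul, Complex.norm_I, Complex.norm_real, Real.norm_eq_abs, abs_mul,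
      abs_of_pos hpi, mul_one]
    exact hη
  have nzw : ‖z - w‖ = 2 * Real.pi * |ξ - η| := by
    rw [hz, hw, ← sub_mul, norm_mul, Complex.norm_I, mul_one, ← Complex.ofReal_sub,
      Complex.norm_real, Real.norm_eq_abs, ← mul_sub, abs_mul, abs_of_pos hpi]
  have e : wave n x ξ - wave n y η
      = (z ^ n - w ^ n) * Complex.exp ((2 * Real.pi * ξ * x : ℝ) * Complex.I)
        + w ^ n * (Complex.exp ((2 * Real.pi * ξ * x : ℝ) * Complex.I)
          - Complex.exp ((2 * Real.pi * η * y : ℝ) * Complex.I)) := by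
    simp only [wave, hz, hw]
    ring
  have h3 : |2 * Real.pi * ξ * x - 2 * Real.pi * η * y|
      ≤ 2 * Real.pi * |ξ - η| * N + Q * |x - y| := by
    have e3 : 2 * Real.pi * ξ * x - 2 * Real.pi * η * y
        = 2 * Real.pi * (ξ - η) * x + 2 * Real.pi * η * (x - y) := by ring
    rw [e3]
    refine (abs_add_le _ _).trans ?_
    rw [abs_mul _ x, abs_mul _ (ξ - η), abs_mul _ (x - y), abs_mul _ η, abs_of_pos hpi]
    gcongr
  rw [e]
  refine (norm_add_le _ _).trans ?_
  rw [norm_mul, norm_mul, Complex.norm_exp_ofReal_mul_I, mul_one, norm_pow]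
  calc _ ≤ n * Q ^ n * (2 * Real.pi * |ξ - η|)
        + Q ^ n * (2 * Real.pi * |ξ - η| * N + Q * |x - y|) := by
        rw [← nzw]
        gcongr
        · exact norm_pow_sub_pow_le_of_norm_le nz nw hQ n
        · rw [nzw]
          exact (norm_exp_sub_exp_le _ _).trans h3
    _ = _ := by ring

/-- The amplitude `1_{0 < s ≤ t} φ̂(k) m(k + c(t - s) sgn k)` of the observable of `u(t)` with
Fourier multiplier `m`. -/
def solutionAmplitude (φ : 𝓢(ℝ, ℝ)) (c t : ℝ) (m : ℝ → ℂ) (p : ℝ × ℝ) : ℂ :=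
  if 0 < p.1 ∧ p.1 ≤ t then profileHat φ p.2 * m (freq c (t - p.1) p.2) else 0

/-- A dominating amplitude. -/
def boundAmplitude (φ : 𝓢(ℝ, ℝ)) (t : ℝ) (n : ℕ) (p : ℝ × ℝ) : ℂ :=
  if 0 < p.1 ∧ p.1 ≤ t then ((‖profileHat φ p.2‖ * (1 + |p.2|) ^ n : ℝ) : ℂ) else 0

variable (φ : 𝓢(ℝ, ℝ)) (c : ℝ)

lemma measurable_profileHat : Measurable (profileHat φ) := (profileHat φ).continuous.measurable

lemma measurableSet_window (t : ℝ) : MeasurableSet {p : ℝ × ℝ | 0 < p.1 ∧ p.1 ≤ t} :=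
  (measurableSet_lt measurable_const measurable_fst).inter
    (measurableSet_le measurable_fst measurable_const)

lemma isAmplitude_boundAmplitude (t : ℝ) (n : ℕ) : IsAmplitude (boundAmplitude φ t n) := by
  obtain ⟨C, hC0, hC⟩ := exists_schwartz_decay (profileHat φ) n
  refine ⟨?_, (Ioc 0 t).indicator fun _ => C, fun k => (1 + k ^ 2)⁻¹, ?_,
    integrable_inv_one_add_sq, memLp_inv_one_add_sq, fun s hs k => ?_⟩
  · refine Measurable.ite (measurableSet_window t) ?_ measurable_const
    have := measurable_profileHat φ
    exact Complex.measurable_ofReal.comp ((this.comp measurable_snd).norm.mul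
      ((measurable_const.add (continuous_abs.measurable.comp measurable_snd)).pow_const n))
  · refine memLp_indicator_const 2 measurableSet_Ioc C (Or.inr ?_)
    exact ((Measure.restrict_apply_le _ _).trans_lt (by simp)).ne
  · simp only [boundAmplitude]
    split_ifs with h
    · rw [indicator_of_mem (show s ∈ Ioc 0 t from h), Complex.norm_real,
        Real.norm_of_nonneg (by positivity)]
      exact hC k
    · rw [indicator_of_notMem (show s ∉ Ioc 0 t from h)]
      simp

variable {φ c}

lemma measurable_solutionAmplitude {X : Type*} [MeasurableSpace X] {t : X → ℝ} (ht : Measurable t)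
    {m : X → ℝ → ℂ} (hm : Measurable fun q : X × ℝ => m q.1 q.2) :
    Measurable fun q : X × (ℝ × ℝ) => solutionAmplitude φ c (t q.1) (m q.1) q.2 := by
  have h1 : Measurable fun q : X × (ℝ × ℝ) => q.2.1 := measurable_fst.comp measurable_snd
  have h2 : Measurable fun q : X × (ℝ × ℝ) => q.2.2 := measurable_snd.comp measurable_snd
  have h3 : Measurable fun q : X × (ℝ × ℝ) => t q.1 := ht.comp measurable_fst
  unfold solutionAmplitude
  refine Measurable.ite ((measurableSet_lt measurable_const h1).inter (measurableSet_le h1 h3)) ?_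
    measurable_const
  refine ((measurable_profileHat φ).comp h2).mul (hm.comp (measurable_fst.prodMk ?_))
  exact (measurable_freq c).comp ((h3.sub h1).prodMk h2)

/-- Up to time T a frequency grows by at most cT, so 1 + |freq| ≤ (1 + cT)(1 + |k|). The growth of
the multiplier is thereby charged to φ̂(k), uniformly in t ≤ T. -/
lemma norm_solutionAmplitude_le (hc : 0 ≤ c) {t T K : ℝ} (htT : t ≤ T) {n : ℕ} {m : ℝ → ℂ}
    (hm : ∀ ξ, ‖m ξ‖ ≤ K * (1 + |ξ|) ^ n) (p : ℝ × ℝ) :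
    ‖solutionAmplitude φ c t m p‖ ≤ (K * (1 + c * T) ^ n) * ‖boundAmplitude φ T n p‖ := by
  have hK : 0 ≤ K := by
    have := (norm_nonneg _).trans (hm 0)
    simpa using this
  by_cases h : 0 < p.1 ∧ p.1 ≤ t
  · have h' : 0 < p.1 ∧ p.1 ≤ T := ⟨h.1, h.2.trans htT⟩
    have hT : 0 ≤ T := by linarith [h'.1, h'.2]
    rw [solutionAmplitude, boundAmplitude, if_pos h, if_pos h', norm_mul, Complex.norm_real,
      Real.norm_of_nonneg (by positivity)]
    have h1 : 1 + |freq c (t - p.1) p.2| ≤ (1 + c * T) * (1 + |p.2|) := by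
      have h2 := abs_freq_le c (t - p.1) p.2
      have h3 : |c * (t - p.1)| ≤ c * T := by
        rw [abs_of_nonneg (mul_nonneg hc (by linarith [h.2]))]
        exact mul_le_mul_of_nonneg_left (by linarith [h.1]) hc
      have h4 : 0 ≤ c * T * |p.2| := by positivity
      nlinarith [abs_nonneg p.2]
    calc ‖profileHat φ p.2‖ * ‖m (freq c (t - p.1) p.2)‖
        ≤ ‖profileHat φ p.2‖ * (K * ((1 + c * T) * (1 + |p.2|)) ^ n) := by
          gcongr
          exact (hm _).trans (by gcongr)
      _ = _ := by rw [mul_pow]; ring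
  · rw [solutionAmplitude, if_neg h, norm_zero]
    by_cases hT : 0 < p.1 ∧ p.1 ≤ T
    · have : 0 ≤ T := by linarith [hT.1, hT.2]
      positivity
    · rw [boundAmplitude, if_neg hT]
      simp

lemma isAmplitude_solutionAmplitude (hc : 0 ≤ c) (t : ℝ) {K : ℝ} {n : ℕ} {m : ℝ → ℂ}
    (hmm : Measurable m) (hm : ∀ ξ, ‖m ξ‖ ≤ K * (1 + |ξ|) ^ n) :
    IsAmplitude (solutionAmplitude φ c t m) := by
  refine (isAmplitude_boundAmplitude φ t n).of_norm_le ?_ _ fun p _ =>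
    norm_solutionAmplitude_le hc le_rfl hm p
  exact (measurable_solutionAmplitude (X := Unit) (t := fun _ => t) (m := fun _ => m)
    measurable_const (hmm.comp measurable_snd)).comp (measurable_const (a := ()).prodMk measurable_id)

lemma isHermitian_solutionAmplitude {t : ℝ} {m : ℝ → ℂ}
    (hm : ∀ ξ, starRingEnd ℂ (m (-ξ)) = m ξ) : IsHermitian (solutionAmplitude φ c t m) := by
  intro s k
  simp only [solutionAmplitude]
  split_ifs
  · rw [map_mul, freq_neg, hm, conj_profileHat_neg]
  · exact map_zero _

lemma norm_wave_le (n : ℕ) (x ξ : ℝ) : ‖wave n x ξ‖ ≤ (2 * Real.pi) ^ n * (1 + |ξ|) ^ n := by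
  rw [norm_wave, mul_pow]
  have := Real.pi_pos
  gcongr
  linarith

end

section

/-! ### Regular versions of the solution and its derivatives -/

variable {φ : 𝓢(ℝ, ℝ)} {c : ℝ}

/-- Two sources of error. For s in the strip (q.1, p.1] only one amplitude is present and nothing is
small except the strip. For earlier s both are present and the difference is Lipschitz in (t, x). -/
lemma exists_norm_waveAmplitude_sub_le (φ : 𝓢(ℝ, ℝ)) (hc : 0 ≤ c) (n N : ℕ) :
    ∃ K : ℝ, 0 ≤ K ∧ ∀ p q : ℝ × ℝ, ‖p‖ ≤ N → ‖q‖ ≤ N → q.1 ≤ p.1 → ∀ z : ℝ × ℝ,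
      ‖solutionAmplitude φ c p.1 (wave n p.2) z - solutionAmplitude φ c q.1 (wave n q.2) z‖
        ≤ K * (1 + z.2 ^ 2)⁻¹ * ((Ioc q.1 p.1).indicator 1 z.1
          + (Ioc 0 (N : ℝ)).indicator 1 z.1 * ‖p - q‖) := by
  obtain ⟨C, hC0, hC⟩ := exists_schwartz_decay (profileHat φ) (n + 1)
  have hpi := Real.two_pi_pos
  have hpi1 : 1 ≤ 2 * Real.pi := by linarith [Real.pi_gt_three]
  set A : ℝ := 2 * Real.pi * (1 + c * N) with hA
  have hcN : 0 ≤ c * N := by positivity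
  have hA1 : 1 ≤ A := by nlinarith
  set B : ℝ := (n + N) * (2 * Real.pi) * c + 1 with hB
  have hB1 : 1 ≤ B := by
    have : 0 ≤ (n + N) * (2 * Real.pi) * c := by positivity
    linarith
  refine ⟨A ^ (n + 1) * B * C, by positivity, fun p q hp hq hqp z => ?_⟩
  rw [Prod.norm_def, max_le_iff] at hp hq
  obtain ⟨hp1, hp2⟩ := hp
  obtain ⟨hq1, hq2⟩ := hq
  rw [Real.norm_eq_abs] at hp1 hp2 hq1 hq2
  obtain ⟨s, k⟩ := z
  simp only [solutionAmplitude]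
  set Q : ℝ := A * (1 + |k|) with hQ
  have hQ1 : 1 ≤ Q := by nlinarith [abs_nonneg k]
  have hfreq : ∀ t : ℝ, |t| ≤ N → 0 < s → s ≤ t → 2 * Real.pi * |freq c (t - s) k| ≤ Q := by
    intro t ht hs hst
    have h2 := abs_freq_le c (t - s) k
    have h3 : |c * (t - s)| ≤ c * N := by
      rw [abs_of_nonneg (mul_nonneg hc (by linarith))]
      exact mul_le_mul_of_nonneg_left (by linarith [le_abs_self t]) hc
    have h4 : 0 ≤ c * N * |k| := by positivity
    have h5 : |freq c (t - s) k| ≤ (1 + c * N) * (1 + |k|) := by nlinarith [abs_nonneg k]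
    calc _ ≤ 2 * Real.pi * ((1 + c * N) * (1 + |k|)) := by gcongr
      _ = Q := by rw [hQ, hA]; ring
  have hψQ : ‖profileHat φ k‖ * Q ^ (n + 1) ≤ A ^ (n + 1) * (C * (1 + k ^ 2)⁻¹) := by
    rw [hQ, mul_pow]
    calc _ = A ^ (n + 1) * (‖profileHat φ k‖ * (1 + |k|) ^ (n + 1)) := by ring
      _ ≤ _ := mul_le_mul_of_nonneg_left (hC k) (by positivity)
  have hd1 : |p.1 - q.1| ≤ ‖p - q‖ := norm_fst_le (p - q)
  have hd2 : |p.2 - q.2| ≤ ‖p - q‖ := norm_snd_le (p - q)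
  have hrhs0 : 0 ≤ A ^ (n + 1) * B * C * (1 + k ^ 2)⁻¹ := by positivity
  have hind0 : 0 ≤ (Ioc 0 (N : ℝ)).indicator (1 : ℝ → ℝ) s * ‖p - q‖ :=
    mul_nonneg (indicator_nonneg (fun _ _ => zero_le_one) _) (norm_nonneg _)
  by_cases h1 : 0 < s ∧ s ≤ p.1
  · rw [if_pos h1]
    have hsN : s ∈ Ioc 0 (N : ℝ) := ⟨h1.1, h1.2.trans ((le_abs_self _).trans hp1)⟩
    by_cases h2 : 0 < s ∧ s ≤ q.1
    · rw [if_pos h2, ← mul_sub, norm_mul, indicator_of_mem hsN,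
        indicator_of_notMem (show s ∉ Ioc q.1 p.1 from fun h => (not_lt.2 h2.2) h.1)]
      have h3 := norm_wave_sub_le n (x := p.2) (y := q.2) hp2
        (hfreq p.1 hp1 h1.1 h1.2) (hfreq q.1 hq1 h2.1 h2.2) hQ1
      have h4 : |freq c (p.1 - s) k - freq c (q.1 - s) k| ≤ c * ‖p - q‖ := by
        refine (abs_freq_sub_le _ _ _ _).trans ?_
        rw [abs_of_nonneg hc, sub_sub_sub_cancel_right]
        gcongr
      have h5 : Q ^ n ≤ Q ^ (n + 1) := pow_le_pow_right₀ hQ1 (by omega)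
      calc _ ≤ ‖profileHat φ k‖ * (((n + N) * (2 * Real.pi)) * Q ^ (n + 1) * (c * ‖p - q‖)
            + Q ^ (n + 1) * ‖p - q‖) := by
            gcongr
            refine h3.trans ?_
            gcongr
        _ = ‖profileHat φ k‖ * Q ^ (n + 1) * (B * ‖p - q‖) := by rw [hB]; ring
        _ ≤ A ^ (n + 1) * (C * (1 + k ^ 2)⁻¹) * (B * ‖p - q‖) := by gcongr
        _ = _ := by simp only [Pi.one_apply]; ring
    · rw [if_neg h2, sub_zero, norm_mul, norm_wave,
        indicator_of_mem (show s ∈ Ioc q.1 p.1 from ⟨not_le.1 fun h => h2 ⟨h1.1, h⟩, h1.2⟩)]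
      calc _ ≤ ‖profileHat φ k‖ * Q ^ n := by
            gcongr
            exact hfreq p.1 hp1 h1.1 h1.2
        _ ≤ ‖profileHat φ k‖ * Q ^ (n + 1) := by
            gcongr
            omega
        _ ≤ A ^ (n + 1) * (C * (1 + k ^ 2)⁻¹) * 1 := by rw [mul_one]; exact hψQ
        _ ≤ A ^ (n + 1) * (C * (1 + k ^ 2)⁻¹) * B := by gcongr
        _ = A ^ (n + 1) * B * C * (1 + k ^ 2)⁻¹ * 1 := by ring
        _ ≤ _ := by
            gcongr
            simp only [Pi.one_apply]
            linarith
  · have h2 : ¬ (0 < s ∧ s ≤ q.1) := fun h => h1 ⟨h.1, h.2.trans hqp⟩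
    rw [if_neg h1, if_neg h2, sub_zero, norm_zero]
    exact mul_nonneg hrhs0 (add_nonneg (indicator_nonneg (fun _ _ => zero_le_one) _) hind0)

lemma integral_indicator_one_le (a b : ℝ) (hab : a ≤ b) :
    ∫ s in Ioi (0 : ℝ), (Ioc a b).indicator (1 : ℝ → ℝ) s ≤ b - a := by
  rw [integral_indicator_one measurableSet_Ioc]
  refine ENNReal.toReal_le_of_le_ofReal (by linarith) ?_
  exact (Measure.restrict_apply_le _ _).trans (by rw [Real.volume_Ioc])

lemma integrable_indicator_one (a b : ℝ) :
    Integrable ((Ioc a b).indicator (1 : ℝ → ℝ)) (volume.restrict (Ioi 0)) :=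
  ((integrable_indicator_iff measurableSet_Ioc).2
    (integrableOn_const (by simp))).restrict

/-- An indicator equals its own square, so the strip contributes its length: the squared norm is
linear, not quadratic, in the time increment. This is where the time exponent 1/2 comes from. -/
lemma exists_integral_waveAmplitude_sub_le (φ : 𝓢(ℝ, ℝ)) (hc : 0 ≤ c) (n N : ℕ) :
    ∃ C : ℝ, ∀ p q : ℝ × ℝ, ‖p‖ ≤ N → ‖q‖ ≤ N →
      ∫ z, ‖solutionAmplitude φ c p.1 (wave n p.2) z
        - solutionAmplitude φ c q.1 (wave n q.2) z‖ ^ 2 ∂spaceTime ≤ C * ‖p - q‖ := by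
  obtain ⟨K, hK0, hK⟩ := exists_norm_waveAmplitude_sub_le φ hc n N
  set G : ℝ := ∫ k : ℝ, ((1 + k ^ 2)⁻¹) ^ 2 with hG
  have hG0 : 0 ≤ G := integral_nonneg fun _ => sq_nonneg _
  have main : ∀ p q : ℝ × ℝ, ‖p‖ ≤ N → ‖q‖ ≤ N → q.1 ≤ p.1 →
      ∫ z, ‖solutionAmplitude φ c p.1 (wave n p.2) z
        - solutionAmplitude φ c q.1 (wave n q.2) z‖ ^ 2 ∂spaceTime
        ≤ 2 * K ^ 2 * (1 + N * (N + N)) * G * ‖p - q‖ := by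
    intro p q hp hq hqp
    have hd : ‖p - q‖ ≤ N + N := (norm_sub_le _ _).trans (add_le_add hp hq)
    have hd1 : p.1 - q.1 ≤ ‖p - q‖ := (le_abs_self _).trans (norm_fst_le (p - q))
    have hi : Integrable (fun s => (Ioc q.1 p.1).indicator (1 : ℝ → ℝ) s
        + ‖p - q‖ ^ 2 * (Ioc 0 (N : ℝ)).indicator (1 : ℝ → ℝ) s) (volume.restrict (Ioi 0)) :=
      (integrable_indicator_one _ _).add ((integrable_indicator_one _ _).const_mul _)
    calc _ ≤ ∫ z, (2 * K ^ 2) * (((Ioc q.1 p.1).indicator (1 : ℝ → ℝ) z.1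
            + ‖p - q‖ ^ 2 * (Ioc 0 (N : ℝ)).indicator (1 : ℝ → ℝ) z.1)
              * ((1 + z.2 ^ 2)⁻¹) ^ 2) ∂spaceTime := by
          refine integral_mono_of_nonneg (Eventually.of_forall fun _ => sq_nonneg _)
            ((hi.mul_prod memLp_inv_one_add_sq.integrable_sq).const_mul _)
            (Eventually.of_forall fun z => ?_)
          refine (pow_le_pow_left₀ (norm_nonneg _) (hK p q hp hq hqp z) 2).trans ?_
          have i1 : (Ioc q.1 p.1).indicator (1 : ℝ → ℝ) z.1 ^ 2
              = (Ioc q.1 p.1).indicator (1 : ℝ → ℝ) z.1 := by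
            by_cases h : z.1 ∈ Ioc q.1 p.1 <;> simp [h]
          have i2 : (Ioc 0 (N : ℝ)).indicator (1 : ℝ → ℝ) z.1 ^ 2
              = (Ioc 0 (N : ℝ)).indicator (1 : ℝ → ℝ) z.1 := by
            by_cases h : z.1 ∈ Ioc 0 (N : ℝ) <;> simp [h]
          set u := (Ioc q.1 p.1).indicator (1 : ℝ → ℝ) z.1
          set v := (Ioc 0 (N : ℝ)).indicator (1 : ℝ → ℝ) z.1
          have h3 : (u + v * ‖p - q‖) ^ 2 ≤ 2 * (u + ‖p - q‖ ^ 2 * v) := by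
            nlinarith [sq_nonneg (u - v * ‖p - q‖)]
          calc _ = K ^ 2 * ((1 + z.2 ^ 2)⁻¹) ^ 2 * (u + v * ‖p - q‖) ^ 2 := by ring
            _ ≤ K ^ 2 * ((1 + z.2 ^ 2)⁻¹) ^ 2 * (2 * (u + ‖p - q‖ ^ 2 * v)) := by gcongr
            _ = _ := by ring
      _ = 2 * K ^ 2 * ((∫ s in Ioi (0 : ℝ), ((Ioc q.1 p.1).indicator (1 : ℝ → ℝ) s
            + ‖p - q‖ ^ 2 * (Ioc 0 (N : ℝ)).indicator (1 : ℝ → ℝ) s)) * G) := by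
          rw [integral_const_mul, spaceTime, hG]
          congr 1
          exact integral_prod_mul (fun s => (Ioc q.1 p.1).indicator (1 : ℝ → ℝ) s
            + ‖p - q‖ ^ 2 * (Ioc 0 (N : ℝ)).indicator (1 : ℝ → ℝ) s)
            (fun k : ℝ => ((1 + k ^ 2)⁻¹) ^ 2)
      _ ≤ 2 * K ^ 2 * ((‖p - q‖ + ‖p - q‖ * (N + N) * N) * G) := by
          gcongr
          rw [integral_add (integrable_indicator_one _ _)
            ((integrable_indicator_one _ _).const_mul _), integral_const_mul]
          have h1 := integral_indicator_one_le q.1 p.1 hqp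
          have h2 := integral_indicator_one_le 0 N (Nat.cast_nonneg N)
          rw [sub_zero] at h2
          have h3 : ‖p - q‖ ^ 2 ≤ ‖p - q‖ * (N + N) := by rw [sq]; gcongr
          have h4 : 0 ≤ ∫ s in Ioi (0 : ℝ), (Ioc 0 (N : ℝ)).indicator (1 : ℝ → ℝ) s :=
            integral_nonneg fun _ => indicator_nonneg (fun _ _ => zero_le_one) _
          exact add_le_add (h1.trans hd1) (mul_le_mul h3 h2 h4 (by positivity))
      _ = _ := by ring
  refine ⟨2 * K ^ 2 * (1 + N * (N + N)) * G, fun p q hp hq => ?_⟩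
  rcases le_total q.1 p.1 with h | h
  · exact main p q hp hq h
  · have := main q p hq hp h
    simp only [norm_sub_rev q p] at this
    refine le_trans (le_of_eq ?_) this
    congr 1
    ext z
    rw [norm_sub_rev]

variable {Ω : Type*} [MeasurableSpace Ω] {P : Measure Ω}

lemma isAmplitude_wave (φ : 𝓢(ℝ, ℝ)) (hc : 0 ≤ c) (n : ℕ) (t x : ℝ) :
    IsAmplitude (solutionAmplitude φ c t (wave n x)) :=
  isAmplitude_solutionAmplitude hc t
    ((continuous_wave n).comp (continuous_const.prodMk continuous_id)).measurable (norm_wave_le n x)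

/-- A family of random fields that are regular versions of the spatial derivatives of the
solution. -/
structure IsSolutionField (P : Measure Ω) (W : (ℝ × ℝ → ℝ) → Ω → ℝ) (φ : 𝓢(ℝ, ℝ)) (c : ℝ)
    (U : ℕ → ℝ × ℝ → Ω → ℝ) : Prop where
  measurable : ∀ n p, Measurable (U n p)
  eq_noise : ∀ n p, U n p =ᵐ[P] W fun x => (kernel (solutionAmplitude φ c p.1 (wave n p.2)) x).re
  eq_spectral : ∀ n p, (fun ω => (U n p ω : ℂ)) =ᵐ[P]
    spectralNoise W (solutionAmplitude φ c p.1 (wave n p.2))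
  continuous : ∀ n ω, Continuous fun p => U n p ω
  holder : ∀ n ω, ∀ α : ℝ, 0 ≤ α → α < 1 / 2 → ∀ N : ℕ, ∃ C : ℝ, ∀ p q, ‖p‖ ≤ N → ‖q‖ ≤ N →
    |U n p ω - U n q ω| ≤ C * ‖p - q‖ ^ α

lemma IsWhiteNoise.exists_isSolutionField [IsProbabilityMeasure P]
    {W : (ℝ × ℝ → ℝ) → Ω → ℝ} (hW : IsWhiteNoise P W) (φ : 𝓢(ℝ, ℝ)) (hc : 0 ≤ c) :
    ∃ U, IsSolutionField P W φ c U := by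
  have h := fun n : ℕ => hW.exists_holder_spectralNoise
    (a := fun p => solutionAmplitude φ c p.1 (wave n p.2)) (fun p => isAmplitude_wave φ hc n p.1 p.2)
    (fun p => isHermitian_solutionAmplitude (conj_wave_neg n p.2))
    (exists_integral_waveAmplitude_sub_le φ hc n)
  choose U h1 h2 h3 h4 h5 using h
  exact ⟨U, h1, h2, h3, h4, h5⟩

namespace IsSolutionField

variable {W : (ℝ × ℝ → ℝ) → Ω → ℝ} {U : ℕ → ℝ × ℝ → Ω → ℝ}

lemma measurable_prod (hU : IsSolutionField P W φ c U) (n : ℕ) :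
    Measurable fun q : (ℝ × ℝ) × Ω => U n q.1 q.2 :=
  (stronglyMeasurable_uncurry_of_continuous_of_stronglyMeasurable (hU.continuous n)
    fun p => (hU.measurable n p).stronglyMeasurable).measurable

lemma measurable_comp (hU : IsSolutionField P W φ c U) (n : ℕ) {X : Type*} [MeasurableSpace X]
    {t x : X → ℝ} (ht : Measurable t) (hx : Measurable x) :
    Measurable fun q : X × Ω => U n (t q.1, x q.1) q.2 :=
  (hU.measurable_prod n).comp
    (((ht.comp measurable_fst).prodMk (hx.comp measurable_fst)).prodMk measurable_snd)

/-- By stochastic Fubini the integral has the integrated amplitude, and integrating `wave (n + 1)`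
in x gives the increment of `wave n`. -/
lemma setIntegral_eq_sub [IsProbabilityMeasure P] (hU : IsSolutionField P W φ c U)
    (hW : IsWhiteNoise P W) (hc : 0 ≤ c) (n : ℕ) (t : ℝ) {x y : ℝ} (hxy : x ≤ y) :
    ∀ᵐ ω ∂P, ∫ z in x..y, U (n + 1) (t, z) ω = U n (t, y) ω - U n (t, x) ω := by
  have hpi := Real.pi_pos
  have hm : Measurable fun q : ℝ × ℝ => wave (n + 1) q.1 q.2 := (continuous_wave (n + 1)).measurable
  set K : ℝ := (2 * Real.pi) ^ (n + 1) * (1 + c * t) ^ (n + 1)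
  obtain ⟨-, hA, h⟩ := hW.integral_eq_spectralNoise (X := ℝ) (ν := volume.restrict (Ioc x y))
    (a := fun z => solutionAmplitude φ c t (wave (n + 1) z))
    (Y := fun z ω => (U (n + 1) (t, z) ω : ℂ)) (w := fun _ => |K| + 1)
    (b := boundAmplitude φ t (n + 1))
    (Complex.measurable_ofReal.comp (hU.measurable_comp (n + 1) measurable_const
      measurable_id)).aestronglyMeasurable
    (Eventually.of_forall fun z => hU.eq_spectral (n + 1) (t, z))
    (measurable_solutionAmplitude measurable_const hm)
    (integrable_const _) (fun _ => by positivity) (isAmplitude_boundAmplitude φ t (n + 1))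
    (fun z p _ => (norm_solutionAmplitude_le hc le_rfl (norm_wave_le (n + 1) z) p).trans (by
      gcongr
      linarith [le_abs_self K]))
  have hsum : ∀ p, solutionAmplitude φ c t (wave n x) p
      + ∫ z in Ioc x y, solutionAmplitude φ c t (wave (n + 1) z) p
        = solutionAmplitude φ c t (wave n y) p := by
    intro p
    by_cases hp : 0 < p.1 ∧ p.1 ≤ t
    · simp only [solutionAmplitude, if_pos hp]
      rw [integral_const_mul, ← intervalIntegral.integral_of_le hxy,
        intervalIntegral.integral_eq_sub_of_hasDerivAt (fun z _ => hasDerivAt_wave n z _)]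
      · ring
      · exact ((continuous_wave (n + 1)).comp
          (continuous_id.prodMk continuous_const)).intervalIntegrable _ _
    · simp [solutionAmplitude, if_neg hp]
  have hadd := hW.spectralNoise_add (isAmplitude_wave φ hc n t x) hA (isAmplitude_wave φ hc n t y)
    (Eventually.of_forall hsum)
  filter_upwards [h, hadd, hU.eq_spectral n (t, x), hU.eq_spectral n (t, y)] with ω h1 h2 h3 h4
  rw [← h1, ← h3, ← h4, integral_complex_ofReal, ← Complex.ofReal_add, Complex.ofReal_inj] at h2
  rw [intervalIntegral.integral_of_le hxy]
  linarith

/-- Almost surely the fields are the successive spatial derivatives of `U 0`. -/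
lemma ae_hasDerivAt [IsProbabilityMeasure P] (hU : IsSolutionField P W φ c U)
    (hW : IsWhiteNoise P W) (hc : 0 ≤ c) :
    ∀ᵐ ω ∂P, ∀ n t x, HasDerivAt (fun x => U n (t, x) ω) (U (n + 1) (t, x) ω) x := by
  -- Rational t and x give one null set for all identities. Both sides are continuous in (t, x), so
  -- density extends them to all real points.
  have h : ∀ᵐ ω ∂P, ∀ (n : ℕ) (t x : ℚ),
      ∫ z in (0 : ℝ)..x, U (n + 1) (t, z) ω = U n (t, x) ω - U n (t, 0) ω := by
    simp only [ae_all_iff]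
    intro n t x
    rcases le_total (0 : ℝ) x with h0 | h0
    · exact hU.setIntegral_eq_sub hW hc n t h0
    · filter_upwards [hU.setIntegral_eq_sub hW hc n t h0] with ω hω
      rw [intervalIntegral.integral_symm, hω, neg_sub]
  filter_upwards [h] with ω hω n t x
  have hcont : Continuous fun p : ℝ × ℝ => ∫ z in (0 : ℝ)..p.2, U (n + 1) (p.1, z) ω := by
    refine intervalIntegral.continuous_parametric_intervalIntegral_of_continuous
      (f := fun (p : ℝ × ℝ) z => U (n + 1) (p.1, z) ω) ?_ continuous_snd
    exact (hU.continuous (n + 1) ω).comp (by fun_prop)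
  have hcont2 : Continuous fun p : ℝ × ℝ => U n p ω - U n (p.1, 0) ω :=
    (hU.continuous n ω).sub ((hU.continuous n ω).comp (by fun_prop))
  have hdense : DenseRange (Prod.map ((↑) : ℚ → ℝ) ((↑) : ℚ → ℝ)) :=
    Rat.denseRange_cast.prodMap Rat.denseRange_cast
  have heq := hdense.equalizer hcont hcont2 (funext fun q => hω n q.1 q.2)
  have hline : Continuous fun z => U (n + 1) (t, z) ω :=
    (hU.continuous (n + 1) ω).comp (by fun_prop)
  have hint : HasDerivAt (fun y => ∫ z in (0 : ℝ)..y, U (n + 1) (t, z) ω)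
      (U (n + 1) (t, x) ω) x :=
    intervalIntegral.integral_hasDerivAt_right (hline.intervalIntegrable _ _)
      (hline.stronglyMeasurableAtFilter _ _) hline.continuousAt
  have e : (fun y => U n (t, y) ω)
      = fun y => (∫ z in (0 : ℝ)..y, U (n + 1) (t, z) ω) + U n (t, 0) ω := by
    ext y
    have := congrFun heq (t, y)
    simp only at this
    linarith
  rw [e]
  exact hint.add_const _

lemma ae_contDiff [IsProbabilityMeasure P] (hU : IsSolutionField P W φ c U)
    (hW : IsWhiteNoise P W) (hc : 0 ≤ c) :
    ∀ᵐ ω ∂P, ∀ n t, ContDiff ℝ (⊤ : ℕ∞) fun x => U n (t, x) ω := by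
  filter_upwards [hU.ae_hasDerivAt hW hc] with ω hω n t
  rw [contDiff_infty]
  intro m
  -- Differentiation passes from `U n` to `U (n + 1)`, so the order of smoothness is raised for all
  -- n simultaneously.
  induction m generalizing n with
  | zero =>
    exact contDiff_zero.2 ((hU.continuous n ω).comp (by fun_prop))
  | succ m ih =>
    have hd : deriv (fun x => U n (t, x) ω) = fun x => U (n + 1) (t, x) ω :=
      funext fun x => (hω n t x).deriv
    push_cast
    rw [contDiff_succ_iff_deriv, hd]
    exact ⟨fun x => (hω n t x).differentiableAt, by simp, ih (n + 1)⟩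

end IsSolutionField

end

section

/-! ### Pairings of the solution with test functions -/

variable {Ω : Type*} [MeasurableSpace Ω] {P : Measure Ω} {W : (ℝ × ℝ → ℝ) → Ω → ℝ}
  {φ : 𝓢(ℝ, ℝ)} {c : ℝ} {U : ℕ → ℝ × ℝ → Ω → ℝ}

/-- Same orthogonality argument as for `spectralNoise_add`: homogeneity comes from the isometry, not
from an assumption on W. -/
lemma IsWhiteNoise.spectralNoise_const_mul (hW : IsWhiteNoise P W) {a : ℝ × ℝ → ℂ}
    (ha : IsAmplitude a) (z : ℂ) :
    (fun ω => z * spectralNoise W a ω) =ᵐ[P] spectralNoise W (fun p => z * a p) := by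
  have hb := ha.const_mul z
  have ma := hW.memLp_spectralNoise ha
  have mb := hW.memLp_spectralNoise hb
  set D : Ω → ℂ := fun ω => z * spectralNoise W a ω - spectralNoise W (fun p => z * a p) ω with hD
  have mD : MemLp D 2 P := (ma.const_mul z).sub mb
  have horth : ∀ {e : ℝ × ℝ → ℂ}, IsAmplitude e →
      ∫ ω, D ω * starRingEnd ℂ (spectralNoise W e ω) ∂P = 0 := by
    intro e he
    have me := hW.memLp_spectralNoise he
    simp only [hD, sub_mul, mul_assoc]
    rw [integral_sub ((integrable_mul_conj ma me).const_mul z) (integrable_mul_conj mb me),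
      integral_const_mul, hW.integral_spectralNoise_mul_conj ha he,
      hW.integral_spectralNoise_mul_conj hb he, ← integral_const_mul]
    simp only [mul_assoc, sub_self]
  have hz : D =ᵐ[P] 0 := by
    refine ae_eq_zero_of_integral_mul_conj_eq_zero mD ?_
    have e : ∀ ω, D ω * starRingEnd ℂ (D ω)
        = starRingEnd ℂ z * (D ω * starRingEnd ℂ (spectralNoise W a ω))
          - D ω * starRingEnd ℂ (spectralNoise W (fun p => z * a p) ω) := by
      intro ω
      nth_rewrite 2 [hD]
      rw [map_sub, map_mul]
      ring
    simp only [e]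
    rw [integral_sub ((integrable_mul_conj mD ma).const_mul _) (integrable_mul_conj mD mb),
      integral_const_mul, horth ha, horth hb]
    simp
  filter_upwards [hz] with ω hω
  simpa [hD, sub_eq_zero] using hω

lemma norm_wave_zero (x ξ : ℝ) : ‖wave 0 x ξ‖ = 1 := by rw [norm_wave, pow_zero]

lemma integral_mul_wave (g : ℝ → ℂ) (ξ : ℝ) : ∫ x, g x * wave 0 x ξ = 𝓕⁻ g ξ := by
  rw [fourierInv_eq_integral]
  congr 1
  ext x
  rw [wave, pow_zero, one_mul, mul_comm, mul_right_comm]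

/-- Averaging the plane waves e^{2πixξ} against g gives 𝓕⁻g(ξ). Hence the observable of u(t) given
by g has Fourier multiplier 𝓕⁻g. -/
lemma integral_mul_solutionAmplitude (t : ℝ) (g : ℝ → ℂ) (p : ℝ × ℝ) :
    ∫ x, g x * solutionAmplitude φ c t (wave 0 x) p = solutionAmplitude φ c t (𝓕⁻ g) p := by
  simp only [solutionAmplitude]
  split_ifs
  · rw [← integral_mul_wave, ← integral_const_mul]
    congr 1
    ext x
    ring
  · simp

lemma norm_waveAmplitude_le (hc : 0 ≤ c) {t T : ℝ} (htT : t ≤ T) (x : ℝ) (p : ℝ × ℝ) :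
    ‖solutionAmplitude φ c t (wave 0 x) p‖ ≤ ‖boundAmplitude φ T 0 p‖ := by
  have h := norm_solutionAmplitude_le (φ := φ) (K := 1) (n := 0) (m := wave 0 x) hc htT
    (fun ξ => by rw [norm_wave_zero, pow_zero, one_mul]) p
  simpa using h

lemma inv_one_add_sq_pos (x : ℝ) : 0 < (1 + x ^ 2)⁻¹ := by positivity

lemma exists_schwartz_le {E : Type*} [NormedAddCommGroup E] [NormedSpace ℝ E] (f : 𝓢(ℝ, E)) :
    ∃ C : ℝ, 0 < C ∧ ∀ x, ‖f x‖ ≤ C * (1 + x ^ 2)⁻¹ := by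
  set C := 2 ^ 2 * (Finset.Iic (2, 0)).sup (fun m => SchwartzMap.seminorm ℝ m.1 m.2) f
  refine ⟨max C 1, by positivity, fun k => ?_⟩
  have h := SchwartzMap.one_add_le_sup_seminorm_apply (𝕜 := ℝ) (m := (2, 0)) (k := 2)
    (n := 0) le_rfl le_rfl f k
  rw [norm_iteratedFDeriv_zero, Real.norm_eq_abs] at h
  rw [← div_eq_mul_inv, le_div_iff₀ (by positivity)]
  calc ‖f k‖ * (1 + k ^ 2) ≤ ‖f k‖ * (1 + |k|) ^ 2 := by
        gcongr
        nlinarith [abs_nonneg k, sq_abs k]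
    _ = (1 + |k|) ^ 2 * ‖f k‖ := by ring
    _ ≤ max C 1 := h.trans (le_max_left _ _)

namespace IsSolutionField

lemma locallyIntegrableOn (hU : IsSolutionField P W φ c U) (ω : Ω) (s : Set (ℝ × ℝ)) :
    LocallyIntegrableOn (fun p : ℝ × ℝ => U 0 (p.1, p.2) ω) s :=
  ((hU.continuous 0 ω).locallyIntegrable).locallyIntegrableOn s

/-- The window 0 < s ≤ 0 is empty, so the kernel vanishes. Rational x and continuity then give a
single null set. -/
lemma ae_initial (hU : IsSolutionField P W φ c U) (hW : IsWhiteNoise P W) :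
    ∀ᵐ ω ∂P, ∀ x, U 0 (0, x) ω = 0 := by
  have h0 : ∀ x, solutionAmplitude φ c 0 (wave 0 x) = fun _ => 0 := fun x => by
    ext p
    rw [solutionAmplitude, if_neg fun h => absurd h.1 (not_lt.2 h.2)]
  have hk : ∀ p : ℝ × ℝ, (kernel (fun _ => 0) p).re = 0 := fun p => by
    simp [kernel, fourier_eq_integral]
  have h : ∀ᵐ ω ∂P, ∀ x : ℚ, U 0 (0, x) ω = 0 := by
    rw [ae_all_iff]
    intro x
    filter_upwards [hU.eq_noise 0 (0, x), hW.map_zero] with ω h1 h2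
    simp only [h0, hk] at h1
    rw [h1, h2]
  filter_upwards [h] with ω hω x
  have hcont : Continuous fun x => U 0 (0, x) ω := (hU.continuous 0 ω).comp (by fun_prop)
  exact congrFun (Rat.denseRange_cast.equalizer hcont continuous_const (funext hω)) x

lemma isGaussianProcess (hU : IsSolutionField P W φ c U) (hW : IsWhiteNoise P W) (hc : 0 ≤ c) :
    IsGaussianProcess (fun p : ℝ≥0 × ℝ => U 0 ((p.1 : ℝ), p.2)) P := by
  refine (hW.gaussian.comp_right fun p : ℝ≥0 × ℝ =>
    ⟨fun x => (kernel (solutionAmplitude φ c p.1 (wave 0 p.2)) x).re,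
      memLp_re (isAmplitude_wave φ hc 0 p.1 p.2).memLp_kernel⟩).congr fun p => ?_
  exact (hU.eq_noise 0 ((p.1 : ℝ), p.2)).symm

lemma exists_holderOnWith (hU : IsSolutionField P W φ c U) (ω : Ω) (x : ℝ) {α : ℝ≥0}
    (hα : α < 1 / 2) (T : ℝ) :
    ∃ K : ℝ≥0, HolderOnWith K α (fun t => U 0 (t, x) ω) (Icc 0 T) := by
  obtain ⟨N, hN⟩ := exists_nat_ge (max T |x|)
  obtain ⟨C, hC⟩ := hU.holder 0 ω α (NNReal.coe_nonneg α) (by exact_mod_cast hα) N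
  have hmem : ∀ t ∈ Icc 0 T, ‖(t, x)‖ ≤ N := fun t ht => by
    rw [Prod.norm_def, max_le_iff]
    exact ⟨by rw [Real.norm_of_nonneg ht.1]; exact ht.2.trans ((le_max_left _ _).trans hN),
      (le_max_right _ _).trans hN⟩
  refine ⟨C.toNNReal, fun s hs t ht => ?_⟩
  have h := hC (s, x) (t, x) (hmem s hs) (hmem t ht)
  have e : ‖((s, x) : ℝ × ℝ) - (t, x)‖ = dist s t := by
    simp [Prod.norm_def, Real.dist_eq]
  rw [e] at h
  rw [edist_dist, edist_dist, ENNReal.ofReal_rpow_of_nonneg (dist_nonneg (x := s) (y := t)) (NNReal.coe_nonneg α), ← ENNReal.ofReal_coe_nnreal,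
    ← ENNReal.ofReal_mul (NNReal.coe_nonneg _)]
  refine ENNReal.ofReal_le_ofReal (h.trans ?_)
  gcongr
  exact Real.le_coe_toNNReal C

variable [IsProbabilityMeasure P]

/-- Pairings with integrable functions are white noise integrals. -/
theorem integral_mul_eq (hU : IsSolutionField P W φ c U) (hW : IsWhiteNoise P W) (hc : 0 ≤ c)
    (t : ℝ) {g : ℝ → ℂ} (hg : Measurable g) {C : ℝ} (hgC : ∀ x, ‖g x‖ ≤ C * (1 + x ^ 2)⁻¹) :
    (∀ᵐ ω ∂P, Integrable fun x => (U 0 (t, x) ω : ℂ) * g x) ∧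
      IsAmplitude (solutionAmplitude φ c t (𝓕⁻ g)) ∧
      (fun ω => ∫ x, (U 0 (t, x) ω : ℂ) * g x) =ᵐ[P]
        spectralNoise W (solutionAmplitude φ c t (𝓕⁻ g)) := by
  have hm : Measurable fun q : ℝ × ℝ => wave 0 q.1 q.2 := (continuous_wave 0).measurable
  have hwm : Integrable fun x : ℝ => (|C| + 1) * (1 + x ^ 2)⁻¹ :=
    integrable_inv_one_add_sq.const_mul _
  have h := hW.integral_eq_spectralNoise (X := ℝ) (ν := volume)
    (a := fun x p => g x * solutionAmplitude φ c t (wave 0 x) p)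
    (Y := fun x ω => (U 0 (t, x) ω : ℂ) * g x) (w := fun x => (|C| + 1) * (1 + x ^ 2)⁻¹)
    (b := boundAmplitude φ t 0)
    ((Complex.measurable_ofReal.comp (hU.measurable_comp 0 measurable_const measurable_id)).mul
      (hg.comp measurable_fst)).aestronglyMeasurable
    (Eventually.of_forall fun x => by
      filter_upwards [hU.eq_spectral 0 (t, x),
        hW.spectralNoise_const_mul (isAmplitude_wave φ hc 0 t x) (g x)] with ω h1 h2
      rw [h1, mul_comm, h2])
    ((hg.comp measurable_fst).mul (measurable_solutionAmplitude measurable_const hm))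
    hwm (fun x => by positivity) (isAmplitude_boundAmplitude φ t 0)
    (fun x p _ => by
      rw [norm_mul]
      refine mul_le_mul ((hgC x).trans ?_) (norm_waveAmplitude_le hc le_rfl x p) (norm_nonneg _)
        (by positivity)
      have := le_abs_self C
      gcongr
      linarith)
  simpa only [integral_mul_solutionAmplitude] using h

lemma pairing_eq (hU : IsSolutionField P W φ c U) (hW : IsWhiteNoise P W) (hc : 0 ≤ c)
    (t : ℝ) (g : 𝓢(ℝ, ℂ)) : IsAmplitude (solutionAmplitude φ c t (𝓕⁻ (g : ℝ → ℂ))) ∧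
      pairing (fun t x => U 0 (t, x)) t g =ᵐ[P]
        spectralNoise W (solutionAmplitude φ c t (𝓕⁻ (g : ℝ → ℂ))) := by
  obtain ⟨C, -, hC⟩ := exists_schwartz_le g
  exact (hU.integral_mul_eq hW hc t g.continuous.measurable hC).2

lemma memLp_pairing (hU : IsSolutionField P W φ c U) (hW : IsWhiteNoise P W) (hc : 0 ≤ c)
    (t : ℝ) (g : 𝓢(ℝ, ℂ)) : MemLp (pairing (fun t x => U 0 (t, x)) t g) 2 P := by
  obtain ⟨h1, h2⟩ := hU.pairing_eq hW hc t g
  exact (hW.memLp_spectralNoise h1).ae_eq h2.symm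

/-- The single weight (1 + x²)⁻¹ dominates every Schwartz function up to a constant, so
integrability against it yields one null set valid for all g. -/
lemma ae_integrable_mul_schwartz (hU : IsSolutionField P W φ c U) (hW : IsWhiteNoise P W)
    (hc : 0 ≤ c) (t : ℝ) :
    ∀ᵐ ω ∂P, ∀ g : 𝓢(ℝ, ℂ), Integrable (fun x => (U 0 (t, x) ω : ℂ) * g x) := by
  have h := (hU.integral_mul_eq hW hc t (g := fun x => (((1 + x ^ 2)⁻¹ : ℝ) : ℂ)) (C := 1)
    (by fun_prop) fun x => by
      rw [one_mul, Complex.norm_real, Real.norm_of_nonneg (inv_one_add_sq_pos x).le]).1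
  filter_upwards [h] with ω hω g
  obtain ⟨C, hC0, hC⟩ := exists_schwartz_le g
  have hcont : Continuous fun x => U 0 (t, x) ω := (hU.continuous 0 ω).comp (by fun_prop)
  refine (hω.norm.const_mul C).mono'
    ((Complex.continuous_ofReal.comp hcont).mul g.continuous).aestronglyMeasurable
    (Eventually.of_forall fun x => ?_)
  rw [norm_mul, norm_mul, Complex.norm_real ((1 + x ^ 2)⁻¹),
    Real.norm_of_nonneg (inv_one_add_sq_pos x).le]
  calc _ ≤ ‖(U 0 (t, x) ω : ℂ)‖ * (C * (1 + x ^ 2)⁻¹) := by gcongr; exact hC x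
    _ = _ := by ring

end IsSolutionField

end

section

/-! ### The mean of the solution -/

variable {Ω : Type*} [MeasurableSpace Ω] {P : Measure Ω} {W : (ℝ × ℝ → ℝ) → Ω → ℝ}
  {φ : 𝓢(ℝ, ℝ)} {c : ℝ} {U : ℕ → ℝ × ℝ → Ω → ℝ}

lemma profileHat_zero (hφ : ∫ x, φ x = 0) : profileHat φ 0 = 0 := by
  rw [profileHat_eq, fourier_eq_integral]
  simp [integral_complex_ofReal, hφ]

/-- The zero mean of φ gives φ̂(0) = 0, hence linear vanishing at the origin, which is combined with
the decay at infinity. -/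
lemma exists_profileHat_le (hφ : ∫ x, φ x = 0) :
    ∃ D : ℝ, 0 ≤ D ∧ ∀ k, ‖profileHat φ k‖ ≤ D * (1 + k ^ 2)⁻¹ * |k| := by
  obtain ⟨C, hC0, hC⟩ := exists_schwartz_le (profileHat φ)
  obtain ⟨L, hL0, hL⟩ := exists_schwartz_le (SchwartzMap.derivCLM ℝ ℂ (profileHat φ))
  have hlip : ∀ k, ‖profileHat φ k‖ ≤ L * |k| := by
    intro k
    have h := Convex.norm_image_sub_le_of_norm_deriv_le (𝕜 := ℝ) (f := profileHat φ) (C := L)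
      (s := univ) (x := 0) (y := k) (fun x _ => (profileHat φ).differentiableAt) (fun x _ => by
        have := hL x
        rw [SchwartzMap.derivCLM_apply] at this
        refine this.trans (mul_le_of_le_one_right hL0.le (inv_le_one_of_one_le₀ ?_))
        nlinarith [sq_nonneg x]) convex_univ (mem_univ _) (mem_univ _)
    rwa [profileHat_zero hφ, sub_zero, sub_zero, Real.norm_eq_abs] at h
  -- The decay constant C serves |k| ≥ 1. The Lipschitz constant L serves |k| ≤ 1, where 1 ≤ 2(1 +
  -- k²)⁻¹.
  refine ⟨C + 2 * L, by positivity, fun k => ?_⟩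
  have hk := inv_one_add_sq_pos k
  rcases le_total |k| 1 with h | h
  · have h1 : 1 ≤ 2 * (1 + k ^ 2)⁻¹ := by
      rw [← div_eq_mul_inv, one_le_div (by positivity)]
      nlinarith [sq_abs k, abs_nonneg k]
    calc _ ≤ L * |k| := hlip k
      _ ≤ L * |k| * (2 * (1 + k ^ 2)⁻¹) := le_mul_of_one_le_right (by positivity) h1
      _ = (2 * L) * (1 + k ^ 2)⁻¹ * |k| := by ring
      _ ≤ _ := by gcongr; linarith
  · calc _ ≤ C * (1 + k ^ 2)⁻¹ := hC k
      _ ≤ (C + 2 * L) * (1 + k ^ 2)⁻¹ := by gcongr; linarith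
      _ ≤ _ := le_mul_of_one_le_right (by positivity) h

lemma fourierInv_comp_div (g : ℝ → ℂ) {R : ℝ} (hR : 0 < R) (ξ : ℝ) :
    𝓕⁻ (fun x => g (x / R)) ξ = R * 𝓕⁻ g (R * ξ) := by
  rw [fourierInv_eq_integral, fourierInv_eq_integral]
  have h := Measure.integral_comp_div (fun v =>
    Complex.exp (((2 * Real.pi * v * (R * ξ) : ℝ) : ℂ) * Complex.I) * g v) R
  rw [abs_of_pos hR, Complex.real_smul] at h
  rw [← h]
  congr 1
  ext v
  congr 4
  field_simp

lemma eLpNorm_two_eq {E : Type*} [NormedAddCommGroup E] {f : Ω → E} (hf : MemLp f 2 P) :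
    eLpNorm f 2 P = ENNReal.ofReal ((∫ ω, ‖f ω‖ ^ 2 ∂P) ^ (2⁻¹ : ℝ)) := by
  rw [hf.eLpNorm_eq_integral_rpow_norm (by simp) (by simp)]
  simp

lemma IsWhiteNoise.integral_norm_spectralNoise_sq (hW : IsWhiteNoise P W) {a : ℝ × ℝ → ℂ}
    (ha : IsAmplitude a) : ∫ ω, ‖spectralNoise W a ω‖ ^ 2 ∂P = ∫ p, ‖a p‖ ^ 2 ∂spaceTime := by
  have h := hW.integral_spectralNoise_mul_conj ha ha
  simp only [Complex.mul_conj, Complex.normSq_eq_norm_sq] at h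
  rwa [integral_complex_ofReal, integral_complex_ofReal, Complex.ofReal_inj] at h

lemma ae_spaceTime_snd_ne_zero : ∀ᵐ p ∂spaceTime, p.2 ≠ 0 :=
  Measure.quasiMeasurePreserving_snd.ae (Measure.ae_ne volume 0)

/-- The dilated multiplier Rψ(Rξ) concentrates at the origin, but φ̂ supplies a factor |k| and |k| ≤
|ξ| along characteristics. With z = R|ξ| the product is at most a multiple of z/(1 + z²). This is
bounded by 1, for domination, and by 1/(R|k|), for convergence at each k ≠ 0. -/
lemma tendsto_integral_norm_dilatedAmplitude_sq (hc : 0 ≤ c) (hφ : ∫ x, φ x = 0) (t : ℝ)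
    (ψ : 𝓢(ℝ, ℂ)) :
    Tendsto (fun R : ℝ => ∫ p, ‖solutionAmplitude φ c t (fun ξ => (R : ℂ) * ψ (R * ξ)) p‖ ^ 2
      ∂spaceTime) atTop (𝓝 0) := by
  obtain ⟨D, hD0, hD⟩ := exists_profileHat_le hφ
  obtain ⟨M, hM0, hM⟩ := exists_schwartz_le ψ
  have key : ∀ R : ℝ, 0 < R → ∀ p : ℝ × ℝ, p.2 ≠ 0 →
      ‖solutionAmplitude φ c t (fun ξ => (R : ℂ) * ψ (R * ξ)) p‖
        ≤ (Ioc 0 t).indicator (fun _ => D * M) p.1 * (1 + p.2 ^ 2)⁻¹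
          * min 1 (R⁻¹ * |p.2|⁻¹) := by
    intro R hR p hp
    have hp' : 0 < |p.2| := abs_pos.2 hp
    by_cases h : 0 < p.1 ∧ p.1 ≤ t
    · rw [solutionAmplitude, if_pos h, indicator_of_mem (show p.1 ∈ Ioc 0 t from h), norm_mul,
        norm_mul, Complex.norm_real, Real.norm_of_nonneg hR.le]
      set ξ := freq c (t - p.1) p.2
      have hξ : |p.2| ≤ |ξ| := by
        have hct : 0 ≤ c * (t - p.1) := mul_nonneg hc (by linarith [h.2])
        rw [abs_freq hct hp]
        linarith
      have hξ' : 0 < |ξ| := hp'.trans_le hξ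
      have h1 : R * ‖ψ (R * ξ)‖ * |p.2| ≤ M * min 1 (R⁻¹ * |p.2|⁻¹) := by
        calc R * ‖ψ (R * ξ)‖ * |p.2| ≤ R * (M * (1 + (R * ξ) ^ 2)⁻¹) * |ξ| := by
              gcongr
              exact hM _
          _ = M * ((R * |ξ|) * (1 + (R * |ξ|) ^ 2)⁻¹) := by
              rw [mul_pow, mul_pow, sq_abs]
              ring
          _ ≤ M * min 1 (R⁻¹ * |p.2|⁻¹) := by
              gcongr
              have hz : 0 < R * |ξ| := by positivity
              rw [← div_eq_mul_inv, le_min_iff]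
              constructor
              · rw [div_le_one (by positivity)]
                nlinarith [sq_nonneg (R * |ξ| - 1)]
              · rw [← mul_inv]
                calc _ ≤ (R * |ξ|)⁻¹ := by
                      rw [div_le_iff₀ (by positivity)]
                      field_simp
                      linarith
                  _ ≤ _ := by gcongr
      calc _ ≤ D * (1 + p.2 ^ 2)⁻¹ * |p.2| * (R * ‖ψ (R * ξ)‖) := by gcongr; exact hD _
        _ = D * (1 + p.2 ^ 2)⁻¹ * (R * ‖ψ (R * ξ)‖ * |p.2|) := by ring
        _ ≤ D * (1 + p.2 ^ 2)⁻¹ * (M * min 1 (R⁻¹ * |p.2|⁻¹)) := by gcongr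
        _ = _ := by ring
    · rw [solutionAmplitude, if_neg h, norm_zero]
      refine mul_nonneg (mul_nonneg (indicator_nonneg (fun _ _ => by positivity) _) ?_) ?_
      · positivity
      · positivity
  have hmeas : ∀ R : ℝ, Measurable (solutionAmplitude φ c t (fun ξ => (R : ℂ) * ψ (R * ξ))) := by
    intro R
    obtain ⟨K, hK⟩ : ∃ K : ℝ, ∀ ξ : ℝ, ‖(R : ℂ) * ψ (R * ξ)‖ ≤ K * (1 + |ξ|) ^ 0 := by
      refine ⟨|R| * M, fun ξ => ?_⟩
      rw [norm_mul, Complex.norm_real, pow_zero, mul_one, Real.norm_eq_abs]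
      gcongr
      refine (hM _).trans (mul_le_of_le_one_right hM0.le (inv_le_one_of_one_le₀ ?_))
      nlinarith [sq_nonneg (R * ξ)]
    refine (isAmplitude_solutionAmplitude hc t ?_ hK).measurable
    have := ψ.continuous.measurable
    fun_prop
  have hdom : Integrable (fun p : ℝ × ℝ => ((Ioc 0 t).indicator (fun _ => (D * M) ^ 2) p.1)
      * ((1 + p.2 ^ 2)⁻¹) ^ 2) spaceTime := by
    have h1 : Integrable ((Ioc 0 t).indicator (fun _ : ℝ => (D * M) ^ 2))
        (volume.restrict (Ioi 0)) :=
      ((integrable_indicator_iff measurableSet_Ioc).2 (integrableOn_const (by simp))).restrict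
    exact h1.mul_prod memLp_inv_one_add_sq.integrable_sq
  have hind : ∀ s, ((Ioc 0 t).indicator (fun _ : ℝ => D * M) s) ^ 2
      = (Ioc 0 t).indicator (fun _ => (D * M) ^ 2) s := fun s => by
    by_cases h : s ∈ Ioc 0 t <;> simp [h]
  have h0 : (0 : ℝ) = ∫ _p : ℝ × ℝ, (0 : ℝ) ∂spaceTime := by simp
  rw [h0]
  refine tendsto_integral_filter_of_dominated_convergence _
    (Eventually.of_forall fun R => ((hmeas R).norm.pow_const 2).aestronglyMeasurable) ?_ hdom ?_
  · filter_upwards [eventually_gt_atTop 0] with R hR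
    filter_upwards [ae_spaceTime_snd_ne_zero] with p hp
    rw [Real.norm_of_nonneg (sq_nonneg _), ← hind, ← mul_pow]
    refine pow_le_pow_left₀ (norm_nonneg _) ((key R hR p hp).trans ?_) 2
    refine mul_le_of_le_one_right (mul_nonneg (indicator_nonneg (fun _ _ => by positivity) _) ?_)
      (min_le_left _ _)
    positivity
  · filter_upwards [ae_spaceTime_snd_ne_zero] with p hp
    have h1 : Tendsto (fun R : ℝ => (Ioc 0 t).indicator (fun _ => D * M) p.1 * (1 + p.2 ^ 2)⁻¹
        * (R⁻¹ * |p.2|⁻¹)) atTop (𝓝 0) := by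
      have := (tendsto_inv_atTop_zero.mul_const (|p.2|⁻¹)).const_mul
        ((Ioc 0 t).indicator (fun _ => D * M) p.1 * (1 + p.2 ^ 2)⁻¹)
      simpa using this
    have h2 : Tendsto (fun R : ℝ => ‖solutionAmplitude φ c t (fun ξ => (R : ℂ) * ψ (R * ξ)) p‖)
        atTop (𝓝 0) := by
      refine squeeze_zero' (Eventually.of_forall fun _ => norm_nonneg _) ?_ h1
      filter_upwards [eventually_gt_atTop 0] with R hR
      refine (key R hR p hp).trans (mul_le_mul_of_nonneg_left (min_le_right _ _) ?_)
      exact mul_nonneg (indicator_nonneg (fun _ _ => by positivity) _) (by positivity)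
    simpa using h2.pow 2

theorem IsSolutionField.tendsto_eLpNorm_integral_dilation [IsProbabilityMeasure P]
    (hU : IsSolutionField P W φ c U) (hW : IsWhiteNoise P W) (hc : 0 ≤ c) (hφ : ∫ x, φ x = 0)
    (t : ℝ) (χ : 𝓢(ℝ, ℝ)) :
    Tendsto (fun R : ℝ => eLpNorm (fun ω => ∫ x, U 0 (t, x) ω * χ (x / R)) 2 P) atTop (𝓝 0) := by
  set χc : 𝓢(ℝ, ℂ) := χ.postcompCLM Complex.ofRealCLM
  set ψ : 𝓢(ℝ, ℂ) := 𝓕⁻ χc with hψ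
  have hψ' : (ψ : ℝ → ℂ) = 𝓕⁻ (fun x => (χ x : ℂ)) := by
    rw [hψ, SchwartzMap.fourierInv_coe]
    rfl
  have key : ∀ R : ℝ, 1 ≤ R → eLpNorm (fun ω => ∫ x, U 0 (t, x) ω * χ (x / R)) 2 P
      = ENNReal.ofReal ((∫ p, ‖solutionAmplitude φ c t (fun ξ => (R : ℂ) * ψ (R * ξ)) p‖ ^ 2
        ∂spaceTime) ^ (2⁻¹ : ℝ)) := by
    intro R hR
    have hR0 : 0 < R := by linarith
    obtain ⟨C, hC0, hC⟩ := exists_schwartz_le χ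
    obtain ⟨-, h1, h2⟩ := hU.integral_mul_eq hW hc t (g := fun x => (χ (x / R) : ℂ))
      (C := C * R ^ 2) (by have := χ.continuous.measurable; fun_prop) (fun x => by
        rw [Complex.norm_real]
        refine (hC _).trans ?_
        rw [mul_assoc]
        gcongr
        rw [← div_eq_mul_inv, le_div_iff₀ (by positivity), inv_mul_le_iff₀ (by positivity)]
        have : (1 + (x / R) ^ 2) * R ^ 2 = R ^ 2 + x ^ 2 := by field_simp
        rw [this]
        nlinarith)
    have e : 𝓕⁻ (fun x => (χ (x / R) : ℂ)) = fun ξ => (R : ℂ) * ψ (R * ξ) := by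
      ext ξ
      rw [hψ', fourierInv_comp_div (fun x => (χ x : ℂ)) hR0]
    rw [e] at h1 h2
    have e2 : eLpNorm (fun ω => ∫ x, U 0 (t, x) ω * χ (x / R)) 2 P
        = eLpNorm (spectralNoise W (solutionAmplitude φ c t fun ξ => (R : ℂ) * ψ (R * ξ))) 2 P := by
      rw [← eLpNorm_congr_ae h2]
      refine eLpNorm_congr_norm_ae (Eventually.of_forall fun ω => ?_)
      simp only [← Complex.ofReal_mul]
      rw [integral_complex_ofReal, Complex.norm_real]
    rw [e2, eLpNorm_two_eq (hW.memLp_spectralNoise h1), hW.integral_norm_spectralNoise_sq h1]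
  have h := (tendsto_integral_norm_dilatedAmplitude_sq hc hφ t ψ).rpow_const (p := 2⁻¹)
    (Or.inr (by norm_num))
  have h' := ENNReal.tendsto_ofReal h
  rw [Real.zero_rpow (by norm_num), ENNReal.ofReal_zero] at h'
  refine h'.congr' ?_
  filter_upwards [eventually_ge_atTop 1] with R hR
  exact (key R hR).symm

end

section

/-! ### The Hilbert transform -/

lemma integral_Ioi_add_integral_Ioi_neg {E : Type*} [NormedAddCommGroup E] [NormedSpace ℝ E]
    {f : ℝ → E} (hf : Integrable f) :
    (∫ y in Ioi (0 : ℝ), f y) + ∫ y in Ioi (0 : ℝ), f (-y) = ∫ y, f y := by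
  rw [integral_comp_neg_Ioi, neg_zero, add_comm]
  exact intervalIntegral.integral_Iic_add_Ioi hf.integrableOn hf.integrableOn

/-- A function with bounded derivative and quadratic decay. -/
structure IsTame (C : ℝ) (f : ℝ → ℝ) : Prop where
  differentiable : Differentiable ℝ f
  deriv_le : ∀ x, |deriv f x| ≤ C
  le : ∀ x, |f x| ≤ C * (1 + x ^ 2)⁻¹

/-- The integral `∫_0^∞ (f(x + y) - f(x - y)) / y dy`. -/
def symmIntegral (f : ℝ → ℝ) (x : ℝ) : ℝ := ∫ y in Ioi (0 : ℝ), (f (x + y) - f (x - y)) / y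

namespace IsTame

variable {C : ℝ} {f : ℝ → ℝ}

lemma nonneg (hf : IsTame C f) : 0 ≤ C := (abs_nonneg _).trans (hf.deriv_le 0)

lemma integrable (hf : IsTame C f) : Integrable f :=
  (integrable_inv_one_add_sq.const_mul C).mono' hf.differentiable.continuous.aestronglyMeasurable
    (Eventually.of_forall hf.le)

/-- A dominating function for the difference quotients. -/
def majorant (C x y : ℝ) : ℝ :=
  (Ioc 0 1).indicator (fun _ => 2 * C) y + C * ((1 + (x + y) ^ 2)⁻¹ + (1 + (x - y) ^ 2)⁻¹)

lemma abs_quotient_le (hf : IsTame C f) (x : ℝ) {y : ℝ} (hy : 0 < y) :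
    |(f (x + y) - f (x - y)) / y| ≤ majorant C x y := by
  have h0 := hf.nonneg
  rw [abs_div, abs_of_pos hy, majorant]
  by_cases h1 : y ≤ 1
  · rw [indicator_of_mem (show y ∈ Ioc (0 : ℝ) 1 from ⟨hy, h1⟩)]
    have h := Convex.norm_image_sub_le_of_norm_deriv_le (𝕜 := ℝ) (f := f) (C := C)
      (s := univ) (x := x - y) (y := x + y) (fun z _ => hf.differentiable z)
      (fun z _ => hf.deriv_le z) convex_univ (mem_univ _) (mem_univ _)
    rw [Real.norm_eq_abs, Real.norm_eq_abs, show x + y - (x - y) = 2 * y by ring,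
      abs_of_pos (by positivity : 0 < 2 * y)] at h
    have h2 : |f (x + y) - f (x - y)| / y ≤ 2 * C := by
      rw [div_le_iff₀ hy]
      linarith
    have : 0 ≤ C * ((1 + (x + y) ^ 2)⁻¹ + (1 + (x - y) ^ 2)⁻¹) := by positivity
    linarith
  · rw [indicator_of_notMem (fun h => h1 h.2), zero_add]
    calc _ ≤ |f (x + y) - f (x - y)| := div_le_self (abs_nonneg _) (by linarith)
      _ ≤ |f (x + y)| + |f (x - y)| := abs_sub _ _
      _ ≤ _ := by
        rw [mul_add]
        exact add_le_add (hf.le _) (hf.le _)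

lemma integrable_majorant (C x : ℝ) : Integrable (majorant C x) := by
  refine Integrable.add ?_ (Integrable.const_mul (Integrable.add ?_ ?_) _)
  · exact (integrable_indicator_iff measurableSet_Ioc).2 (integrableOn_const (by simp))
  · exact integrable_inv_one_add_sq.comp_add_left x
  · exact integrable_inv_one_add_sq.comp_sub_left x

lemma integral_majorant (C x : ℝ) : ∫ y, majorant C x y = 2 * C + 2 * Real.pi * C := by
  unfold majorant
  have i1 : Integrable fun y : ℝ => (1 + (x + y) ^ 2)⁻¹ := integrable_inv_one_add_sq.comp_add_left x
  have i2 : Integrable fun y : ℝ => (1 + (x - y) ^ 2)⁻¹ := integrable_inv_one_add_sq.comp_sub_left x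
  rw [integral_add ((integrable_indicator_iff measurableSet_Ioc).2 (integrableOn_const (by simp)))
    ((integrable_fun_add i1 i2).const_mul _), integral_const_mul, integral_add i1 i2,
    integral_indicator measurableSet_Ioc,
    integral_add_left_eq_self (fun y : ℝ => (1 + y ^ 2)⁻¹) x,
    integral_sub_left_eq_self (fun y : ℝ => (1 + y ^ 2)⁻¹) volume x, integral_univ_inv_one_add_sq]
  simp
  ring

lemma integrableOn_quotient (hf : IsTame C f) (x : ℝ) :
    IntegrableOn (fun y => (f (x + y) - f (x - y)) / y) (Ioi 0) := by
  have hm := hf.differentiable.continuous.measurable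
  refine (integrable_majorant C x).integrableOn.mono'
    (Measurable.aestronglyMeasurable (by fun_prop)) ?_
  filter_upwards [ae_restrict_mem measurableSet_Ioi] with y hy using hf.abs_quotient_le x hy

lemma abs_symmIntegral_le (hf : IsTame C f) (x : ℝ) : |symmIntegral f x| ≤ 10 * C := by
  have h0 := hf.nonneg
  have h1 : |symmIntegral f x| ≤ ∫ y in Ioi (0 : ℝ), majorant C x y := by
    rw [symmIntegral, ← Real.norm_eq_abs]
    refine norm_integral_le_of_norm_le (integrable_majorant C x).integrableOn ?_
    filter_upwards [ae_restrict_mem measurableSet_Ioi] with y hy using hf.abs_quotient_le x hy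
  refine h1.trans ?_
  calc _ ≤ ∫ y, majorant C x y := by
        refine setIntegral_le_integral (integrable_majorant C x) (Eventually.of_forall fun y => ?_)
        exact add_nonneg (indicator_nonneg (fun _ _ => by positivity) _) (by positivity)
    _ = 2 * C + 2 * Real.pi * C := integral_majorant C x
    _ ≤ 10 * C := by nlinarith [Real.pi_le_four]

lemma abs_integral_le (hf : IsTame C f) : |∫ x, f x| ≤ 4 * C := by
  have h0 := hf.nonneg
  calc |∫ x, f x| ≤ ∫ x : ℝ, C * (1 + x ^ 2)⁻¹ := by
        rw [← Real.norm_eq_abs]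
        exact norm_integral_le_of_norm_le (integrable_inv_one_add_sq.const_mul C)
          (Eventually.of_forall hf.le)
    _ = C * Real.pi := by rw [integral_const_mul, integral_univ_inv_one_add_sq]
    _ ≤ 4 * C := by nlinarith [Real.pi_le_four]

/-- Write x = (x ± y) ∓ y: multiplying the difference by x gives the difference for zf(z) minus
y(f(x+y) + f(x-y)), and the factor y cancels the denominator. So the commutator of x with the
Hilbert transform is a multiple of ∫ f. -/
lemma mul_symmIntegral (hf : IsTame C f) (x : ℝ) {C' : ℝ} (hzf : IsTame C' fun z => z * f z) :
    x * symmIntegral f x = symmIntegral (fun z => z * f z) x - ∫ z, f z := by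
  have i1 : Integrable fun y => f (x + y) := hf.integrable.comp_add_left x
  have i2 : Integrable fun y => f (x - y) := hf.integrable.comp_sub_left x
  have e : ∫ z, f z = ∫ y in Ioi (0 : ℝ), (f (x + y) + f (x - y)) := by
    rw [integral_add i1.integrableOn i2.integrableOn, ← integral_add_left_eq_self f x,
      ← integral_Ioi_add_integral_Ioi_neg i1]
    simp only [sub_eq_add_neg]
  rw [e, symmIntegral, symmIntegral, ← integral_const_mul, ← integral_sub
    (hzf.integrableOn_quotient x) (integrable_fun_add i1 i2).integrableOn]
  refine setIntegral_congr_fun measurableSet_Ioi fun y hy => ?_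
  have hy0 : y ≠ 0 := ne_of_gt hy
  field_simp
  ring

/-- Quadratic decay of the Hilbert transform of functions with vanishing integral. -/
lemma abs_symmIntegral_le_inv (hf : IsTame C f) (h1 : IsTame C fun z => z * f z)
    (h2 : IsTame C fun z => z * (z * f z)) (hint : ∫ z, f z = 0) (x : ℝ) :
    |symmIntegral f x| ≤ 24 * C * (1 + x ^ 2)⁻¹ := by
  -- The commutator is used twice; the vanishing integral of f removes the term that would grow like
  -- x. Below, 24 = 10 + 14, where 10 bounds `symmIntegral` itself and 14 = 10 + 4 bounds x² times
  -- it.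
  have e : x ^ 2 * symmIntegral f x
      = symmIntegral (fun z => z * (z * f z)) x - ∫ z, z * f z := by
    rw [sq, mul_assoc, hf.mul_symmIntegral x h1, hint, sub_zero, h1.mul_symmIntegral x h2]
  have h3 := hf.abs_symmIntegral_le x
  have h4 : |x ^ 2 * symmIntegral f x| ≤ 14 * C := by
    rw [e]
    refine (abs_sub _ _).trans ?_
    linarith [h2.abs_symmIntegral_le x, h1.abs_integral_le]
  rw [abs_mul, abs_of_nonneg (sq_nonneg x)] at h4
  rw [← div_eq_mul_inv, le_div_iff₀ (by positivity)]
  linarith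

/-- For a tame function the symmetric quotient is integrable up to y = 0, so the truncated integrals
converge by domination and the principal value is an ordinary integral. -/
lemma hilbert_eq (hf : IsTame C f) (x : ℝ) :
    hilbert f x = -(1 / Real.pi) * symmIntegral f x := by
  refine Tendsto.limUnder_eq (Tendsto.const_mul _ ?_)
  have hi := (integrable_indicator_iff measurableSet_Ioi).2 (hf.integrableOn_quotient x)
  have e : ∀ ε : ℝ, 0 < ε → ∫ y in Ioi ε, (f (x + y) - f (x - y)) / y
      = ∫ y, (Ioi ε).indicator ((Ioi 0).indicator fun y => (f (x + y) - f (x - y)) / y) y := by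
    intro ε hε
    rw [integral_indicator measurableSet_Ioi]
    refine setIntegral_congr_fun measurableSet_Ioi fun y hy => ?_
    rw [indicator_of_mem (show y ∈ Ioi (0 : ℝ) from hε.trans hy)]
  rw [symmIntegral, ← integral_indicator measurableSet_Ioi]
  refine Tendsto.congr' (f₁ := fun ε => ∫ y, (Ioi ε).indicator
    ((Ioi 0).indicator fun y => (f (x + y) - f (x - y)) / y) y) ?_ ?_
  · filter_upwards [self_mem_nhdsWithin] with ε hε using (e ε hε).symm
  · refine tendsto_integral_filter_of_dominated_convergence _
      (Eventually.of_forall fun ε => hi.1.indicator measurableSet_Ioi) ?_ hi.norm ?_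
    · exact Eventually.of_forall fun ε => Eventually.of_forall fun y => norm_indicator_le_norm_self _ _
    · refine Eventually.of_forall fun y => ?_
      by_cases hy : 0 < y
      · refine tendsto_const_nhds.congr' ?_
        filter_upwards [Ioo_mem_nhdsGT hy] with ε hε
        rw [indicator_of_mem (show y ∈ Ioi ε from hε.2)]
      · refine tendsto_const_nhds.congr fun ε => ?_
        rw [indicator_of_notMem (show y ∉ Ioi (0 : ℝ) from hy)]
        by_cases h : y ∈ Ioi ε
        · rw [indicator_of_mem h, indicator_of_notMem (show y ∉ Ioi (0 : ℝ) from hy)]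
        · rw [indicator_of_notMem h]

end IsTame

/-- The Laplace transform of the sine, read off from the imaginary part of a complex exponential
integral. It provides y/(y² + δ²), a regularisation of 1/y that is a superposition of sines. -/
lemma integral_exp_mul_sin {δ : ℝ} (hδ : 0 < δ) (y : ℝ) :
    ∫ k in Ioi (0 : ℝ), Real.exp (-(2 * Real.pi * δ * k)) * Real.sin (2 * Real.pi * k * y)
      = (2 * Real.pi)⁻¹ * (y / (y ^ 2 + δ ^ 2)) := by
  have hpi := Real.two_pi_pos
  set a : ℂ := ⟨-(2 * Real.pi * δ), 2 * Real.pi * y⟩ with ha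
  have hre : a.re < 0 := by simp only [ha]; have := mul_pos hpi hδ; linarith
  have h := integral_exp_mul_complex_Ioi hre 0
  have h2 := congrArg Complex.im h
  have hi := integrableOn_exp_mul_complex_Ioi hre 0
  have e1 : (∫ k in Ioi (0 : ℝ), Complex.exp (a * k)).im
      = ∫ k in Ioi (0 : ℝ), (Complex.exp (a * k)).im := (integral_im hi).symm
  rw [e1] at h2
  have e2 : ∀ k : ℝ, (Complex.exp (a * k)).im
      = Real.exp (-(2 * Real.pi * δ * k)) * Real.sin (2 * Real.pi * k * y) := by
    intro k
    rw [Complex.exp_im]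
    simp only [ha, Complex.mul_re, Complex.mul_im, Complex.ofReal_re, Complex.ofReal_im]
    congr 2 <;> ring
  simp only [e2] at h2
  rw [h2]
  simp only [Complex.ofReal_zero, mul_zero, Complex.exp_zero, neg_div, Complex.neg_im, one_div,
    Complex.inv_im, Complex.normSq_apply, ha]
  have : 0 < y ^ 2 + δ ^ 2 := by positivity
  field_simp
  ring

/-- The regularised form of the identity between the Hilbert transform and its multiplier. -/
lemma integral_mul_regularised {F : ℝ → ℝ} (hF : IntegrableOn F (Ioi 0)) {δ : ℝ} (hδ : 0 < δ) :
    ∫ y in Ioi (0 : ℝ), F y * (y / (y ^ 2 + δ ^ 2))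
      = 2 * Real.pi * ∫ k in Ioi (0 : ℝ), Real.exp (-(2 * Real.pi * δ * k))
        * ∫ y in Ioi (0 : ℝ), F y * Real.sin (2 * Real.pi * k * y) := by
  have hpi := Real.two_pi_pos
  have hexp : IntegrableOn (fun k => Real.exp (-(2 * Real.pi * δ * k))) (Ioi 0) := by
    have := exp_neg_integrableOn_Ioi 0 (mul_pos hpi hδ)
    simpa [neg_mul] using this
  have hprod : Integrable (Function.uncurry fun y k => F y * (Real.exp (-(2 * Real.pi * δ * k))
      * Real.sin (2 * Real.pi * k * y)))
      ((volume.restrict (Ioi 0)).prod (volume.restrict (Ioi 0))) := by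
    refine (hF.norm.mul_prod hexp).mono' ?_ (Eventually.of_forall fun q => ?_)
    · exact hF.1.comp_fst.mul (by fun_prop)
    · rw [Function.uncurry, norm_mul, norm_mul, Real.norm_of_nonneg (Real.exp_pos _).le]
      gcongr
      refine mul_le_of_le_one_right (Real.exp_pos _).le ?_
      rw [Real.norm_eq_abs]
      exact Real.abs_sin_le_one _
  have h := integral_integral_swap hprod
  calc _ = 2 * Real.pi * ∫ y in Ioi (0 : ℝ), ∫ k in Ioi (0 : ℝ),
        F y * (Real.exp (-(2 * Real.pi * δ * k)) * Real.sin (2 * Real.pi * k * y)) := by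
        rw [← integral_const_mul]
        congr 1
        ext y
        rw [integral_const_mul, integral_exp_mul_sin hδ]
        field_simp
    _ = _ := by
        rw [h]
        congr 2
        ext k
        rw [← integral_const_mul]
        congr 1
        ext y
        ring

/-- Formally 1/y = 2π ∫_0^∞ sin(2πky) dk, which does not converge absolutely. The exchange of
integrals is carried out with the damping e^{-2πδk} and then δ → 0 by domination on both sides. -/
lemma integral_quotient_eq {F : ℝ → ℝ} (hF : IntegrableOn F (Ioi 0))
    (hF' : IntegrableOn (fun y => F y / y) (Ioi 0))
    (hS : IntegrableOn (fun k => ∫ y in Ioi (0 : ℝ), F y * Real.sin (2 * Real.pi * k * y)) (Ioi 0)) :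
    ∫ y in Ioi (0 : ℝ), F y / y
      = 2 * Real.pi * ∫ k in Ioi (0 : ℝ), ∫ y in Ioi (0 : ℝ), F y * Real.sin (2 * Real.pi * k * y) := by
  have hpi := Real.two_pi_pos
  have l1 : Tendsto (fun δ : ℝ => ∫ y in Ioi (0 : ℝ), F y * (y / (y ^ 2 + δ ^ 2))) (𝓝[>] 0)
      (𝓝 (∫ y in Ioi (0 : ℝ), F y / y)) := by
    refine tendsto_integral_filter_of_dominated_convergence _ (Eventually.of_forall fun δ => ?_) ?_
      hF'.norm ?_
    · exact hF.1.mul (Measurable.aestronglyMeasurable (by fun_prop))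
    · refine Eventually.of_forall fun δ => ?_
      filter_upwards [ae_restrict_mem measurableSet_Ioi] with y hy
      have hy : 0 < y := hy
      rw [norm_mul, div_eq_mul_inv (F y), norm_mul]
      gcongr
      rw [Real.norm_of_nonneg (by positivity), Real.norm_of_nonneg (by positivity),
        div_le_iff₀ (by positivity)]
      field_simp
      nlinarith [sq_nonneg δ]
    · filter_upwards [ae_restrict_mem measurableSet_Ioi] with y hy
      have hy : 0 < y := hy
      have h : Tendsto (fun δ : ℝ => F y * (y / (y ^ 2 + δ ^ 2))) (𝓝 0)
          (𝓝 (F y * (y / (y ^ 2 + 0 ^ 2)))) := by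
        refine Tendsto.const_mul _ (Tendsto.div tendsto_const_nhds ?_ (by positivity))
        exact (Continuous.tendsto (by fun_prop) 0)
      have e : F y * (y / (y ^ 2 + 0 ^ 2)) = F y / y := by field_simp; ring
      rw [e] at h
      exact h.mono_left nhdsWithin_le_nhds
  have l2 : Tendsto (fun δ : ℝ => 2 * Real.pi * ∫ k in Ioi (0 : ℝ),
      Real.exp (-(2 * Real.pi * δ * k)) * ∫ y in Ioi (0 : ℝ), F y * Real.sin (2 * Real.pi * k * y))
      (𝓝[>] 0) (𝓝 (2 * Real.pi * ∫ k in Ioi (0 : ℝ), ∫ y in Ioi (0 : ℝ),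
        F y * Real.sin (2 * Real.pi * k * y))) := by
    refine Tendsto.const_mul _ ?_
    refine tendsto_integral_filter_of_dominated_convergence _ (Eventually.of_forall fun δ => ?_) ?_
      hS.norm ?_
    · exact (Continuous.aestronglyMeasurable (by fun_prop)).mul hS.1
    · filter_upwards [self_mem_nhdsWithin] with δ hδ
      have hδ : 0 < δ := hδ
      filter_upwards [ae_restrict_mem measurableSet_Ioi] with k hk
      have hk : 0 < k := hk
      rw [norm_mul, Real.norm_of_nonneg (Real.exp_pos _).le]
      refine mul_le_of_le_one_left (norm_nonneg _) (Real.exp_le_one_iff.2 ?_)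
      have : 0 < 2 * Real.pi * δ * k := by positivity
      linarith
    · refine Eventually.of_forall fun k => ?_
      have h : Tendsto (fun δ : ℝ => Real.exp (-(2 * Real.pi * δ * k))
          * ∫ y in Ioi (0 : ℝ), F y * Real.sin (2 * Real.pi * k * y)) (𝓝 0)
          (𝓝 (Real.exp (-(2 * Real.pi * 0 * k))
            * ∫ y in Ioi (0 : ℝ), F y * Real.sin (2 * Real.pi * k * y))) :=
        (Continuous.tendsto (by fun_prop) 0)
      have e : Real.exp (-(2 * Real.pi * 0 * k)) = 1 := by simp
      rw [e, one_mul] at h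
      exact h.mono_left nhdsWithin_le_nhds
  refine tendsto_nhds_unique l1 (l2.congr' ?_)
  filter_upwards [self_mem_nhdsWithin] with δ hδ
  exact (integral_mul_regularised hF hδ).symm

end

section

/-! ### The Fourier multiplier of the Hilbert transform -/

/-- The complex-valued Schwartz function given by a real-valued one. -/
def toComplex (h : 𝓢(ℝ, ℝ)) : 𝓢(ℝ, ℂ) := h.postcompCLM Complex.ofRealCLM

lemma toComplex_apply (h : 𝓢(ℝ, ℝ)) (x : ℝ) : toComplex h x = (h x : ℂ) := rfl

/-- The product of a Schwartz function with the variable. -/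
def mulVar (h : 𝓢(ℝ, ℝ)) : 𝓢(ℝ, ℝ) := SchwartzMap.smulLeftCLM ℝ (fun x : ℝ => x) h

lemma mulVar_apply (h : 𝓢(ℝ, ℝ)) (x : ℝ) : mulVar h x = x * h x := by
  rw [mulVar, SchwartzMap.smulLeftCLM_apply_apply (by fun_prop), smul_eq_mul]

lemma coe_mulVar (h : 𝓢(ℝ, ℝ)) : (mulVar h : ℝ → ℝ) = fun x => x * h x :=
  funext (mulVar_apply h)

lemma IsTame.mono {C C' : ℝ} {f : ℝ → ℝ} (hf : IsTame C f) (h : C ≤ C') : IsTame C' f :=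
  ⟨hf.differentiable, fun x => (hf.deriv_le x).trans h, fun x => (hf.le x).trans (by gcongr)⟩

lemma exists_isTame (f : 𝓢(ℝ, ℝ)) : ∃ C, IsTame C f := by
  obtain ⟨C, -, hC⟩ := exists_schwartz_le f
  obtain ⟨L, hL0, hL⟩ := exists_schwartz_le (SchwartzMap.derivCLM ℝ ℝ f)
  refine ⟨max C L, f.differentiable, fun x => ?_, fun x => ?_⟩
  · have := hL x
    rw [SchwartzMap.derivCLM_apply] at this
    refine (this.trans (mul_le_of_le_one_right hL0.le (inv_le_one_of_one_le₀ ?_))).trans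
      (le_max_right _ _)
    nlinarith [sq_nonneg x]
  · refine (hC x).trans ?_
    gcongr
    exact le_max_left _ _

lemma exists_abs_symmIntegral_le (h : 𝓢(ℝ, ℝ)) (hint : ∫ x, h x = 0) :
    ∃ C : ℝ, ∀ x, |symmIntegral h x| ≤ C * (1 + x ^ 2)⁻¹ := by
  obtain ⟨C0, h0⟩ := exists_isTame h
  obtain ⟨C1, h1⟩ := exists_isTame (mulVar h)
  obtain ⟨C2, h2⟩ := exists_isTame (mulVar (mulVar h))
  simp only [coe_mulVar] at h1 h2
  set C := max C0 (max C1 C2)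
  exact ⟨24 * C, (h0.mono (le_max_left _ _)).abs_symmIntegral_le_inv
    (h1.mono ((le_max_left _ _).trans (le_max_right _ _)))
    (h2.mono ((le_max_right _ _).trans (le_max_right _ _))) hint⟩

lemma measurable_symmIntegral {X : Type*} [MeasurableSpace X] {f : X → ℝ → ℝ}
    (hf : Measurable fun q : X × ℝ => f q.1 q.2) :
    Measurable fun q : X × ℝ => symmIntegral (f q.1) q.2 := by
  refine (StronglyMeasurable.integral_prod_right (ν := volume.restrict (Ioi (0 : ℝ)))
    (f := fun (q : X × ℝ) y => (f q.1 (q.2 + y) - f q.1 (q.2 - y)) / y) ?_).measurable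
  refine Measurable.stronglyMeasurable (Measurable.div (Measurable.sub ?_ ?_) measurable_snd)
  · exact hf.comp (by fun_prop : Measurable fun z : (X × ℝ) × ℝ => (z.1.1, z.1.2 + z.2))
  · exact hf.comp (by fun_prop : Measurable fun z : (X × ℝ) × ℝ => (z.1.1, z.1.2 - z.2))

/-! ### Frequency representation of the Hilbert transform of a Schwartz function -/

section

variable (h : 𝓢(ℝ, ℝ)) (x : ℝ)

/-- The integrand of the Fourier representation of `h` at the point `x`. -/
def spectralIntegrand (k : ℝ) : ℂ :=
  Complex.exp (((-2 * Real.pi * k * x : ℝ) : ℂ) * Complex.I) * 𝓕⁻ (fun v => (h v : ℂ)) k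

lemma coe_fourierInv_toComplex : ((𝓕⁻ (toComplex h) : 𝓢(ℝ, ℂ)) : ℝ → ℂ) = 𝓕⁻ (fun v => (h v : ℂ)) := by
  rw [SchwartzMap.fourierInv_coe]
  rfl

lemma integrable_spectralIntegrand : Integrable (spectralIntegrand h x) := by
  unfold spectralIntegrand
  rw [← coe_fourierInv_toComplex]
  have hc := (𝓕⁻ (toComplex h) : 𝓢(ℝ, ℂ)).continuous
  refine (𝓕⁻ (toComplex h) : 𝓢(ℝ, ℂ)).integrable.norm.mono'
    (Continuous.aestronglyMeasurable (by fun_prop)) (Eventually.of_forall fun k => ?_)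
  rw [norm_mul, Complex.norm_exp_ofReal_mul_I, one_mul]

lemma spectralIntegrand_eq (k : ℝ) : spectralIntegrand h x k
    = ∫ y, Complex.exp (((2 * Real.pi * k * y : ℝ) : ℂ) * Complex.I) * (h (x + y) : ℂ) := by
  rw [spectralIntegrand, fourierInv_eq_integral,
    ← integral_add_left_eq_self (fun v =>
      Complex.exp (((2 * Real.pi * v * k : ℝ) : ℂ) * Complex.I) * (h v : ℂ)) x, ← integral_const_mul]
  congr 1
  ext y
  rw [← mul_assoc, ← Complex.exp_add]
  congr 2
  push_cast
  ring

/-- Since the sine is odd, the half-line integral of h(x+y) - h(x-y) unfolds to the full-line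
integral of h(x+y) against the sine, which is a difference of two exponential integrals. -/
lemma integral_mul_sin_eq (k : ℝ) :
    ((∫ y in Ioi (0 : ℝ), (h (x + y) - h (x - y)) * Real.sin (2 * Real.pi * k * y) : ℝ) : ℂ)
      = (spectralIntegrand h x k - spectralIntegrand h x (-k)) / (2 * Complex.I) := by
  have hx : Integrable fun y => h (x + y) := h.integrable.comp_add_left x
  have hc := h.continuous
  have hi : Integrable fun y => h (x + y) * Real.sin (2 * Real.pi * k * y) := by
    refine hx.norm.mono' (Continuous.aestronglyMeasurable (by fun_prop))
      (Eventually.of_forall fun y => ?_)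
    rw [norm_mul]
    refine mul_le_of_le_one_right (norm_nonneg _) ?_
    rw [Real.norm_eq_abs]
    exact Real.abs_sin_le_one _
  have hie : ∀ k : ℝ, Integrable fun y =>
      Complex.exp (((2 * Real.pi * k * y : ℝ) : ℂ) * Complex.I) * (h (x + y) : ℂ) := by
    intro k
    refine hx.norm.mono' (Continuous.aestronglyMeasurable (by fun_prop))
      (Eventually.of_forall fun y => ?_)
    rw [norm_mul, Complex.norm_exp_ofReal_mul_I, one_mul, Complex.norm_real]
  have e1 : ∫ y in Ioi (0 : ℝ), (h (x + y) - h (x - y)) * Real.sin (2 * Real.pi * k * y)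
      = ∫ y, h (x + y) * Real.sin (2 * Real.pi * k * y) := by
    rw [← integral_Ioi_add_integral_Ioi_neg hi, ← integral_add hi.integrableOn hi.comp_neg.integrableOn]
    congr 1
    ext y
    rw [mul_neg, Real.sin_neg, ← sub_eq_add_neg x y]
    ring
  rw [e1, ← integral_complex_ofReal, spectralIntegrand_eq, spectralIntegrand_eq,
    ← integral_sub (hie k) (hie (-k)), ← integral_div]
  congr 1
  ext y
  rw [← sub_mul, Complex.ofReal_mul, Complex.ofReal_sin, Complex.sin]
  have e2 : ((2 * Real.pi * -k * y : ℝ) : ℂ) * Complex.I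
    = -((2 * Real.pi * k * y : ℝ) : ℂ) * Complex.I := by push_cast; ring
  rw [e2]
  have hI := Complex.I_ne_zero
  field_simp
  rw [Complex.I_sq]
  ring

lemma integrable_integral_mul_sin :
    Integrable fun k => ∫ y in Ioi (0 : ℝ), (h (x + y) - h (x - y)) * Real.sin (2 * Real.pi * k * y) := by
  have hi : Integrable fun k =>
      (spectralIntegrand h x k - spectralIntegrand h x (-k)) / (2 * Complex.I) :=
    ((integrable_spectralIntegrand h x).sub (integrable_spectralIntegrand h x).comp_neg).div_const _
  simp only [← integral_mul_sin_eq] at hi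
  exact hi.re

/-- The Fourier multiplier of the Hilbert transform, applied to `h`. -/
def hilbertSymbol (k : ℝ) : ℂ := Complex.I * ((Real.sign k : ℂ) * 𝓕⁻ (fun v => (h v : ℂ)) k)

/-- Folding the frequency integral onto k > 0, the sign function selects the odd part, which is the
sine transform of h(x+y) - h(x-y); `integral_quotient_eq` turns its integral into the principal
value. The symbol carries +i because it multiplies 𝓕⁻h, where frequencies are reversed. -/
lemma ofReal_hilbert_eq : (hilbert h x : ℂ) = 𝓕 (hilbertSymbol h) x := by
  obtain ⟨C, hC⟩ := exists_isTame h
  have hF : IntegrableOn (fun y => h (x + y) - h (x - y)) (Ioi 0) :=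
    ((h.integrable.comp_add_left x).sub (h.integrable.comp_sub_left x)).integrableOn
  have hq := integral_quotient_eq hF (hC.integrableOn_quotient x)
    (integrable_integral_mul_sin h x).integrableOn
  set S : ℝ → ℝ := fun k =>
    ∫ y in Ioi (0 : ℝ), (h (x + y) - h (x - y)) * Real.sin (2 * Real.pi * k * y) with hS
  have hI := Complex.I_ne_zero
  have hs : Integrable fun k => (Real.sign k : ℂ) * spectralIntegrand h x k := by
    refine (integrable_spectralIntegrand h x).norm.mono' ?_ (Eventually.of_forall fun k => ?_)
    · exact (Complex.measurable_ofReal.comp measurable_sign).aestronglyMeasurable.mul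
        (integrable_spectralIntegrand h x).1
    · rw [norm_mul, Complex.norm_real]
      exact mul_le_of_le_one_left (norm_nonneg _) (abs_sign_le k)
  have e1 : 𝓕 (hilbertSymbol h) x = Complex.I * ∫ k, (Real.sign k : ℂ) * spectralIntegrand h x k := by
    rw [fourier_eq_integral, ← integral_const_mul]
    congr 1
    ext k
    rw [hilbertSymbol, spectralIntegrand]
    ring
  have e2 : ∫ k, (Real.sign k : ℂ) * spectralIntegrand h x k
      = 2 * Complex.I * ((∫ k in Ioi (0 : ℝ), S k : ℝ) : ℂ) := by
    rw [← integral_Ioi_add_integral_Ioi_neg hs, ← integral_add hs.integrableOn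
      hs.comp_neg.integrableOn, ← integral_complex_ofReal, ← integral_const_mul]
    refine setIntegral_congr_fun measurableSet_Ioi fun k hk => ?_
    have hk : 0 < k := hk
    rw [hS, integral_mul_sin_eq, Real.sign_of_pos hk, Real.sign_of_neg (neg_lt_zero.2 hk)]
    field_simp
    push_cast
    ring
  have hpi : (Real.pi : ℂ) ≠ 0 := Complex.ofReal_ne_zero.2 Real.pi_ne_zero
  rw [hC.hilbert_eq, symmIntegral, hq, e1, e2]
  push_cast
  field_simp
  rw [Complex.I_sq]
  ring

variable {h}

/-- The jump of the sign at 0 is cancelled by 𝓕⁻h(0) = ∫ h = 0. Continuity is what allows Fourier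
inversion to hold at every point. -/
lemma continuous_hilbertSymbol (hint : ∫ x, h x = 0) : Continuous (hilbertSymbol h) := by
  have hc : Continuous (𝓕⁻ (fun v => (h v : ℂ))) := by
    rw [← coe_fourierInv_toComplex]
    exact (𝓕⁻ (toComplex h) : 𝓢(ℝ, ℂ)).continuous
  have h0 : 𝓕⁻ (fun v => (h v : ℂ)) 0 = 0 := by
    rw [fourierInv_eq_integral]
    simp [integral_complex_ofReal, hint]
  refine continuous_const.mul (continuous_iff_continuousAt.2 fun k => ?_)
  rcases eq_or_ne k 0 with rfl | hk
  · have ht : Tendsto (fun k => ‖𝓕⁻ (fun v => (h v : ℂ)) k‖) (𝓝 0) (𝓝 0) := by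
      have := hc.norm.tendsto 0
      rwa [h0, norm_zero] at this
    rw [ContinuousAt, h0, mul_zero]
    refine squeeze_zero_norm (fun k => ?_) ht
    rw [norm_mul, Complex.norm_real]
    exact mul_le_of_le_one_left (norm_nonneg _) (abs_sign_le k)
  · refine ContinuousAt.mul (Complex.continuous_ofReal.continuousAt.comp ?_) hc.continuousAt
    rcases lt_or_gt_of_ne hk with h1 | h1
    · refine (continuousAt_const (y := (-1 : ℝ))).congr ?_
      filter_upwards [Iio_mem_nhds h1] with z hz using (Real.sign_of_neg hz).symm
    · refine (continuousAt_const (y := (1 : ℝ))).congr ?_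
      filter_upwards [Ioi_mem_nhds h1] with z hz using (Real.sign_of_pos hz).symm

/-- The Hilbert transform is the Fourier multiplier with symbol `-i sgn`. -/
theorem fourierInv_hilbert (hint : ∫ x, h x = 0) :
    𝓕⁻ (fun x => (hilbert h x : ℂ)) = hilbertSymbol h := by
  obtain ⟨C, hC⟩ := exists_isTame h
  obtain ⟨K, hK⟩ := exists_abs_symmIntegral_le h hint
  have e : (fun x => (hilbert h x : ℂ)) = 𝓕 (hilbertSymbol h) := funext (ofReal_hilbert_eq h)
  have hm : Measurable fun x => symmIntegral h x :=
    (measurable_symmIntegral (X := Unit) (f := fun _ => h)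
      (h.continuous.measurable.comp measurable_snd)).comp (measurable_const (a := ()).prodMk measurable_id)
  have hi : Integrable fun x => (hilbert h x : ℂ) := by
    have hs : Integrable fun x => symmIntegral h x :=
      (integrable_inv_one_add_sq.const_mul K).mono' hm.aestronglyMeasurable
        (Eventually.of_forall hK)
    simp only [hC.hilbert_eq]
    exact (hs.const_mul _).ofReal
  have hsym : Integrable (hilbertSymbol h) := by
    refine (𝓕⁻ (toComplex h) : 𝓢(ℝ, ℂ)).integrable.norm.mono'
      (continuous_hilbertSymbol hint).aestronglyMeasurable (Eventually.of_forall fun k => ?_)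
    rw [coe_fourierInv_toComplex, hilbertSymbol, norm_mul, norm_mul, Complex.norm_I, one_mul,
      Complex.norm_real]
    exact mul_le_of_le_one_left (norm_nonneg _) (abs_sign_le k)
  rw [e]
  rw [e] at hi
  exact (continuous_hilbertSymbol hint).fourierInv_fourier_eq hsym hi

end

end

section

/-! ### Test functions -/

lemma sign_freq {c τ : ℝ} (hcτ : 0 ≤ c * τ) (k : ℝ) : Real.sign (freq c τ k) = Real.sign k := by
  rcases lt_trichotomy k 0 with h | rfl | h
  · rw [freq, Real.sign_of_neg h, Real.sign_of_neg (by linarith)]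
  · simp [freq]
  · rw [freq, Real.sign_of_pos h, Real.sign_of_pos (by linarith)]

namespace IsTestFunction

variable {g : ℝ → ℝ → ℝ}

/-- The time derivative of a function of `(t, x)`. -/
def dt (g : ℝ → ℝ → ℝ) (s x : ℝ) : ℝ := fderiv ℝ (fun p : ℝ × ℝ => g p.1 p.2) (s, x) (1, 0)

/-- The space derivative of a function of `(t, x)`. -/
def dx (g : ℝ → ℝ → ℝ) (s x : ℝ) : ℝ := fderiv ℝ (fun p : ℝ × ℝ => g p.1 p.2) (s, x) (0, 1)

lemma hasFDerivAt (hg : IsTestFunction g) (p : ℝ × ℝ) :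
    HasFDerivAt (fun p : ℝ × ℝ => g p.1 p.2) (fderiv ℝ (fun p : ℝ × ℝ => g p.1 p.2) p) p :=
  (hg.smooth.differentiable (by simp)).differentiableAt.hasFDerivAt

lemma hasDerivAt_dt (hg : IsTestFunction g) (s x : ℝ) :
    HasDerivAt (fun r => g r x) (dt g s x) s :=
  (hg.hasFDerivAt (s, x)).comp_hasDerivAt (f := fun r : ℝ => (r, x)) s
    ((hasDerivAt_id s).prodMk (hasDerivAt_const s x))

lemma hasDerivAt_dx (hg : IsTestFunction g) (s x : ℝ) :
    HasDerivAt (g s) (dx g s x) x :=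
  (hg.hasFDerivAt (s, x)).comp_hasDerivAt (f := fun z : ℝ => (s, z)) x
    ((hasDerivAt_const x s).prodMk (hasDerivAt_id x))

lemma continuous (hg : IsTestFunction g) : Continuous fun p : ℝ × ℝ => g p.1 p.2 :=
  hg.smooth.continuous

lemma continuous_dt (hg : IsTestFunction g) : Continuous fun p : ℝ × ℝ => dt g p.1 p.2 :=
  (hg.smooth.continuous_fderiv (by simp)).clm_apply continuous_const

lemma abs_dt_le (s x : ℝ) :
    |dt g s x| ≤ ‖iteratedFDeriv ℝ 1 (fun p : ℝ × ℝ => g p.1 p.2) (s, x)‖ := by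
  rw [norm_iteratedFDeriv_one, ← Real.norm_eq_abs]
  refine (ContinuousLinearMap.le_opNorm _ _).trans (le_of_eq ?_)
  simp [Prod.norm_def]

lemma abs_dx_le (s x : ℝ) :
    |dx g s x| ≤ ‖iteratedFDeriv ℝ 1 (fun p : ℝ × ℝ => g p.1 p.2) (s, x)‖ := by
  rw [norm_iteratedFDeriv_one, ← Real.norm_eq_abs]
  refine (ContinuousLinearMap.le_opNorm _ _).trans (le_of_eq ?_)
  simp [Prod.norm_def]

lemma exists_iteratedFDeriv_le (hg : IsTestFunction g) (j n : ℕ) (T : ℝ) :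
    ∃ C : ℝ, 0 ≤ C ∧ ∀ s ∈ Icc 0 T, ∀ x : ℝ,
      |x| ^ j * ‖iteratedFDeriv ℝ n (fun p : ℝ × ℝ => g p.1 p.2) (s, x)‖ ≤ C * (1 + x ^ 2)⁻¹ := by
  obtain ⟨B1, h1⟩ := hg.decay j n T
  obtain ⟨B2, h2⟩ := hg.decay (j + 2) n T
  refine ⟨|B1| + |B2|, by positivity, fun s hs x => ?_⟩
  rw [← div_eq_mul_inv, le_div_iff₀ (by positivity)]
  have h1 := (h1 s hs x).trans (le_abs_self B1)
  have h2 := (h2 s hs x).trans (le_abs_self B2)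
  rw [pow_add, sq_abs] at h2
  linarith

lemma exists_le (hg : IsTestFunction g) (j : ℕ) (T : ℝ) :
    ∃ C : ℝ, 0 ≤ C ∧ ∀ s ∈ Icc 0 T, ∀ x : ℝ,
      |x| ^ j * |g s x| ≤ C * (1 + x ^ 2)⁻¹ ∧ |x| ^ j * |dx g s x| ≤ C * (1 + x ^ 2)⁻¹
        ∧ |x| ^ j * |dt g s x| ≤ C * (1 + x ^ 2)⁻¹ := by
  obtain ⟨C0, h00, h0⟩ := hg.exists_iteratedFDeriv_le j 0 T
  obtain ⟨C1, h10, h1⟩ := hg.exists_iteratedFDeriv_le j 1 T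
  refine ⟨C0 + C1, by positivity, fun s hs x => ?_⟩
  have h0 := h0 s hs x
  rw [norm_iteratedFDeriv_zero, Real.norm_eq_abs] at h0
  have hx := inv_one_add_sq_pos x
  have e1 : C1 * (1 + x ^ 2)⁻¹ ≤ (C0 + C1) * (1 + x ^ 2)⁻¹ := by gcongr; linarith
  refine ⟨h0.trans (by gcongr; linarith), le_trans ?_ ((h1 s hs x).trans e1),
    le_trans ?_ ((h1 s hs x).trans e1)⟩
  · gcongr
    exact abs_dx_le s x
  · gcongr
    exact abs_dt_le s x

/-- A time slice of a test function. -/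
def slice (hg : IsTestFunction g) {s : ℝ} (hs : 0 ≤ s) : 𝓢(ℝ, ℝ) where
  toFun := g s
  smooth' := hg.smooth.comp (contDiff_prodMk_right s)
  decay' k n := by
    obtain ⟨B, hB⟩ := hg.decay k n s
    refine ⟨B, fun x => ?_⟩
    set L : ℝ →L[ℝ] ℝ × ℝ := ContinuousLinearMap.inr ℝ ℝ ℝ
    set G : ℝ × ℝ → ℝ := fun p => g p.1 p.2
    have hcd : ContDiff ℝ (⊤ : ℕ∞) fun p => G ((s, 0) + p) :=
      hg.smooth.comp (contDiff_const.add contDiff_id)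
    have e : g s = (fun p => G ((s, 0) + p)) ∘ L := by
      ext z
      simp [G, L]
    have hL : ‖L‖ ≤ 1 := ContinuousLinearMap.norm_inr_le_one ℝ ℝ ℝ
    have h1 : ‖iteratedFDeriv ℝ n (g s) x‖ ≤ ‖iteratedFDeriv ℝ n G (s, x)‖ := by
      rw [e, L.iteratedFDeriv_comp_right hcd x (i := n) (by exact_mod_cast le_top),
        iteratedFDeriv_comp_add_left]
      refine (ContinuousMultilinearMap.norm_compContinuousLinearMap_le _ _).trans ?_
      have hp : ∏ _i : Fin n, ‖L‖ ≤ 1 := Finset.prod_le_one (fun _ _ => norm_nonneg _) fun _ _ => hL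
      have e2 : ((s, 0) : ℝ × ℝ) + L x = (s, x) := by simp [L]
      rw [e2]
      exact mul_le_of_le_one_right (norm_nonneg _) hp
    rw [Real.norm_eq_abs]
    exact (mul_le_mul_of_nonneg_left h1 (by positivity)).trans (hB s ⟨hs, le_rfl⟩ x)

lemma slice_apply (hg : IsTestFunction g) {s : ℝ} (hs : 0 ≤ s) (x : ℝ) : hg.slice hs x = g s x := rfl

lemma exists_isTame (hg : IsTestFunction g) (j : ℕ) (T : ℝ) :
    ∃ C, ∀ s ∈ Icc 0 T, IsTame C fun z => z ^ j * g s z := by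
  obtain ⟨C0, h00, h0⟩ := hg.exists_le j T
  obtain ⟨C1, h10, h1⟩ := hg.exists_le (j - 1) T
  refine ⟨j * C1 + C0, fun s hs => ?_⟩
  have hd : ∀ x, HasDerivAt (fun z => z ^ j * g s z) (j * x ^ (j - 1) * g s x + x ^ j * dx g s x) x :=
    fun x => (hasDerivAt_pow j x).mul (hg.hasDerivAt_dx s x)
  have hle : ∀ x : ℝ, (1 + x ^ 2)⁻¹ ≤ 1 := fun x =>
    inv_le_one_of_one_le₀ (by nlinarith [sq_nonneg x])
  refine ⟨fun x => (hd x).differentiableAt, fun x => ?_, fun x => ?_⟩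
  · rw [(hd x).deriv]
    refine (abs_add_le _ _).trans ?_
    rw [abs_mul, abs_mul, abs_mul, abs_pow, abs_pow, Nat.abs_cast, mul_assoc]
    have i1 := (h1 s hs x).1.trans (mul_le_of_le_one_right h10 (hle x))
    have i2 := (h0 s hs x).2.1.trans (mul_le_of_le_one_right h00 (hle x))
    gcongr
  · rw [abs_mul, abs_pow]
    refine (h0 s hs x).1.trans ?_
    have := inv_one_add_sq_pos x
    gcongr
    have : 0 ≤ j * C1 := by positivity
    linarith

/-- The quadratic decay estimate applied to z g(s, z), whose integral is the vanishing moment of the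
test function. It needs tame bounds for zʲ g with j = 1, 2, 3, uniform in s. -/
lemma exists_symmIntegral_le (hg : IsTestFunction g) (T : ℝ) :
    ∃ C : ℝ, 0 ≤ C ∧ ∀ s ∈ Icc 0 T, (∀ x, |symmIntegral (fun z => z * g s z) x| ≤ C * (1 + x ^ 2)⁻¹) ∧
      IsTame C (fun z => z * g s z) := by
  obtain ⟨C1, h1⟩ := hg.exists_isTame 1 T
  obtain ⟨C2, h2⟩ := hg.exists_isTame 2 T
  obtain ⟨C3, h3⟩ := hg.exists_isTame 3 T
  set C := |C1| + |C2| + |C3| with hC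
  have hC1 : C1 ≤ C := by linarith [le_abs_self C1, abs_nonneg C2, abs_nonneg C3]
  have hC2 : C2 ≤ C := by linarith [le_abs_self C2, abs_nonneg C1, abs_nonneg C3]
  have hC3 : C3 ≤ C := by linarith [le_abs_self C3, abs_nonneg C1, abs_nonneg C2]
  have hC0 : 0 ≤ C := by positivity
  refine ⟨24 * C, by positivity, fun s hs => ?_⟩
  have e1 : (fun z => z ^ 1 * g s z) = fun z => z * g s z := by simp
  have e2 : (fun z => z ^ 2 * g s z) = fun z => z * (z * g s z) := by ext; ring
  have e3 : (fun z => z ^ 3 * g s z) = fun z => z * (z * (z * g s z)) := by ext; ring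
  have h1 := (h1 s hs).mono hC1
  have h2 := (h2 s hs).mono hC2
  have h3 := (h3 s hs).mono hC3
  rw [e1] at h1
  rw [e2] at h2
  rw [e3] at h3
  exact ⟨h1.abs_symmIntegral_le_inv h2 h3 (hg.moment_zero s hs.1), h1.mono (by linarith)⟩

/-- A measurable form of `(-∂_s + A*) g` on the time interval `(0, t]`. -/
def backwardKernel (c : ℝ) (g : ℝ → ℝ → ℝ) (t : ℝ) (q : ℝ × ℝ) : ℝ :=
  if 0 < q.1 ∧ q.1 ≤ t then -dt g q.1 q.2 + 2 * c * symmIntegral (fun z => z * g q.1 z) q.2 else 0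

lemma measurable_backwardKernel (hg : IsTestFunction g) (c t : ℝ) :
    Measurable (backwardKernel c g t) := by
  refine Measurable.ite (measurableSet_window t) ?_ measurable_const
  refine hg.continuous_dt.measurable.neg.add (Measurable.const_mul ?_ _)
  exact measurable_symmIntegral (f := fun s z => z * g s z)
    (measurable_snd.mul hg.continuous.measurable)

lemma exists_backwardKernel_le (hg : IsTestFunction g) (c t : ℝ) :
    ∃ C : ℝ, 0 < C ∧ ∀ q, |backwardKernel c g t q| ≤ C * (1 + q.2 ^ 2)⁻¹ := by
  obtain ⟨C0, h00, h0⟩ := hg.exists_le 0 t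
  obtain ⟨C1, h10, h1⟩ := hg.exists_symmIntegral_le t
  refine ⟨C0 + |2 * c| * C1 + 1, by positivity, fun q => ?_⟩
  have hq := inv_one_add_sq_pos q.2
  rw [backwardKernel]
  split_ifs with h
  · have hs : q.1 ∈ Icc 0 t := ⟨h.1.le, h.2⟩
    have i1 := (h0 q.1 hs q.2).2.2
    rw [pow_zero, one_mul] at i1
    calc _ ≤ |dt g q.1 q.2| + |2 * c| * |symmIntegral (fun z => z * g q.1 z) q.2| := by
          refine (abs_add_le _ _).trans ?_
          rw [abs_neg, abs_mul (2 * c)]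
      _ ≤ C0 * (1 + q.2 ^ 2)⁻¹ + |2 * c| * (C1 * (1 + q.2 ^ 2)⁻¹) := by
          gcongr
          exact (h1 q.1 hs).1 q.2
      _ ≤ _ := by linarith
  · rw [abs_zero]
    positivity

/-- The factor 2c is the product of -2πc from A* and -1/π from the Hilbert transform. -/
lemma backwardKernel_eq (hg : IsTestFunction g) (c : ℝ) {t s : ℝ} (hs : 0 < s ∧ s ≤ t) (x : ℝ) :
    backwardKernel c g t (s, x) = backwardOp c g s x := by
  obtain ⟨C, -, hC⟩ := hg.exists_symmIntegral_le t
  have hpi := Real.pi_pos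
  rw [backwardKernel, if_pos hs, backwardOp, adjointOp, (hC s ⟨hs.1.le, hs.2⟩).2.hilbert_eq,
    (hg.hasDerivAt_dt s x).deriv]
  field_simp

lemma integrable_slice (hg : IsTestFunction g) {s : ℝ} (hs : 0 ≤ s) :
    Integrable (fun x => (g s x : ℂ)) := ((hg.slice hs).integrable (μ := volume)).ofReal

lemma integrable_mul_slice (hg : IsTestFunction g) {s : ℝ} (hs : 0 ≤ s) :
    Integrable (fun x => ((x * g s x : ℝ) : ℂ)) := by
  have h : Integrable fun x => x * g s x := by
    have h := (mulVar (hg.slice hs)).integrable (μ := volume)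
    rwa [coe_mulVar] at h
  exact h.ofReal

lemma integrable_dt (hg : IsTestFunction g) {s : ℝ} (hs : 0 ≤ s) :
    Integrable (fun x => (dt g s x : ℂ)) := by
  obtain ⟨C, -, hC⟩ := hg.exists_le 0 s
  have hc : Continuous (dt g s) := hg.continuous_dt.comp (by fun_prop : Continuous fun x : ℝ => (s, x))
  refine Integrable.ofReal ((integrable_inv_one_add_sq.const_mul C).mono' hc.aestronglyMeasurable
    (Eventually.of_forall fun x => ?_))
  have := (hC s ⟨hs, le_rfl⟩ x).2.2
  rwa [pow_zero, one_mul] at this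

lemma _root_.DynWhiteNoise.integrable_exp_mul {f : ℝ → ℂ} (hf : Integrable f) (ξ : ℝ) :
    Integrable fun v => Complex.exp (((2 * Real.pi * v * ξ : ℝ) : ℂ) * Complex.I) * f v := by
  refine hf.norm.mono' (AEStronglyMeasurable.mul (Continuous.aestronglyMeasurable (by fun_prop)) hf.1)
    (Eventually.of_forall fun v => ?_)
  rw [norm_mul, Complex.norm_exp_ofReal_mul_I, one_mul]

/-- On the Fourier side A* multiplies 𝓕⁻(x g) by -2πic sgn ξ. As 2πi 𝓕⁻(x g) is the ξ-derivative of
𝓕⁻g, this is minus transport with velocity c sgn ξ. -/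
lemma fourierInv_backwardOp (hg : IsTestFunction g) (c : ℝ) {s : ℝ} (hs : 0 < s) (ξ : ℝ) :
    𝓕⁻ (fun x => (backwardOp c g s x : ℂ)) ξ
      = -𝓕⁻ (fun x => (dt g s x : ℂ)) ξ
        - (2 * Real.pi * c * Real.sign ξ : ℝ) * Complex.I * 𝓕⁻ (fun x => ((x * g s x : ℝ) : ℂ)) ξ := by
  have hint : ∫ x, mulVar (hg.slice hs.le) x = 0 := by
    simp only [mulVar_apply, slice_apply]
    exact hg.moment_zero s hs.le
  have hH := congrFun (fourierInv_hilbert hint) ξ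
  have e1 : (mulVar (hg.slice hs.le) : ℝ → ℝ) = fun x => x * g s x :=
    funext fun x => mulVar_apply _ x
  simp only [hilbertSymbol, e1] at hH
  obtain ⟨C, -, hC⟩ := hg.exists_symmIntegral_le s
  obtain ⟨hC1, hC2⟩ := hC s ⟨hs.le, le_rfl⟩
  have hm : Measurable fun x => symmIntegral (fun z => z * g s z) x := by
    rw [← e1]
    exact (measurable_symmIntegral (X := Unit) (f := fun _ => mulVar (hg.slice hs.le))
      ((mulVar (hg.slice hs.le)).continuous.measurable.comp measurable_snd)).comp
        (measurable_const (a := ()).prodMk measurable_id)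
  have hi : Integrable fun x => ((hilbert (fun z => z * g s z) x : ℝ) : ℂ) := by
    simp only [hC2.hilbert_eq]
    exact (((integrable_inv_one_add_sq.const_mul C).mono' hm.aestronglyMeasurable
      (Eventually.of_forall hC1)).const_mul _).ofReal
  have e2 : (fun x => (backwardOp c g s x : ℂ)) = fun x => -(dt g s x : ℂ)
      + (-(2 * Real.pi * c) : ℝ) * ((hilbert (fun z => z * g s z) x : ℝ) : ℂ) := by
    ext x
    rw [backwardOp, adjointOp, (hg.hasDerivAt_dt s x).deriv]
    push_cast
    ring
  rw [e2, fourierInv_eq_integral]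
  simp only [mul_add, mul_neg, mul_left_comm _ (((-(2 * Real.pi * c) : ℝ)) : ℂ)]
  have i1 : Integrable fun v => -(Complex.exp (((2 * Real.pi * v * ξ : ℝ) : ℂ) * Complex.I)
      * (dt g s v : ℂ)) := (integrable_exp_mul (hg.integrable_dt hs.le) ξ).neg
  rw [integral_add i1 ((integrable_exp_mul hi ξ).const_mul _), integral_neg, integral_const_mul,
    ← fourierInv_eq_integral, ← fourierInv_eq_integral, hH]
  push_cast
  ring

/-- Along the characteristics the Fourier transform of a test function is differentiated by the
backward operator. -/
lemma hasDerivAt_fourierInv (hg : IsTestFunction g) {c : ℝ} (hc : 0 ≤ c) {s r : ℝ} (hs : 0 < s)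
    (hsr : s ≤ r) (k : ℝ) :
    HasDerivAt (fun r => 𝓕⁻ (fun x => (g r x : ℂ)) (freq c (r - s) k))
      (-𝓕⁻ (fun x => (backwardOp c g r x : ℂ)) (freq c (r - s) k)) r := by
  have hr : 0 < r := hs.trans_le hsr
  have hpi := Real.two_pi_pos
  set σ := Real.sign k with hσ
  obtain ⟨C0, h00, h0⟩ := hg.exists_le 0 (r + 1)
  obtain ⟨C1, h10, h1⟩ := hg.exists_le 1 (r + 1)
  have hgc := hg.continuous
  have hdc := hg.continuous_dt
  set F : ℝ → ℝ → ℂ := fun r x =>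
    Complex.exp (((2 * Real.pi * x * freq c (r - s) k : ℝ) : ℂ) * Complex.I) * (g r x : ℂ) with hF
  set F' : ℝ → ℝ → ℂ := fun r x =>
    Complex.exp (((2 * Real.pi * x * freq c (r - s) k : ℝ) : ℂ) * Complex.I) *
      ((2 * Real.pi * c * σ : ℝ) * Complex.I * ((x * g r x : ℝ) : ℂ) + (dt g r x : ℂ)) with hF'
  have hdiff : ∀ x r, HasDerivAt (fun r => F r x) (F' r x) r := by
    intro x r
    have d1 : HasDerivAt (fun r => freq c (r - s) k) (c * σ) r := by
      have := ((((hasDerivAt_id r).sub_const s).const_mul c).mul_const σ).const_add k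
      simpa [freq, hσ] using this
    have d2 : HasDerivAt (fun r : ℝ => ((2 * Real.pi * x * freq c (r - s) k : ℝ) : ℂ) * Complex.I)
        (((2 * Real.pi * x * (c * σ) : ℝ) : ℂ) * Complex.I) r :=
      (d1.const_mul _).ofReal_comp.mul_const _
    have d3 := d2.cexp.mul (hg.hasDerivAt_dt r x).ofReal_comp
    refine d3.congr_deriv ?_
    rw [hF']
    push_cast
    ring
  have hmem : Ioo 0 (r + 1) ∈ 𝓝 r := Ioo_mem_nhds hr (by linarith)
  have hcx : ∀ r : ℝ, Continuous fun x : ℝ => (r, x) := fun r => by fun_prop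
  have key := hasDerivAt_integral_of_dominated_loc_of_deriv_le (F := F) (F' := F') (x₀ := r)
    (μ := volume) (s := Ioo 0 (r + 1))
    (bound := fun x => (2 * Real.pi * c * |σ| * C1 + C0) * (1 + x ^ 2)⁻¹) hmem
    (Eventually.of_forall fun r => by
      have h1 : Continuous (g r) := hgc.comp (hcx r)
      exact Continuous.aestronglyMeasurable (by simp only [hF]; fun_prop))
    (integrable_exp_mul (hg.integrable_slice hr.le) _)
    (by
      have h1 : Continuous (g r) := hgc.comp (hcx r)
      have h2 : Continuous (dt g r) := hdc.comp (hcx r)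
      exact Continuous.aestronglyMeasurable (by simp only [hF']; fun_prop))
    (Eventually.of_forall fun x r hr => by
      have hr' : r ∈ Icc 0 (r + 1) := ⟨hr.1.le, by linarith⟩
      have hr'' := Ioo_subset_Icc_self hr
      have i0 := (h0 r hr'' x).2.2
      have i1 := (h1 r hr'' x).1
      rw [pow_zero, one_mul] at i0
      rw [pow_one, ← abs_mul] at i1
      simp only [hF']
      rw [norm_mul, Complex.norm_exp_ofReal_mul_I, one_mul]
      refine (norm_add_le _ _).trans ?_
      rw [norm_mul, norm_mul, Complex.norm_I, mul_one, Complex.norm_real, Complex.norm_real,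
        Complex.norm_real, Real.norm_eq_abs, Real.norm_eq_abs, Real.norm_eq_abs, abs_mul,
        abs_of_nonneg (by positivity : 0 ≤ 2 * Real.pi * c)]
      calc _ ≤ 2 * Real.pi * c * |σ| * (C1 * (1 + x ^ 2)⁻¹) + C0 * (1 + x ^ 2)⁻¹ := by gcongr
        _ = _ := by ring)
    (integrable_inv_one_add_sq.const_mul _)
    (Eventually.of_forall fun x r _ => hdiff x r)
  have e1 : (fun r => 𝓕⁻ (fun x => (g r x : ℂ)) (freq c (r - s) k)) = fun r => ∫ x, F r x :=
    funext fun r => fourierInv_eq_integral _ _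
  rw [e1]
  refine key.2.congr_deriv ?_
  -- A characteristic never changes sign, so the sign in the symbol of A* is that of the initial
  -- frequency k, which is also the direction of motion.
  rw [hg.fourierInv_backwardOp c hr, sign_freq (mul_nonneg hc (by linarith))]
  simp only [hF', mul_add, mul_left_comm _ (((2 * Real.pi * c * σ : ℝ) : ℂ) * Complex.I)]
  rw [integral_add ((integrable_exp_mul (hg.integrable_mul_slice hr.le) _).const_mul _)
    (integrable_exp_mul (hg.integrable_dt hr.le) _), integral_const_mul, ← fourierInv_eq_integral,
    ← fourierInv_eq_integral]
  ring

end IsTestFunction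

end

section

/-! ### The weak equation -/

open IsTestFunction (backwardKernel)

variable {Ω : Type*} [MeasurableSpace Ω] {P : Measure Ω} {W : (ℝ × ℝ → ℝ) → Ω → ℝ}
  {φ : 𝓢(ℝ, ℝ)} {c : ℝ} {U : ℕ → ℝ × ℝ → Ω → ℝ} {g : ℝ → ℝ → ℝ}

lemma fourierInv_profileHat (φ : 𝓢(ℝ, ℝ)) (x : ℝ) :
    𝓕⁻ (profileHat φ : ℝ → ℂ) x = (φ x : ℂ) := by
  rw [← SchwartzMap.fourierInv_coe, profileHat, FourierTransform.fourierInv_fourier_eq]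
  rfl

/-- The convolution theorem, obtained by moving the transform from h to the modulated φ̂ by duality;
inversion of φ̂ then gives the translate φ(x - y). -/
lemma fourier_profileHat_mul {h : ℝ → ℂ} (hh : Integrable h) (y : ℝ) :
    𝓕 (fun k => profileHat φ k * 𝓕⁻ h k) y = ∫ x, (φ (x - y) : ℂ) * h x := by
  set A : ℝ → ℂ := fun k =>
    Complex.exp (((-2 * Real.pi * k * y : ℝ) : ℂ) * Complex.I) * profileHat φ k with hA
  have hAi : Integrable A := by
    have hc := (profileHat φ).continuous
    refine (profileHat φ).integrable.norm.mono' (Continuous.aestronglyMeasurable (by fun_prop))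
      (Eventually.of_forall fun k => ?_)
    rw [hA, norm_mul, Complex.norm_exp_ofReal_mul_I, one_mul]
  have e1 : 𝓕 (fun k => profileHat φ k * 𝓕⁻ h k) y = ∫ k, 𝓕 h k * A (-k) := by
    rw [fourier_eq_integral, ← integral_neg_eq_self]
    congr 1
    ext k
    rw [Real.fourierInv_eq_fourier_neg, neg_neg, hA]
    ring
  rw [e1, integral_fourier_mul_eq hh hAi.comp_neg]
  congr 1
  ext x
  rw [mul_comm (h x), fourier_eq_integral, ← integral_neg_eq_self, ← fourierInv_profileHat,
    fourierInv_eq_integral]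
  congr 2
  ext k
  rw [neg_neg, hA, ← mul_assoc, ← Complex.exp_add]
  congr 2
  push_cast
  ring

/-- The amplitude of the forcing tested against `g` on the time interval `(0, t]`. -/
def forcingAmplitude (φ : 𝓢(ℝ, ℝ)) (g : ℝ → ℝ → ℝ) (t : ℝ) (p : ℝ × ℝ) : ℂ :=
  if 0 < p.1 ∧ p.1 ≤ t then profileHat φ p.2 * 𝓕⁻ (fun x => (g p.1 x : ℂ)) p.2 else 0

/-- The forcing sees the noise at its initial frequency, so its amplitude contains no `freq`. -/
lemma kernel_forcingAmplitude (hg : IsTestFunction g) (t : ℝ) (p : ℝ × ℝ) :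
    kernel (forcingAmplitude φ g t) p = (forcingKernel φ g t p : ℂ) := by
  simp only [kernel, forcingAmplitude, forcingKernel]
  by_cases h : 0 < p.1 ∧ p.1 ≤ t
  · simp only [if_pos h]
    rw [indicator_of_mem (show p.1 ∈ Ioc 0 t from h), fourier_profileHat_mul
      (hg.integrable_slice h.1.le), ← integral_complex_ofReal]
    simp only [Complex.ofReal_mul]
  · simp only [if_neg h]
    rw [indicator_of_notMem (show p.1 ∉ Ioc 0 t from h)]
    simp [fourier_eq_integral]

/-- The amplitude of the space-time pairing of the solution with `(-∂_s + A*) g`. -/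
lemma integral_backwardAmplitude (hg : IsTestFunction g) (hc : 0 ≤ c) (t : ℝ) (p : ℝ × ℝ)
    (hi : Integrable (fun q : ℝ × ℝ => (backwardKernel c g t q : ℂ)
      * solutionAmplitude φ c q.1 (wave 0 q.2) p) ((volume.restrict (Ioc 0 t)).prod volume)) :
    solutionAmplitude φ c t (𝓕⁻ fun x => (g t x : ℂ)) p
      + ∫ q, (backwardKernel c g t q : ℂ) * solutionAmplitude φ c q.1 (wave 0 q.2) p
        ∂((volume.restrict (Ioc 0 t)).prod volume) = forcingAmplitude φ g t p := by
  have hslice : ∀ s ∈ Ioc 0 t, ∫ x, (backwardKernel c g t (s, x) : ℂ)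
      * solutionAmplitude φ c s (wave 0 x) p
        = solutionAmplitude φ c s (𝓕⁻ fun x => (backwardOp c g s x : ℂ)) p := by
    intro s hs
    simp only [hg.backwardKernel_eq c (t := t) hs]
    exact integral_mul_solutionAmplitude s (fun x => (backwardOp c g s x : ℂ)) p
  have hi1 : IntegrableOn (fun s => solutionAmplitude φ c s
      (𝓕⁻ fun x => (backwardOp c g s x : ℂ)) p) (Ioc 0 t) :=
    (integrableOn_congr_fun hslice measurableSet_Ioc).1 hi.integral_prod_left
  rw [integral_prod _ hi]
  simp only
  rw [setIntegral_congr_fun measurableSet_Ioc hslice]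
  by_cases h : 0 < p.1 ∧ p.1 ≤ t
  · set X : ℝ → ℂ := fun s => profileHat φ p.2
      * 𝓕⁻ (fun x => (backwardOp c g s x : ℂ)) (freq c (s - p.1) p.2) with hX
    -- Noise injected at time p.1 affects the solution only afterwards, so the time integral over
    -- (0, t] effectively starts at p.1.
    have e1 : (fun s => solutionAmplitude φ c s (𝓕⁻ fun x => (backwardOp c g s x : ℂ)) p)
        = (Ici p.1).indicator X := by
      ext s
      by_cases hs : p.1 ≤ s
      · rw [indicator_of_mem (show s ∈ Ici p.1 from hs), solutionAmplitude, if_pos ⟨h.1, hs⟩]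
      · rw [indicator_of_notMem (show s ∉ Ici p.1 from hs), solutionAmplitude,
          if_neg fun h' => hs h'.2]
    have e2 : Ioc 0 t ∩ Ici p.1 = Icc p.1 t := by
      ext s
      simp only [mem_inter_iff, mem_Ioc, mem_Ici, mem_Icc]
      exact ⟨fun h' => ⟨h'.2, h'.1.2⟩, fun h' => ⟨⟨h.1.trans_le h'.1, h'.2⟩, h'.1⟩⟩
    rw [e1] at hi1 ⊢
    have hX1 : IntegrableOn X (Icc p.1 t) := by
      rw [← e2, inter_comm, ← integrableOn_indicator_iff measurableSet_Ici]
      exact hi1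
    rw [setIntegral_indicator measurableSet_Ici, e2, integral_Icc_eq_integral_Ioc,
      ← intervalIntegral.integral_of_le h.2]
    have hX2 : IntervalIntegrable (fun s => -X s) volume p.1 t :=
      ((intervalIntegrable_iff_integrableOn_Icc_of_le h.2).2 hX1).neg
    -- The boundary term at t is the amplitude of the pairing of u(t) with g(t). At the injection
    -- time the frequency has not moved, which gives the forcing amplitude.
    have hft := intervalIntegral.integral_eq_sub_of_hasDerivAt (a := p.1) (b := t)
      (f := fun r => profileHat φ p.2 * 𝓕⁻ (fun x => (g r x : ℂ)) (freq c (r - p.1) p.2))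
      (f' := fun s => -X s) (fun r hr => by
        rw [uIcc_of_le h.2] at hr
        refine ((hg.hasDerivAt_fourierInv hc h.1 hr.1 p.2).const_mul _).congr_deriv ?_
        rw [hX]
        ring) hX2
    rw [intervalIntegral.integral_neg, sub_self, freq_zero] at hft
    rw [solutionAmplitude, if_pos h, forcingAmplitude, if_pos h]
    linear_combination -hft
  · have e1 : ∀ s ∈ Ioc 0 t, solutionAmplitude φ c s (𝓕⁻ fun x => (backwardOp c g s x : ℂ)) p = 0 :=
      fun s hs => by
        rw [solutionAmplitude, if_neg fun h' => h ⟨h'.1, h'.2.trans hs.2⟩]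
    rw [setIntegral_congr_fun measurableSet_Ioc e1, solutionAmplitude, if_neg h, forcingAmplitude,
      if_neg h]
    simp

-- Stochastic Fubini over (0, t] × ℝ expresses the space-time pairing as one white noise integral.
-- The equation is then additivity of spectral noises together with `integral_backwardAmplitude`.
set_option maxHeartbeats 1000000 in
theorem IsSolutionField.weak [IsProbabilityMeasure P] (hU : IsSolutionField P W φ c U)
    (hW : IsWhiteNoise P W) (hc : 0 ≤ c) (hg : IsTestFunction g) {t : ℝ} (ht : 0 < t) :
    ∀ᵐ ω ∂P, Integrable (fun p : ℝ × ℝ => U 0 (p.1, p.2) ω * backwardOp c g p.1 p.2)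
        ((volume.restrict (Ioc 0 t)).prod volume) ∧
      (∫ x, U 0 (t, x) ω * g t x) + ∫ s in Ioc 0 t, ∫ x, U 0 (s, x) ω * backwardOp c g s x
        = W (forcingKernel φ g t) ω := by
  set ν : Measure (ℝ × ℝ) := (volume.restrict (Ioc 0 t)).prod volume with hν
  obtain ⟨C, hC0, hC⟩ := hg.exists_backwardKernel_le c t
  have hm : Measurable fun q : ℝ × ℝ => wave 0 q.1 q.2 := (continuous_wave 0).measurable
  have hBm := hg.measurable_backwardKernel c t
  have hw : Integrable (fun q : ℝ × ℝ => C * (1 + q.2 ^ 2)⁻¹) ν :=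
    (integrable_const C).mul_prod integrable_inv_one_add_sq
  have hmeas : Measurable fun q : (ℝ × ℝ) × (ℝ × ℝ) => (backwardKernel c g t q.1 : ℂ)
      * solutionAmplitude φ c q.1.1 (wave 0 q.1.2) q.2 :=
    (Complex.measurable_ofReal.comp (hBm.comp measurable_fst)).mul
      (measurable_solutionAmplitude (X := ℝ × ℝ) (t := fun q => q.1) (m := fun q => wave 0 q.2)
        measurable_fst
        (hm.comp ((measurable_snd.comp measurable_fst).prodMk measurable_snd)))
  have hab : ∀ q p : ℝ × ℝ, 0 < p.1 → ‖(backwardKernel c g t q : ℂ)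
      * solutionAmplitude φ c q.1 (wave 0 q.2) p‖ ≤ C * (1 + q.2 ^ 2)⁻¹ * ‖boundAmplitude φ t 0 p‖ := by
    intro q p _
    rw [norm_mul, Complex.norm_real]
    by_cases hq : 0 < q.1 ∧ q.1 ≤ t
    · exact mul_le_mul (hC q) (norm_waveAmplitude_le hc hq.2 q.2 p) (norm_nonneg _) (by positivity)
    · rw [backwardKernel, if_neg hq, norm_zero, zero_mul]
      positivity
  obtain ⟨h1, h2, h3⟩ := hW.integral_eq_spectralNoise (X := ℝ × ℝ) (ν := ν)
    (a := fun q p => (backwardKernel c g t q : ℂ) * solutionAmplitude φ c q.1 (wave 0 q.2) p)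
    (Y := fun q ω => (U 0 (q.1, q.2) ω : ℂ) * (backwardKernel c g t q : ℂ))
    (w := fun q => C * (1 + q.2 ^ 2)⁻¹) (b := boundAmplitude φ t 0)
    ((Complex.measurable_ofReal.comp (hU.measurable_comp 0 measurable_fst measurable_snd)).mul
      (Complex.measurable_ofReal.comp (hBm.comp measurable_fst))).aestronglyMeasurable
    (Eventually.of_forall fun q => by
      filter_upwards [hU.eq_spectral 0 (q.1, q.2), hW.spectralNoise_const_mul
        (isAmplitude_wave φ hc 0 q.1 q.2) (backwardKernel c g t q : ℂ)] with ω e1 e2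
      rw [e1, mul_comm, e2])
    hmeas hw (fun q => by positivity) (isAmplitude_boundAmplitude φ t 0) hab
  have hsum : ∀ p : ℝ × ℝ, 0 < p.1 → solutionAmplitude φ c t (𝓕⁻ fun x => (g t x : ℂ)) p
      + ∫ q, (backwardKernel c g t q : ℂ) * solutionAmplitude φ c q.1 (wave 0 q.2) p ∂ν
        = forcingAmplitude φ g t p := fun p hp => by
    refine integral_backwardAmplitude hg hc t p ((hw.mul_const ‖boundAmplitude φ t 0 p‖).mono'
      (hmeas.comp (measurable_id.prodMk measurable_const)).aestronglyMeasurable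
      (Eventually.of_forall fun q => hab q p hp))
  obtain ⟨Cg, -, hCg⟩ := exists_schwartz_le (hg.slice ht.le)
  have hgm : Measurable fun x => (g t x : ℂ) :=
    Complex.measurable_ofReal.comp (hg.slice ht.le).continuous.measurable
  obtain ⟨-, h4, h5⟩ := hU.integral_mul_eq hW hc t hgm (C := Cg) (fun x => by
    rw [Complex.norm_real]
    exact hCg x)
  -- For s > 0 the forcing amplitude is the sum of the two amplitudes already controlled, so
  -- measurability and domination are inherited from them.
  have hF : IsAmplitude (forcingAmplitude φ g t) := by
    have h6 := h4.add h2
    refine h6.of_norm_le ?_ 1 fun p hp => by rw [one_mul, hsum p hp]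
    have : forcingAmplitude φ g t = fun p => if 0 < p.1 then
        (solutionAmplitude φ c t (𝓕⁻ fun x => (g t x : ℂ)) p
      + ∫ q, (backwardKernel c g t q : ℂ) * solutionAmplitude φ c q.1 (wave 0 q.2) p ∂ν) else 0 := by
      ext p
      split_ifs with hp
      · exact (hsum p hp).symm
      · rw [forcingAmplitude, if_neg fun h => hp h.1]
    rw [this]
    exact Measurable.ite (measurableSet_lt measurable_const measurable_fst) h6.measurable
      measurable_const
  have h7 := hW.spectralNoise_add h4 h2 hF
    (by filter_upwards [ae_spaceTime_pos] with p hp using hsum p hp)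
  have hae : ∀ᵐ q ∂ν, backwardKernel c g t q = backwardOp c g q.1 q.2 := by
    have : ∀ᵐ q ∂ν, q.1 ∈ Ioc 0 t :=
      Measure.quasiMeasurePreserving_fst.ae (ae_restrict_mem measurableSet_Ioc)
    filter_upwards [this] with q hq using hg.backwardKernel_eq c (t := t) hq q.2
  filter_upwards [h1, h3, h5, h7, hW.map_zero] with ω i1 i3 i5 i7 i0
  have hint : Integrable (fun q : ℝ × ℝ => U 0 (q.1, q.2) ω * backwardOp c g q.1 q.2) ν := by
    refine (i1.re).congr ?_
    filter_upwards [hae] with q hq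
    rw [← hq, ← Complex.ofReal_mul]
    exact Complex.ofReal_re _
  refine ⟨hint, ?_⟩
  have e1 : spectralNoise W (forcingAmplitude φ g t) ω = (W (forcingKernel φ g t) ω : ℂ) := by
    simp [spectralNoise, complexNoise, kernel_forcingAmplitude hg, i0]
  have e2 : ∫ q, (U 0 (q.1, q.2) ω : ℂ) * (backwardKernel c g t q : ℂ) ∂ν
      = ((∫ s in Ioc 0 t, ∫ x, U 0 (s, x) ω * backwardOp c g s x : ℝ) : ℂ) := by
    rw [← integral_prod (fun q : ℝ × ℝ => U 0 (q.1, q.2) ω * backwardOp c g q.1 q.2) hint,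
      ← integral_complex_ofReal]
    refine integral_congr_ae ?_
    filter_upwards [hae] with q hq
    rw [hq, Complex.ofReal_mul]
  have e3 : ∫ x, (U 0 (t, x) ω : ℂ) * (g t x : ℂ) = ((∫ x, U 0 (t, x) ω * g t x : ℝ) : ℂ) := by
    rw [← integral_complex_ofReal]
    simp only [Complex.ofReal_mul]
  rw [← i3, ← i5, e1, e2, e3, ← Complex.ofReal_add, Complex.ofReal_inj] at i7
  exact i7

end

section

/-! ### The limiting random distribution -/

variable {Ω : Type*} [MeasurableSpace Ω] {P : Measure Ω} {W : (ℝ × ℝ → ℝ) → Ω → ℝ}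
  {φ : 𝓢(ℝ, ℝ)} {c : ℝ}

/-- The amplitude `φ̂(k) m(k + cs sgn k)` of the observable of the limit with Fourier
multiplier `m`. -/
def limitAmplitude (φ : 𝓢(ℝ, ℝ)) (c : ℝ) (m : ℝ → ℂ) (p : ℝ × ℝ) : ℂ :=
  profileHat φ p.2 * m (freq c p.1 p.2)

lemma measurable_limitAmplitude {X : Type*} [MeasurableSpace X] {m : X → ℝ → ℂ}
    (hm : Measurable fun q : X × ℝ => m q.1 q.2) :
    Measurable fun q : X × (ℝ × ℝ) => limitAmplitude φ c (m q.1) q.2 := by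
  unfold limitAmplitude
  refine ((measurable_profileHat φ).comp (measurable_snd.comp measurable_snd)).mul
    (hm.comp (measurable_fst.prodMk ?_))
  exact (measurable_freq c).comp measurable_snd

lemma memLp_inv_one_add_mul_sq (hc : 0 < c) : MemLp (fun s : ℝ => (1 + (c * s) ^ 2)⁻¹) 2 := by
  have hm : Measurable fun s : ℝ => (1 + (c * s) ^ 2)⁻¹ := by fun_prop
  rw [memLp_two_iff_integrable_sq hm.aestronglyMeasurable]
  exact memLp_inv_one_add_sq.integrable_sq.comp_mul_left' hc.ne'

lemma integrable_inv_one_add_mul_sq (hc : 0 < c) : Integrable (fun s : ℝ => (1 + (c * s) ^ 2)⁻¹) :=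
  integrable_inv_one_add_sq.comp_mul_left' hc.ne'

/-- Frequencies recede at speed c, so decay of a multiplier in frequency becomes decay in elapsed
time. The point k = 0 is excluded because it does not move. -/
lemma inv_one_add_freq_sq_le (hc : 0 < c) {s k : ℝ} (hs : 0 < s) (hk : k ≠ 0) :
    (1 + freq c s k ^ 2)⁻¹ ≤ (1 + (c * s) ^ 2)⁻¹ := by
  have hcs : 0 < c * s := by positivity
  have h : (c * s) ^ 2 ≤ freq c s k ^ 2 := by
    rw [← sq_abs (freq c s k), abs_freq hcs.le hk]
    gcongr
    linarith [abs_nonneg k]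
  exact inv_anti₀ (by positivity) (by linarith)

/-- The stationary frequency k = 0 is harmless since φ̂(0) = 0. The resulting decay in s is what
permits the infinite time window of the limit. -/
lemma norm_limitAmplitude_le (hc : 0 < c) (hφ : ∫ x, φ x = 0) {K : ℝ} {m : ℝ → ℂ}
    (hm : ∀ ξ, ‖m ξ‖ ≤ K * (1 + ξ ^ 2)⁻¹) {p : ℝ × ℝ} (hp : 0 < p.1) :
    ‖limitAmplitude φ c m p‖ ≤ ‖profileHat φ p.2‖ * (K * (1 + (c * p.1) ^ 2)⁻¹) := by
  have hK : 0 ≤ K := by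
    have := (norm_nonneg _).trans (hm 0)
    simpa using this
  rw [limitAmplitude, norm_mul]
  rcases eq_or_ne p.2 0 with h | h
  · rw [h, profileHat_zero hφ, norm_zero, zero_mul, zero_mul]
  · gcongr
    exact (hm _).trans (mul_le_mul_of_nonneg_left (inv_one_add_freq_sq_le hc hp h) hK)

lemma isAmplitude_limitAmplitude (hc : 0 < c) (hφ : ∫ x, φ x = 0) {K : ℝ} {m : ℝ → ℂ}
    (hmm : Measurable m) (hm : ∀ ξ, ‖m ξ‖ ≤ K * (1 + ξ ^ 2)⁻¹) :
    IsAmplitude (limitAmplitude φ c m) := by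
  obtain ⟨C, hC0, hC⟩ := exists_schwartz_le (profileHat φ)
  have hK : 0 ≤ K := by
    have := (norm_nonneg _).trans (hm 0)
    simpa using this
  refine ⟨?_, fun s => C * K * (1 + (c * s) ^ 2)⁻¹, fun k => (1 + k ^ 2)⁻¹,
    ((memLp_inv_one_add_mul_sq hc).const_mul _).restrict _,
    integrable_inv_one_add_sq, memLp_inv_one_add_sq, fun s hs k => ?_⟩
  · exact ((measurable_profileHat φ).comp measurable_snd).mul (hmm.comp (measurable_freq c))
  · refine (norm_limitAmplitude_le hc hφ hm (p := (s, k)) hs).trans ?_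
    calc _ ≤ C * (1 + k ^ 2)⁻¹ * (K * (1 + (c * s) ^ 2)⁻¹) := by gcongr; exact hC k
      _ = _ := by ring

lemma isHermitian_limitAmplitude {m : ℝ → ℂ} (hm : ∀ ξ, starRingEnd ℂ (m (-ξ)) = m ξ) :
    IsHermitian (limitAmplitude φ c m) := fun s k => by
  rw [limitAmplitude, limitAmplitude, map_mul, freq_neg, hm, conj_profileHat_neg]

/-- The Fourier multiplier of `(1 - ∂_x²)⁻¹`. -/
def resolventSymbol (ξ : ℝ) : ℝ := (1 + (2 * Real.pi * ξ) ^ 2)⁻¹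

lemma resolventSymbol_pos (ξ : ℝ) : 0 < resolventSymbol ξ := by
  unfold resolventSymbol
  positivity

lemma measurable_resolventSymbol : Measurable resolventSymbol := by
  unfold resolventSymbol
  fun_prop

lemma resolventSymbol_le (ξ : ℝ) : resolventSymbol ξ ≤ (1 + ξ ^ 2)⁻¹ := by
  unfold resolventSymbol
  have h : 1 ≤ (2 * Real.pi) ^ 2 := by nlinarith [Real.pi_gt_three]
  refine inv_anti₀ (by positivity) ?_
  rw [mul_pow]
  linarith [mul_le_mul_of_nonneg_right h (sq_nonneg ξ)]

/-- The Fourier multiplier of the point evaluations of the potential of the limit. -/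
def potentialSymbol (x ξ : ℝ) : ℂ := wave 0 x ξ * (resolventSymbol ξ : ℂ)

lemma norm_potentialSymbol (x ξ : ℝ) : ‖potentialSymbol x ξ‖ = resolventSymbol ξ := by
  rw [potentialSymbol, norm_mul, norm_wave_zero, one_mul, Complex.norm_real,
    Real.norm_of_nonneg (resolventSymbol_pos ξ).le]

lemma norm_potentialSymbol_le (x ξ : ℝ) : ‖potentialSymbol x ξ‖ ≤ 1 * (1 + ξ ^ 2)⁻¹ := by
  rw [norm_potentialSymbol, one_mul]
  exact resolventSymbol_le ξ

lemma measurable_potentialSymbol : Measurable fun q : ℝ × ℝ => potentialSymbol q.1 q.2 :=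
  (continuous_wave 0).measurable.mul
    (Complex.measurable_ofReal.comp (measurable_resolventSymbol.comp measurable_snd))

/-- One factor of the square is bounded by 2 and the other by 2π|ξ||x - y|. One resolvent factor
absorbs 2π|ξ| and the other is kept for the decay in s. -/
lemma norm_potentialSymbol_sub_sq_le (x y ξ : ℝ) :
    ‖potentialSymbol x ξ - potentialSymbol y ξ‖ ^ 2 ≤ 2 * |x - y| * (1 + ξ ^ 2)⁻¹ := by
  have hr := resolventSymbol_pos ξ
  have h1 : ‖wave 0 x ξ - wave 0 y ξ‖ ≤ 2 * Real.pi * |ξ| * |x - y| := by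
    simp only [wave, pow_zero, one_mul]
    refine (norm_exp_sub_exp_le _ _).trans (le_of_eq ?_)
    rw [← mul_sub, abs_mul, abs_mul, abs_of_pos Real.two_pi_pos]
  have h2 : ‖wave 0 x ξ - wave 0 y ξ‖ ≤ 2 := by
    refine (norm_sub_le _ _).trans ?_
    rw [norm_wave_zero, norm_wave_zero]
    norm_num
  have h3 : 2 * Real.pi * |ξ| * resolventSymbol ξ ≤ 1 := by
    rw [resolventSymbol, ← div_eq_mul_inv, div_le_one (by positivity)]
    rw [mul_pow, ← sq_abs ξ, ← mul_pow]
    nlinarith [sq_nonneg (2 * Real.pi * |ξ| - 1)]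
  rw [potentialSymbol, potentialSymbol, ← sub_mul, norm_mul, Complex.norm_real,
    Real.norm_of_nonneg hr.le]
  calc (‖wave 0 x ξ - wave 0 y ξ‖ * resolventSymbol ξ) ^ 2
      = ‖wave 0 x ξ - wave 0 y ξ‖ * ‖wave 0 x ξ - wave 0 y ξ‖ * resolventSymbol ξ ^ 2 := by ring
    _ ≤ 2 * (2 * Real.pi * |ξ| * |x - y|) * resolventSymbol ξ ^ 2 := by gcongr
    _ = 2 * |x - y| * resolventSymbol ξ * (2 * Real.pi * |ξ| * resolventSymbol ξ) := by ring
    _ ≤ 2 * |x - y| * resolventSymbol ξ * 1 := by gcongr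
    _ ≤ _ := by
      rw [mul_one]
      gcongr
      exact resolventSymbol_le ξ

/-- A continuous random potential: the limiting distribution is `(1 - ∂_x²) V`. -/
structure IsLimitPotential (P : Measure Ω) (W : (ℝ × ℝ → ℝ) → Ω → ℝ) (φ : 𝓢(ℝ, ℝ)) (c : ℝ)
    (V : ℝ → Ω → ℝ) : Prop where
  measurable : ∀ x, Measurable (V x)
  eq_spectral : ∀ x, (fun ω => (V x ω : ℂ)) =ᵐ[P]
    spectralNoise W (limitAmplitude φ c (potentialSymbol x))
  continuous : ∀ ω, Continuous fun x => V x ω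

lemma isAmplitude_potential (hc : 0 < c) (hφ : ∫ x, φ x = 0) (x : ℝ) :
    IsAmplitude (limitAmplitude φ c (potentialSymbol x)) :=
  isAmplitude_limitAmplitude (K := 1) (m := potentialSymbol x) hc hφ
    (Measurable.of_uncurry_left (f := potentialSymbol) measurable_potentialSymbol)
    (norm_potentialSymbol_le x)

/-- The plane wave does not decay in ξ, so the limit has no point values over the infinite window.
Dividing by 1 + (2πξ)² makes the amplitude square integrable, with squared increments linear in the
distance. -/
lemma IsWhiteNoise.exists_isLimitPotential [IsProbabilityMeasure P] (hW : IsWhiteNoise P W)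
    (hc : 0 < c) (hφ : ∫ x, φ x = 0) : ∃ V, IsLimitPotential P W φ c V := by
  obtain ⟨C, hC0, hC⟩ := exists_schwartz_le (profileHat φ)
  set J : ℝ := ∫ p : ℝ × ℝ, (1 + (c * p.1) ^ 2)⁻¹ * (C * (1 + p.2 ^ 2)⁻¹) ^ 2 ∂spaceTime with hJ
  have hJi : Integrable (fun p : ℝ × ℝ => (1 + (c * p.1) ^ 2)⁻¹ * (C * (1 + p.2 ^ 2)⁻¹) ^ 2)
      spaceTime :=
    (integrable_inv_one_add_mul_sq hc).restrict.mul_prod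
      (memLp_inv_one_add_sq.const_mul C).integrable_sq
  have hbound : ∀ p q : ℝ × ℝ, ∫ z, ‖limitAmplitude φ c (potentialSymbol p.2) z
      - limitAmplitude φ c (potentialSymbol q.2) z‖ ^ 2 ∂spaceTime ≤ 2 * J * ‖p - q‖ := by
    intro p q
    have hd2 : |p.2 - q.2| ≤ ‖p - q‖ := norm_snd_le (p - q)
    calc _ ≤ ∫ z : ℝ × ℝ, (2 * ‖p - q‖) *
          ((1 + (c * z.1) ^ 2)⁻¹ * (C * (1 + z.2 ^ 2)⁻¹) ^ 2) ∂spaceTime := by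
          refine integral_mono_of_nonneg (Eventually.of_forall fun _ => sq_nonneg _)
            (hJi.const_mul _) ?_
          filter_upwards [ae_spaceTime_pos, ae_spaceTime_snd_ne_zero] with z hz hz2
          simp only [limitAmplitude]
          rw [← mul_sub, norm_mul, mul_pow]
          calc _ ≤ (C * (1 + z.2 ^ 2)⁻¹) ^ 2 * (2 * |p.2 - q.2| * (1 + freq c z.1 z.2 ^ 2)⁻¹) := by
                gcongr
                · exact hC _
                · exact norm_potentialSymbol_sub_sq_le _ _ _
            _ ≤ (C * (1 + z.2 ^ 2)⁻¹) ^ 2 * (2 * ‖p - q‖ * (1 + (c * z.1) ^ 2)⁻¹) := by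
                refine mul_le_mul_of_nonneg_left ?_ (sq_nonneg _)
                exact mul_le_mul (by gcongr) (inv_one_add_freq_sq_le hc hz hz2) (by positivity)
                  (by positivity)
            _ = _ := by ring
      _ = 2 * J * ‖p - q‖ := by rw [integral_const_mul]; ring
  -- The planar criterion is applied to a family that does not depend on its first coordinate.
  obtain ⟨Y, h1, -, h3, h4, -⟩ := hW.exists_holder_spectralNoise
    (a := fun p => limitAmplitude φ c (potentialSymbol p.2))
    (fun p => isAmplitude_potential hc hφ p.2)
    (fun p => isHermitian_limitAmplitude fun ξ => by
      have : resolventSymbol (-ξ) = resolventSymbol ξ := by simp [resolventSymbol]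
      rw [potentialSymbol, map_mul, conj_wave_neg, Complex.conj_ofReal, this, potentialSymbol])
    (fun N => ⟨2 * J, fun p q _ _ => hbound p q⟩)
  exact ⟨fun x => Y (0, x), fun x => h1 _, fun x => h3 (0, x),
    fun ω => (h4 ω).comp (by fun_prop)⟩

namespace IsLimitPotential

variable {V : ℝ → Ω → ℝ}

lemma measurable_prod (hV : IsLimitPotential P W φ c V) :
    Measurable fun q : ℝ × Ω => V q.1 q.2 :=
  (stronglyMeasurable_uncurry_of_continuous_of_stronglyMeasurable hV.continuous
    fun x => (hV.measurable x).stronglyMeasurable).measurable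

theorem integral_mul_eq [IsProbabilityMeasure P] (hV : IsLimitPotential P W φ c V)
    (hW : IsWhiteNoise P W) (hc : 0 < c) (hφ : ∫ x, φ x = 0)
    {g : ℝ → ℂ} (hg : Measurable g) {C : ℝ} (hgC : ∀ x, ‖g x‖ ≤ C * (1 + x ^ 2)⁻¹) :
    (∀ᵐ ω ∂P, Integrable fun x => (V x ω : ℂ) * g x) ∧
      (fun ω => ∫ x, (V x ω : ℂ) * g x) =ᵐ[P]
        spectralNoise W (limitAmplitude φ c fun ξ => (resolventSymbol ξ : ℂ) * 𝓕⁻ g ξ) := by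
  have hwm : Integrable fun x : ℝ => (|C| + 1) * (1 + x ^ 2)⁻¹ :=
    integrable_inv_one_add_sq.const_mul _
  obtain ⟨h1, -, h2⟩ := hW.integral_eq_spectralNoise (X := ℝ) (ν := volume)
    (a := fun x p => g x * limitAmplitude φ c (potentialSymbol x) p)
    (Y := fun x ω => (V x ω : ℂ) * g x) (w := fun x => (|C| + 1) * (1 + x ^ 2)⁻¹)
    (b := limitAmplitude φ c (potentialSymbol 0))
    ((Complex.measurable_ofReal.comp hV.measurable_prod).mul
      (hg.comp measurable_fst)).aestronglyMeasurable
    (Eventually.of_forall fun x => by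
      filter_upwards [hV.eq_spectral x,
        hW.spectralNoise_const_mul (isAmplitude_potential hc hφ x) (g x)] with ω h1 h2
      rw [h1, mul_comm, h2])
    ((hg.comp measurable_fst).mul (measurable_limitAmplitude measurable_potentialSymbol))
    hwm (fun x => by positivity) (isAmplitude_potential hc hφ 0)
    (fun x p _ => by
      rw [norm_mul]
      have e : ‖limitAmplitude φ c (potentialSymbol x) p‖
          = ‖limitAmplitude φ c (potentialSymbol 0) p‖ := by
        rw [limitAmplitude, limitAmplitude, norm_mul, norm_mul, norm_potentialSymbol,
          norm_potentialSymbol]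
      rw [e]
      gcongr
      refine (hgC x).trans ?_
      have := le_abs_self C
      gcongr
      linarith)
  refine ⟨h1, h2.trans (Eventually.of_forall fun ω => ?_)⟩
  congr 2
  ext p
  rw [limitAmplitude, ← integral_mul_wave, ← integral_const_mul, ← integral_const_mul]
  congr 1
  ext x
  rw [limitAmplitude, potentialSymbol]
  ring

end IsLimitPotential

/-- The Schwartz function `g - g''`. -/
def helmholtz : 𝓢(ℝ, ℂ) →L[ℂ] 𝓢(ℝ, ℂ) :=
  ContinuousLinearMap.id ℂ 𝓢(ℝ, ℂ) - (SchwartzMap.derivCLM ℂ ℂ) ∘L (SchwartzMap.derivCLM ℂ ℂ)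

lemma fourierInv_deriv (g : 𝓢(ℝ, ℂ)) (ξ : ℝ) :
    𝓕⁻ (SchwartzMap.derivCLM ℂ ℂ g : ℝ → ℂ) ξ
      = -(2 * Real.pi * Complex.I * ξ) * 𝓕⁻ (g : ℝ → ℂ) ξ := by
  have e : (SchwartzMap.derivCLM ℂ ℂ g : ℝ → ℂ) = deriv g :=
    funext fun x => SchwartzMap.derivCLM_apply ℂ g x
  have h := congrFun (Real.fourier_deriv (f := g) g.integrable g.differentiable
    (by rw [← e]; exact (SchwartzMap.derivCLM ℂ ℂ g).integrable)) (-ξ)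
  rw [e, Real.fourierInv_eq_fourier_neg, Real.fourierInv_eq_fourier_neg, h, smul_eq_mul]
  push_cast
  ring

/-- Applying 1 - ∂_x² to the test function undoes the resolvent in the amplitude of V, so that the
limit paired with g has multiplier 𝓕⁻g. -/
lemma fourierInv_helmholtz (g : 𝓢(ℝ, ℂ)) (ξ : ℝ) :
    (resolventSymbol ξ : ℂ) * 𝓕⁻ (helmholtz g : ℝ → ℂ) ξ = 𝓕⁻ (g : ℝ → ℂ) ξ := by
  have e : (helmholtz g : ℝ → ℂ) = fun x => g x
      - SchwartzMap.derivCLM ℂ ℂ (SchwartzMap.derivCLM ℂ ℂ g) x := rfl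
  rw [e, fourierInv_eq_integral]
  simp only [mul_sub]
  rw [integral_sub (integrable_exp_mul g.integrable ξ) (integrable_exp_mul
    (SchwartzMap.derivCLM ℂ ℂ (SchwartzMap.derivCLM ℂ ℂ g)).integrable ξ), ← fourierInv_eq_integral,
    ← fourierInv_eq_integral, fourierInv_deriv, fourierInv_deriv, resolventSymbol]
  have h : (1 + (2 * (Real.pi : ℂ) * ξ) ^ 2) ≠ 0 := by
    have : (0 : ℝ) < 1 + (2 * Real.pi * ξ) ^ 2 := by positivity
    exact_mod_cast this.ne'
  push_cast
  rw [inv_mul_eq_iff_eq_mul₀ h]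
  linear_combination (-(2 * (Real.pi : ℂ) * ξ) ^ 2 * 𝓕⁻ (g : ℝ → ℂ) ξ) * Complex.I_sq

lemma norm_le_seminorm_mul (f : 𝓢(ℝ, ℂ)) (x : ℝ) :
    ‖f x‖ ≤ (4 * (Finset.Iic (2, 0)).sup (schwartzSeminormFamily ℂ ℝ ℂ) f) * (1 + x ^ 2)⁻¹ := by
  have h := SchwartzMap.one_add_le_sup_seminorm_apply (𝕜 := ℂ) (m := (2, 0)) (k := 2)
    (n := 0) le_rfl le_rfl f x
  rw [norm_iteratedFDeriv_zero, Real.norm_eq_abs] at h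
  rw [← div_eq_mul_inv, le_div_iff₀ (by positivity)]
  calc ‖f x‖ * (1 + x ^ 2) ≤ ‖f x‖ * (1 + |x|) ^ 2 := by
        gcongr
        nlinarith [abs_nonneg x, sq_abs x]
    _ = (1 + |x|) ^ 2 * ‖f x‖ := by ring
    _ ≤ 2 ^ 2 * _ := h
    _ = _ := by norm_num; rfl

lemma integrable_mul_schwartz {v : ℝ → ℝ} (hv : Continuous v)
    (hi : Integrable fun x => v x * (1 + x ^ 2)⁻¹) (f : 𝓢(ℝ, ℂ)) :
    Integrable fun x => (v x : ℂ) * f x := by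
  obtain ⟨C, -, hC⟩ := exists_schwartz_le f
  have hf := f.continuous
  refine (hi.norm.const_mul C).mono' (Continuous.aestronglyMeasurable (by fun_prop))
    (Eventually.of_forall fun x => ?_)
  rw [norm_mul, Complex.norm_real, norm_mul, Real.norm_of_nonneg (inv_one_add_sq_pos x).le]
  calc _ ≤ ‖v x‖ * (C * (1 + x ^ 2)⁻¹) := by gcongr; exact hC x
    _ = _ := by ring

/-- Integration against a continuous function as a functional on Schwartz functions. -/
def integralFunctional (v : ℝ → ℝ) (hv : Continuous v)
    (hi : Integrable fun x => v x * (1 + x ^ 2)⁻¹) : 𝓢(ℝ, ℂ) →L[ℂ] ℂ :=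
  SchwartzMap.mkCLMtoNormedSpace (fun f => ∫ x, (v x : ℂ) * f x)
    (fun f g => by
      rw [← integral_add (integrable_mul_schwartz hv hi f) (integrable_mul_schwartz hv hi g)]
      simp only [_root_.add_apply, mul_add])
    (fun a f => by
      rw [RingHom.id_apply, ← integral_smul]
      simp only [_root_.smul_apply, smul_eq_mul, mul_left_comm])
    ⟨Finset.Iic (2, 0), 4 * ∫ x, ‖v x * (1 + x ^ 2)⁻¹‖, by positivity, fun f => by
      set S := (Finset.Iic (2, 0)).sup (schwartzSeminormFamily ℂ ℝ ℂ) f with hS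
      calc _ ≤ ∫ x, (4 * S) * ‖v x * (1 + x ^ 2)⁻¹‖ := by
            refine norm_integral_le_of_norm_le (hi.norm.const_mul _) (Eventually.of_forall fun x => ?_)
            rw [norm_mul, Complex.norm_real, norm_mul,
              Real.norm_of_nonneg (inv_one_add_sq_pos x).le]
            calc _ ≤ ‖v x‖ * (4 * S * (1 + x ^ 2)⁻¹) := by
                  gcongr
                  exact norm_le_seminorm_mul f x
              _ = _ := by ring
        _ = _ := by rw [integral_const_mul]; ring⟩

open Classical in
/-- The tempered distribution `(1 - ∂_x²) v`, for `v` of moderate growth. -/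
def potentialDistribution (v : ℝ → ℝ) : 𝓢'(ℝ, ℂ) :=
  if h : Continuous v ∧ Integrable fun x => v x * (1 + x ^ 2)⁻¹ then
    ContinuousLinearMap.toPointwiseConvergenceCLM _ _ _ _
      ((integralFunctional v h.1 h.2) ∘L helmholtz)
  -- For the random potential this branch is taken only on a null set, by `ae_integrable`.
  else 0

lemma potentialDistribution_apply {v : ℝ → ℝ} (hv : Continuous v)
    (hi : Integrable fun x => v x * (1 + x ^ 2)⁻¹) (g : 𝓢(ℝ, ℂ)) :
    potentialDistribution v g = ∫ x, (v x : ℂ) * helmholtz g x := by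
  rw [potentialDistribution, dif_pos ⟨hv, hi⟩]
  rfl

namespace IsLimitPotential

variable {V : ℝ → Ω → ℝ} [IsProbabilityMeasure P]

lemma ae_integrable (hV : IsLimitPotential P W φ c V) (hW : IsWhiteNoise P W) (hc : 0 < c)
    (hφ : ∫ x, φ x = 0) : ∀ᵐ ω ∂P, Integrable fun x => V x ω * (1 + x ^ 2)⁻¹ := by
  have h := (hV.integral_mul_eq hW hc hφ (g := fun x => (((1 + x ^ 2)⁻¹ : ℝ) : ℂ)) (C := 1)
    (by fun_prop) fun x => by
      rw [one_mul, Complex.norm_real, Real.norm_of_nonneg (inv_one_add_sq_pos x).le]).1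
  filter_upwards [h] with ω hω
  simp only [← Complex.ofReal_mul] at hω
  exact hω.re

lemma distribution_eq (hV : IsLimitPotential P W φ c V) (hW : IsWhiteNoise P W) (hc : 0 < c)
    (hφ : ∫ x, φ x = 0) (g : 𝓢(ℝ, ℂ)) :
    (fun ω => potentialDistribution (fun x => V x ω) g) =ᵐ[P]
      spectralNoise W (limitAmplitude φ c (𝓕⁻ (g : ℝ → ℂ))) := by
  obtain ⟨C, -, hC⟩ := exists_schwartz_le (helmholtz g)
  have h := (hV.integral_mul_eq hW hc hφ (helmholtz g).continuous.measurable hC).2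
  simp only [fourierInv_helmholtz] at h
  filter_upwards [h, hV.ae_integrable hW hc hφ] with ω h1 h2
  rw [potentialDistribution_apply (hV.continuous ω) h2, h1]

/-- The potential is real and 1 - ∂_x² commutes with conjugation. The exceptional event is only the
failure of integrability of V, so it does not depend on g. -/
lemma distribution_conj (hV : IsLimitPotential P W φ c V) (hW : IsWhiteNoise P W) (hc : 0 < c)
    (hφ : ∫ x, φ x = 0) :
    ∀ᵐ ω ∂P, ∀ g h : 𝓢(ℝ, ℂ), (∀ x, h x = starRingEnd ℂ (g x)) →
      potentialDistribution (fun x => V x ω) h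
        = starRingEnd ℂ (potentialDistribution (fun x => V x ω) g) := by
  filter_upwards [hV.ae_integrable hW hc hφ] with ω hω g h hgh
  have hd : ∀ {g h : 𝓢(ℝ, ℂ)}, (∀ x, h x = starRingEnd ℂ (g x)) → ∀ x,
      SchwartzMap.derivCLM ℂ ℂ h x = starRingEnd ℂ (SchwartzMap.derivCLM ℂ ℂ g x) := by
    intro g h hgh x
    rw [SchwartzMap.derivCLM_apply, SchwartzMap.derivCLM_apply, show (h : ℝ → ℂ) = fun x => star (g x) from
      funext hgh, deriv.star]
    rfl
  rw [potentialDistribution_apply (hV.continuous ω) hω,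
    potentialDistribution_apply (hV.continuous ω) hω, ← integral_conj]
  congr 1
  ext x
  have e : ∀ f : 𝓢(ℝ, ℂ), helmholtz f x
      = f x - SchwartzMap.derivCLM ℂ ℂ (SchwartzMap.derivCLM ℂ ℂ f) x := fun f => rfl
  rw [e, e, hgh, hd (hd hgh), map_mul, map_sub, Complex.conj_ofReal]

end IsLimitPotential

end

section

/-! ### The limiting covariance -/

variable {φ : 𝓢(ℝ, ℝ)} {c : ℝ}

/-- The power spectrum of the forcing. -/
def powerSpectrum (φ : 𝓢(ℝ, ℝ)) (k : ℝ) : ℝ := ‖profileHat φ k‖ ^ 2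

lemma powerSpectrum_nonneg (k : ℝ) : 0 ≤ powerSpectrum φ k := sq_nonneg _

lemma powerSpectrum_neg (k : ℝ) : powerSpectrum φ (-k) = powerSpectrum φ k := by
  rw [powerSpectrum, powerSpectrum, ← conj_profileHat_neg φ k, RCLike.norm_conj]

lemma continuous_powerSpectrum : Continuous (powerSpectrum φ) :=
  (profileHat φ).continuous.norm.pow 2

lemma spectralTail_eq (r : ℝ) :
    spectralTail c φ r = (1 / c) * ∫ s in Ioi r, powerSpectrum φ s := by
  rw [spectralTail, ← profileHat_eq]
  rfl

lemma exists_powerSpectrum_le (φ : 𝓢(ℝ, ℝ)) (n : ℕ) :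
    ∃ C : ℝ, ∀ k, powerSpectrum φ k * (|k| ^ n * (1 + k ^ 2)) ≤ C * (1 + k ^ 2)⁻¹ := by
  obtain ⟨C, hC0, hC⟩ := exists_schwartz_decay (profileHat φ) (n + 2)
  obtain ⟨C', hC'0, hC'⟩ := exists_schwartz_le (profileHat φ)
  refine ⟨C' * C, fun k => ?_⟩
  have h1 : ‖profileHat φ k‖ ≤ C' := (hC' k).trans (mul_le_of_le_one_right hC'0.le
    (inv_le_one_of_one_le₀ (by nlinarith [sq_nonneg k])))
  have h2 : |k| ^ n * (1 + k ^ 2) ≤ (1 + |k|) ^ (n + 2) := by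
    rw [pow_add]
    have h3 : 1 + k ^ 2 ≤ (1 + |k|) ^ 2 := by nlinarith [abs_nonneg k, sq_abs k]
    have h4 : |k| ^ n ≤ (1 + |k|) ^ n := pow_le_pow_left₀ (abs_nonneg k) (by linarith) n
    exact mul_le_mul h4 h3 (by positivity) (by positivity)
  calc _ = ‖profileHat φ k‖ * (‖profileHat φ k‖ * (|k| ^ n * (1 + k ^ 2))) := by
        rw [powerSpectrum]; ring
    _ ≤ ‖profileHat φ k‖ * (‖profileHat φ k‖ * (1 + |k|) ^ (n + 2)) := by gcongr
    _ ≤ C' * (C * (1 + k ^ 2)⁻¹) :=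
        mul_le_mul h1 (hC k) (by positivity) hC'0.le
    _ = _ := by ring

lemma integrable_powerSpectrum_mul (φ : 𝓢(ℝ, ℝ)) (n : ℕ) :
    Integrable fun k => powerSpectrum φ k * (|k| ^ n * (1 + k ^ 2)) := by
  obtain ⟨C, hC⟩ := exists_powerSpectrum_le φ n
  have hc := continuous_powerSpectrum (φ := φ)
  refine (integrable_inv_one_add_sq.const_mul C).mono' (Continuous.aestronglyMeasurable
    (by fun_prop)) (Eventually.of_forall fun k => ?_)
  rw [Real.norm_of_nonneg (mul_nonneg (powerSpectrum_nonneg k) (by positivity))]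
  exact hC k

lemma integrable_powerSpectrum (φ : 𝓢(ℝ, ℝ)) : Integrable (powerSpectrum φ) := by
  refine (integrable_powerSpectrum_mul φ 0).mono' continuous_powerSpectrum.aestronglyMeasurable
    (Eventually.of_forall fun k => ?_)
  rw [Real.norm_of_nonneg (powerSpectrum_nonneg k), pow_zero, one_mul]
  exact le_mul_of_one_le_right (powerSpectrum_nonneg k) (by nlinarith [sq_nonneg k])

lemma spectralTail_nonneg (hc : 0 < c) (r : ℝ) : 0 ≤ spectralTail c φ r := by
  rw [spectralTail_eq]
  exact mul_nonneg (by positivity) (integral_nonneg fun _ => powerSpectrum_nonneg _)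

lemma antitone_spectralTail (hc : 0 < c) : Antitone (spectralTail c φ) := by
  intro r r' h
  rw [spectralTail_eq, spectralTail_eq]
  refine mul_le_mul_of_nonneg_left ?_ (by positivity)
  exact setIntegral_mono_set (integrable_powerSpectrum φ).integrableOn
    (Eventually.of_forall fun _ => powerSpectrum_nonneg _) (Ioi_subset_Ioi h).eventuallyLE

lemma measurable_spectralTail_abs (hc : 0 < c) : Measurable fun k => spectralTail c φ |k| :=
  (antitone_spectralTail hc).measurable.comp continuous_abs.measurable

/-- For s > |k| the weight |k|ⁿ(1 + k²) is at most |s|ⁿ(1 + s²), so it can be moved under the tail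
integral. -/
lemma exists_spectralTail_le (φ : 𝓢(ℝ, ℝ)) (hc : 0 < c) (n : ℕ) :
    ∃ D : ℝ, ∀ k, |k| ^ n * spectralTail c φ |k| ≤ D * (1 + k ^ 2)⁻¹ := by
  have hi := integrable_powerSpectrum_mul φ n
  refine ⟨(1 / c) * ∫ k, powerSpectrum φ k * (|k| ^ n * (1 + k ^ 2)), fun k => ?_⟩
  rw [← div_eq_mul_inv, le_div_iff₀ (by positivity), spectralTail_eq]
  have h : (∫ s in Ioi |k|, powerSpectrum φ s) * (|k| ^ n * (1 + k ^ 2))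
      ≤ ∫ k, powerSpectrum φ k * (|k| ^ n * (1 + k ^ 2)) := by
    rw [← integral_mul_const]
    refine le_trans (setIntegral_mono_on ((integrable_powerSpectrum φ).integrableOn.mul_const _)
      hi.integrableOn measurableSet_Ioi fun s hs => ?_) (setIntegral_le_integral hi
        (Eventually.of_forall fun s => mul_nonneg (powerSpectrum_nonneg s) (by positivity)))
    have hs : |k| < s := hs
    have hs' : |k| ≤ |s| := hs.le.trans (le_abs_self s)
    refine mul_le_mul_of_nonneg_left ?_ (powerSpectrum_nonneg s)
    rw [← sq_abs k, ← sq_abs s]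
    gcongr
  calc _ = (1 / c) * ((∫ s in Ioi |k|, powerSpectrum φ s) * (|k| ^ n * (1 + k ^ 2))) := by ring
    _ ≤ _ := mul_le_mul_of_nonneg_left h (by positivity)

lemma integrable_spectralTail (φ : 𝓢(ℝ, ℝ)) (hc : 0 < c) :
    Integrable fun k => spectralTail c φ |k| := by
  obtain ⟨D, hD⟩ := exists_spectralTail_le φ hc 0
  refine (integrable_inv_one_add_sq.const_mul D).mono'
    (measurable_spectralTail_abs hc).aestronglyMeasurable (Eventually.of_forall fun k => ?_)
  rw [Real.norm_of_nonneg (spectralTail_nonneg hc _)]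
  simpa using hD k

lemma correction_neg (z : ℝ) : correction c φ (-z) = correction c φ z := by
  unfold correction
  congr 1
  ext k
  rw [mul_neg, Real.cos_neg]

lemma ofReal_correction (φ : 𝓢(ℝ, ℝ)) (hc : 0 < c) (z : ℝ) :
    (correction c φ z : ℂ) = 𝓕⁻ (fun k => (spectralTail c φ |k| : ℂ)) z := by
  have hi := integrable_spectralTail φ hc
  have hcos : Integrable fun k => spectralTail c φ |k| * Real.cos (2 * Real.pi * k * z) := by
    refine hi.norm.mono' (hi.1.mul (Continuous.aestronglyMeasurable (by fun_prop)))
      (Eventually.of_forall fun k => ?_)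
    rw [norm_mul]
    exact mul_le_of_le_one_right (norm_nonneg _) (Real.abs_cos_le_one _)
  have hsin : Integrable fun k => spectralTail c φ |k| * Real.sin (2 * Real.pi * k * z) := by
    refine hi.norm.mono' (hi.1.mul (Continuous.aestronglyMeasurable (by fun_prop)))
      (Eventually.of_forall fun k => ?_)
    rw [norm_mul]
    exact mul_le_of_le_one_right (norm_nonneg _) (Real.abs_sin_le_one _)
  have hodd : ∫ k, spectralTail c φ |k| * Real.sin (2 * Real.pi * k * z) = 0 := by
    have h := integral_neg_eq_self (fun k => spectralTail c φ |k| * Real.sin (2 * Real.pi * k * z))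
      volume
    simp only [abs_neg, mul_neg, neg_mul, Real.sin_neg, integral_neg] at h
    linarith
  have e : ∀ k : ℝ, Complex.exp (((2 * Real.pi * k * z : ℝ) : ℂ) * Complex.I)
      * (spectralTail c φ |k| : ℂ) = ((spectralTail c φ |k| * Real.cos (2 * Real.pi * k * z) : ℝ) : ℂ)
        + Complex.I * ((spectralTail c φ |k| * Real.sin (2 * Real.pi * k * z) : ℝ) : ℂ) := by
    intro k
    rw [Complex.exp_mul_I, ← Complex.ofReal_cos, ← Complex.ofReal_sin]
    push_cast
    ring
  rw [fourierInv_eq_integral]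
  simp only [e]
  rw [integral_add hcos.ofReal (hsin.ofReal.const_mul _), integral_const_mul,
    integral_complex_ofReal, integral_complex_ofReal, hodd, correction]
  simp

/-- All moments of Ψ(|k|) are finite, so its Fourier transform can be differentiated indefinitely;
evenness makes 𝓕 and 𝓕⁻ interchangeable. -/
lemma contDiff_correction (φ : 𝓢(ℝ, ℝ)) (hc : 0 < c) :
    ContDiff ℝ (⊤ : ℕ∞) (correction c φ) := by
  have h : ContDiff ℝ (⊤ : ℕ∞) (𝓕 fun k => (spectralTail c φ |k| : ℂ)) := by
    refine Real.contDiff_fourier fun n _ => ?_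
    obtain ⟨D, hD⟩ := exists_spectralTail_le φ hc n
    refine (integrable_inv_one_add_sq.const_mul D).mono' ?_ (Eventually.of_forall fun k => ?_)
    · have := measurable_spectralTail_abs (φ := φ) hc
      exact Measurable.aestronglyMeasurable (by fun_prop)
    · rw [Complex.norm_real, Real.norm_of_nonneg (spectralTail_nonneg hc _), Real.norm_eq_abs k,
        Real.norm_of_nonneg (mul_nonneg (by positivity) (spectralTail_nonneg hc _))]
      exact hD k
  have e : correction c φ = fun z => Complex.reCLM (𝓕 (fun k => (spectralTail c φ |k| : ℂ)) z) := by
    ext z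
    rw [← correction_neg, ← Complex.ofReal_re (correction c φ (-z)), ofReal_correction φ hc,
      Real.fourierInv_eq_fourier_neg, neg_neg]
    rfl
  rw [e]
  exact Complex.reCLM.contDiff.comp h

lemma forcingCorrelation_zero (hφ : ∀ x, φ (-x) = φ x) :
    forcingCorrelation φ 0 = ∫ x, φ x ^ 2 := by
  unfold forcingCorrelation
  congr 1
  ext x
  rw [zero_sub, hφ, sq]

lemma integral_powerSpectrum (φ : 𝓢(ℝ, ℝ)) : ∫ k, powerSpectrum φ k = ∫ x, φ x ^ 2 := by
  have h := integral_fourier_mul_conj (f := toComplex φ) (g := toComplex φ) (toComplex φ).integrable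
    ((toComplex φ).memLp 2) (toComplex φ).integrable ((toComplex φ).memLp 2)
  have e : 𝓕 (toComplex φ : ℝ → ℂ) = profileHat φ := (profileHat_eq φ).symm
  rw [e] at h
  simp only [Complex.mul_conj, Complex.normSq_eq_norm_sq, toComplex_apply, Complex.norm_real,
    Real.norm_eq_abs, sq_abs] at h
  rw [integral_complex_ofReal, integral_complex_ofReal, Complex.ofReal_inj] at h
  exact h

/-- The power spectrum is even, so the half-line carries half of the Parseval integral, whence the 2
in C_f(0)/(2c). -/
lemma spectralTail_zero (φ : 𝓢(ℝ, ℝ)) (hφ : ∀ x, φ (-x) = φ x) :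
    spectralTail c φ 0 = forcingCorrelation φ 0 / (2 * c) := by
  have h := integral_Ioi_add_integral_Ioi_neg (integrable_powerSpectrum φ)
  simp only [powerSpectrum_neg] at h
  rw [forcingCorrelation_zero hφ, ← integral_powerSpectrum, ← h, spectralTail_eq]
  field_simp
  ring

lemma integral_sq_pos (hφ : φ ≠ 0) : 0 < ∫ x, φ x ^ 2 := by
  obtain ⟨x, hx⟩ : ∃ x, φ x ≠ 0 := by
    by_contra! h
    exact hφ (SchwartzMap.ext h)
  exact integral_pos_of_integrable_nonneg_nonzero (μ := volume) (φ.continuous.pow 2)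
    (φ.memLp 2).integrable_sq (fun _ => sq_nonneg _) (pow_ne_zero 2 hx)

end

section

/-! ### The limiting covariance as a frequency integral -/

variable {φ : 𝓢(ℝ, ℝ)} {c : ℝ}

/-! ### Integrating the transported power spectrum over time -/

section transport

variable {K : ℝ} {m : ℝ → ℂ}

lemma integrable_of_le_inv_one_add_sq (hmm : Measurable m) (hm : ∀ ξ, ‖m ξ‖ ≤ K * (1 + ξ ^ 2)⁻¹) :
    Integrable m :=
  (integrable_inv_one_add_sq.const_mul K).mono' hmm.aestronglyMeasurable (Eventually.of_forall hm)

lemma integrable_powerSpectrum_mul_freq (hmm : Measurable m)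
    (hm : ∀ ξ, ‖m ξ‖ ≤ K * (1 + ξ ^ 2)⁻¹) (s : ℝ) :
    Integrable fun k => (powerSpectrum φ k : ℂ) * m (freq c s k) := by
  refine (((integrable_powerSpectrum φ).ofReal (𝕜 := ℂ)).bdd_mul (c := K)
    ((hmm.comp ((measurable_freq c).comp measurable_prodMk_left)).aestronglyMeasurable
      (f := fun k => m (freq c s k))) (Eventually.of_forall fun k => ?_)).congr
    (Eventually.of_forall fun k => mul_comm _ _)
  have hK : 0 ≤ K := by simpa using (norm_nonneg _).trans (hm 0)
  exact (hm _).trans (mul_le_of_le_one_right hK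
    (inv_le_one_of_one_le₀ (by nlinarith [sq_nonneg (freq c s k)])))

/-- Evenness of the power spectrum folds the integral onto k > 0, where transport is translation by
cs; the new variable is ξ = k + cs. The indicators replace the domain by the whole line so that the
translation leaves it unchanged. -/
lemma integral_powerSpectrum_mul_freq (hc : 0 < c) (hmm : Measurable m)
    (hm : ∀ ξ, ‖m ξ‖ ≤ K * (1 + ξ ^ 2)⁻¹) {s : ℝ} (hs : 0 < s) :
    ∫ k, (powerSpectrum φ k : ℂ) * m (freq c s k)
      = ∫ ξ, (Ioi 0).indicator (fun k => (powerSpectrum φ k : ℂ)) (ξ - c * s)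
          * (Ioi 0).indicator (fun ξ => m ξ + m (-ξ)) ξ := by
  have hi := integrable_powerSpectrum_mul_freq (φ := φ) (c := c) hmm hm s
  have hcs : 0 < c * s := mul_pos hc hs
  rw [← integral_Ioi_add_integral_Ioi_neg hi, ← integral_add hi.integrableOn hi.comp_neg.integrableOn,
    ← integral_indicator measurableSet_Ioi, ← integral_add_right_eq_self (fun ξ =>
      (Ioi 0).indicator (fun k => (powerSpectrum φ k : ℂ)) (ξ - c * s)
        * (Ioi 0).indicator (fun ξ => m ξ + m (-ξ)) ξ) (c * s)]
  congr 1
  ext k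
  simp only [add_sub_cancel_right]
  by_cases hk : 0 < k
  · have h2 : 0 < k + c * s := by positivity
    rw [indicator_of_mem (mem_Ioi.2 hk), indicator_of_mem (mem_Ioi.2 hk),
      indicator_of_mem (mem_Ioi.2 h2), powerSpectrum_neg, freq_neg, freq, Real.sign_of_pos hk,
      mul_one, mul_add]
  · rw [indicator_of_notMem (by simpa using hk), indicator_of_notMem (by simpa using hk), zero_mul]

/-- Frequency ξ > 0 is reached exactly from the initial frequencies k = ξ - cs in (0, ξ), and ds =
dk/c. The accumulated spectrum is the difference of two tails. -/
lemma integral_Ioi_powerSpectrum_sub (hc : 0 < c) {ξ : ℝ} (hξ : 0 < ξ) :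
    ∫ s in Ioi (0 : ℝ), (Ioi 0).indicator (fun k => (powerSpectrum φ k : ℂ)) (ξ - c * s)
      = ((spectralTail c φ 0 - spectralTail c φ ξ : ℝ) : ℂ) := by
  have h1 := integral_comp_mul_left_Ioi
    (fun r => (Ioi 0).indicator (fun k => (powerSpectrum φ k : ℂ)) (ξ - r)) 0 hc
  rw [mul_zero] at h1
  have h2 : ∫ r in Ioi (0 : ℝ), (Ioi 0).indicator (fun k => (powerSpectrum φ k : ℂ)) (ξ - r)
      = ∫ k in Ioo 0 ξ, (powerSpectrum φ k : ℂ) := by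
    rw [← integral_indicator measurableSet_Ioi, ← integral_indicator measurableSet_Ioo,
      ← integral_sub_left_eq_self _ volume ξ]
    congr 1
    ext r
    simp only [indicator, mem_Ioi, mem_Ioo, sub_pos, sub_sub_cancel]
    split_ifs <;> tauto
  have h3 : ∫ k in Ioo 0 ξ, powerSpectrum φ k
      = (∫ k in Ioi 0, powerSpectrum φ k) - ∫ k in Ioi ξ, powerSpectrum φ k := by
    have hi := integrable_powerSpectrum φ
    rw [← integral_Ioc_eq_integral_Ioo, ← Ioc_union_Ioi_eq_Ioi hξ.le, setIntegral_union
      (Ioc_disjoint_Ioi le_rfl) measurableSet_Ioi hi.integrableOn hi.integrableOn,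
      add_sub_cancel_right]
  rw [h1, h2, integral_complex_ofReal, h3, spectralTail_eq, spectralTail_eq, Complex.real_smul]
  push_cast
  rw [one_div]
  ring

/-- The heart of the covariance formula: pass to the arrival frequency ξ, exchange integrals, and
sum over all times at fixed ξ. Unfolding ξ > 0 restores the multiplier on the whole line. -/
lemma integral_Ioi_integral_powerSpectrum (hc : 0 < c) (hmm : Measurable m)
    (hm : ∀ ξ, ‖m ξ‖ ≤ K * (1 + ξ ^ 2)⁻¹) :
    ∫ s in Ioi (0 : ℝ), ∫ k, (powerSpectrum φ k : ℂ) * m (freq c s k)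
      = ∫ ξ, ((spectralTail c φ 0 - spectralTail c φ |ξ| : ℝ) : ℂ) * m ξ := by
  have hmi := integrable_of_le_inv_one_add_sq hmm hm
  have hρ : Integrable ((Ioi 0).indicator fun k => (powerSpectrum φ k : ℂ)) :=
    ((integrable_powerSpectrum φ).ofReal (𝕜 := ℂ)).indicator measurableSet_Ioi
  have hM : Integrable ((Ioi 0).indicator fun ξ => m ξ + m (-ξ)) :=
    (integrable_fun_add hmi hmi.comp_neg).indicator measurableSet_Ioi
  have hprod : Integrable (fun p : ℝ × ℝ =>
      (Ioi 0).indicator (fun k => (powerSpectrum φ k : ℂ)) (p.2 - c * p.1)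
        * (Ioi 0).indicator (fun ξ => m ξ + m (-ξ)) p.2)
      ((volume.restrict (Ioi 0)).prod volume) := by
    -- Integrability is checked with s innermost. As the power spectrum is nonnegative, the integral
    -- of the norm is given by the same difference of tails, which is at most Ψ(0).
    refine (integrable_prod_iff' ?_).2 ⟨Eventually.of_forall fun ξ => ?_, ?_⟩
    · refine Measurable.aestronglyMeasurable ?_
      have h1 : Measurable ((Ioi 0).indicator fun k => (powerSpectrum φ k : ℂ)) :=
        (Complex.measurable_ofReal.comp continuous_powerSpectrum.measurable).indicator
          measurableSet_Ioi
      have h2 : Measurable ((Ioi 0).indicator fun ξ => m ξ + m (-ξ)) :=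
        (hmm.add (hmm.comp measurable_neg)).indicator measurableSet_Ioi
      exact (h1.comp (by fun_prop : Measurable fun p : ℝ × ℝ => p.2 - c * p.1)).mul
        (h2.comp measurable_snd)
    · exact (((hρ.comp_sub_left ξ).comp_mul_left' hc.ne').mul_const
        ((Ioi 0).indicator (fun ξ => m ξ + m (-ξ)) ξ)).restrict
    · simp only [norm_mul]
      have e : ∀ ξ, ∫ s in Ioi (0 : ℝ),
          ‖(Ioi 0).indicator (fun k => (powerSpectrum φ k : ℂ)) (ξ - c * s)‖
            * ‖(Ioi 0).indicator (fun ξ => m ξ + m (-ξ)) ξ‖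
          = (spectralTail c φ 0 - spectralTail c φ |ξ|)
            * ‖(Ioi 0).indicator (fun ξ => m ξ + m (-ξ)) ξ‖ := by
        intro ξ
        by_cases hξ : 0 < ξ
        · rw [integral_mul_const, abs_of_pos hξ]
          congr 1
          have h := integral_Ioi_powerSpectrum_sub (φ := φ) hc hξ
          rw [← Complex.ofReal_inj, ← h, ← integral_complex_ofReal]
          congr 1
          ext s
          rw [norm_indicator_eq_indicator_norm]
          simp only [indicator]
          split_ifs
          · rw [Complex.norm_real, Real.norm_of_nonneg (powerSpectrum_nonneg _)]
          · simp
        · rw [indicator_of_notMem (by simpa using hξ)]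
          simp
      simp only [e]
      refine (hM.norm.bdd_mul (c := spectralTail c φ 0) (measurable_const.sub
        (measurable_spectralTail_abs hc)).aestronglyMeasurable (Eventually.of_forall fun ξ => ?_))
      have h1 := spectralTail_nonneg (φ := φ) hc |ξ|
      have h2 := antitone_spectralTail (φ := φ) hc (abs_nonneg ξ)
      rw [Real.norm_of_nonneg (by linarith)]
      linarith
  rw [setIntegral_congr_fun measurableSet_Ioi
    fun s hs => integral_powerSpectrum_mul_freq (φ := φ) hc hmm hm hs, integral_integral_swap hprod]
  have hi : Integrable fun ξ => ((spectralTail c φ 0 - spectralTail c φ |ξ| : ℝ) : ℂ) * m ξ := by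
    refine hmi.bdd_mul (c := spectralTail c φ 0) (Complex.measurable_ofReal.comp
      (measurable_const.sub (measurable_spectralTail_abs hc))).aestronglyMeasurable
      (Eventually.of_forall fun ξ => ?_)
    have h1 := spectralTail_nonneg (φ := φ) hc |ξ|
    have h2 := antitone_spectralTail (φ := φ) hc (abs_nonneg ξ)
    rw [Complex.norm_real, Real.norm_of_nonneg (by linarith)]
    linarith
  rw [← integral_Ioi_add_integral_Ioi_neg hi, ← integral_add hi.integrableOn hi.comp_neg.integrableOn,
    ← integral_indicator measurableSet_Ioi]
  congr 1
  ext ξ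
  rw [integral_mul_const]
  by_cases hξ : 0 < ξ
  · rw [indicator_of_mem (mem_Ioi.2 hξ), indicator_of_mem (mem_Ioi.2 hξ),
      integral_Ioi_powerSpectrum_sub hc hξ, abs_neg, abs_of_pos hξ, mul_add]
  · rw [indicator_of_notMem (by simpa using hξ), indicator_of_notMem (by simpa using hξ), mul_zero]

end transport

lemma fourierInv_schwartz_neg (g : 𝓢(ℝ, ℂ)) (ξ : ℝ) : 𝓕⁻ (g : ℝ → ℂ) (-ξ) = 𝓕 (g : ℝ → ℂ) ξ := by
  rw [Real.fourierInv_eq_fourier_neg, neg_neg]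

lemma exists_fourierInv_le (g : 𝓢(ℝ, ℂ)) :
    ∃ C > 0, ∀ ξ, ‖𝓕⁻ (g : ℝ → ℂ) ξ‖ ≤ C * (1 + ξ ^ 2)⁻¹ := by
  obtain ⟨C, hC0, hC⟩ := exists_schwartz_le (𝓕⁻ g)
  exact ⟨C, hC0, fun ξ => by simpa only [SchwartzMap.fourierInv_coe] using hC ξ⟩

lemma continuous_fourierInv_schwartz (g : 𝓢(ℝ, ℂ)) : Continuous (𝓕⁻ (g : ℝ → ℂ)) := by
  rw [← SchwartzMap.fourierInv_coe]
  exact (𝓕⁻ g).continuous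

/-- The product of the multipliers of two observables. -/
def pairSymbol (g₁ g₂ : 𝓢(ℝ, ℂ)) (ξ : ℝ) : ℂ := 𝓕⁻ (g₁ : ℝ → ℂ) ξ * 𝓕⁻ (g₂ : ℝ → ℂ) (-ξ)

lemma continuous_pairSymbol (g₁ g₂ : 𝓢(ℝ, ℂ)) : Continuous (pairSymbol g₁ g₂) :=
  (continuous_fourierInv_schwartz g₁).mul ((continuous_fourierInv_schwartz g₂).comp continuous_neg)

lemma exists_pairSymbol_le (g₁ g₂ : 𝓢(ℝ, ℂ)) :
    ∃ C, ∀ ξ, ‖pairSymbol g₁ g₂ ξ‖ ≤ C * (1 + ξ ^ 2)⁻¹ := by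
  obtain ⟨C, hC0, hC⟩ := exists_fourierInv_le g₁
  obtain ⟨D, hD0, hD⟩ := exists_fourierInv_le g₂
  refine ⟨C * D, fun ξ => ?_⟩
  have h1 : ‖𝓕⁻ (g₂ : ℝ → ℂ) (-ξ)‖ ≤ D := (hD _).trans (mul_le_of_le_one_right hD0.le
    (inv_le_one_of_one_le₀ (by nlinarith [sq_nonneg (-ξ)])))
  rw [pairSymbol, norm_mul]
  calc _ ≤ C * (1 + ξ ^ 2)⁻¹ * D := by gcongr; exact hC ξ
    _ = _ := by ring

lemma integrable_pairSymbol (g₁ g₂ : 𝓢(ℝ, ℂ)) : Integrable (pairSymbol g₁ g₂) := by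
  obtain ⟨C, hC⟩ := exists_pairSymbol_le g₁ g₂
  exact integrable_of_le_inv_one_add_sq (continuous_pairSymbol g₁ g₂).measurable hC

lemma integral_pairSymbol (g₁ g₂ : 𝓢(ℝ, ℂ)) : ∫ ξ, pairSymbol g₁ g₂ ξ = ∫ x, g₁ x * g₂ x := by
  simp only [pairSymbol, fourierInv_schwartz_neg]
  have h := integral_fourier_mul_eq g₂.integrable (𝓕⁻ g₁).integrable
  rw [← SchwartzMap.fourier_coe (𝓕⁻ g₁), FourierTransform.fourier_fourierInv_eq,
    SchwartzMap.fourierInv_coe] at h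
  simpa only [mul_comm] using h

/-- Opening both inverse transforms gives the phase e^{2πiξ(x-y)}, and the ξ-integral of Ψ(|ξ|)
against it is the correction at x - y. -/
lemma integral_spectralTail_mul_pairSymbol (hc : 0 < c) (g₁ g₂ : 𝓢(ℝ, ℂ)) :
    ∫ ξ, (spectralTail c φ |ξ| : ℂ) * pairSymbol g₁ g₂ ξ
      = ∫ p : ℝ × ℝ, (correction c φ (p.1 - p.2) : ℂ) * g₁ p.1 * g₂ p.2 := by
  set e : ℝ → ℝ → ℂ := fun x ξ => Complex.exp (((2 * Real.pi * x * ξ : ℝ) : ℂ) * Complex.I) with he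
  have hΨ : Integrable fun ξ => (spectralTail c φ |ξ| : ℂ) := (integrable_spectralTail φ hc).ofReal
  have hi : Integrable (fun q : ℝ × (ℝ × ℝ) => (spectralTail c φ |q.1| : ℂ)
      * ((e q.2.1 q.1 * g₁ q.2.1) * (e q.2.2 (-q.1) * g₂ q.2.2)))
      (volume.prod (volume.prod volume)) := by
    have h1 := hΨ.mul_prod (g₁.integrable.mul_prod g₂.integrable (μ := volume) (ν := volume))
    refine h1.mono ?_ (Eventually.of_forall fun q => ?_)
    · refine h1.aestronglyMeasurable.mul (f := fun q : ℝ × (ℝ × ℝ) => (spectralTail c φ |q.1| : ℂ)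
        * (g₁ q.2.1 * g₂ q.2.2)) (g := fun q => e q.2.1 q.1 * e q.2.2 (-q.1))
        (Continuous.aestronglyMeasurable (by fun_prop)) |>.congr (Eventually.of_forall fun q => ?_)
      simp only [Pi.mul_apply]
      ring
    · simp only [norm_mul, he, Complex.norm_exp_ofReal_mul_I, one_mul, le_refl]
  have h1 : ∀ ξ, (spectralTail c φ |ξ| : ℂ) * pairSymbol g₁ g₂ ξ
      = ∫ p : ℝ × ℝ, (spectralTail c φ |ξ| : ℂ)
        * ((e p.1 ξ * g₁ p.1) * (e p.2 (-ξ) * g₂ p.2)) := by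
    intro ξ
    rw [integral_const_mul, Measure.volume_eq_prod, integral_prod_mul (fun x => e x ξ * g₁ x)
      (fun x => e x (-ξ) * g₂ x), pairSymbol, fourierInv_eq_integral, fourierInv_eq_integral]
  simp only [h1]
  rw [integral_integral_swap hi]
  congr 1
  ext p
  rw [ofReal_correction φ hc, fourierInv_eq_integral, ← integral_mul_const, ← integral_mul_const]
  congr 1
  ext ξ
  have : Complex.exp (((2 * Real.pi * ξ * (p.1 - p.2) : ℝ) : ℂ) * Complex.I)
      = e p.1 ξ * e p.2 (-ξ) := by
    rw [he, ← Complex.exp_add]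
    congr 1
    push_cast
    ring
  rw [this]
  ring

theorem integral_Ioi_integral_pairSymbol (hc : 0 < c) (hφ : ∀ x, φ (-x) = φ x)
    (g₁ g₂ : 𝓢(ℝ, ℂ)) :
    ∫ s in Ioi (0 : ℝ), ∫ k, (powerSpectrum φ k : ℂ) * pairSymbol g₁ g₂ (freq c s k)
      = limitCovariance c φ g₁ g₂ := by
  obtain ⟨C, hC⟩ := exists_pairSymbol_le g₁ g₂
  rw [integral_Ioi_integral_powerSpectrum hc (continuous_pairSymbol g₁ g₂).measurable hC,
    limitCovariance, ← integral_spectralTail_mul_pairSymbol hc, ← integral_pairSymbol,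
    ← spectralTail_zero φ hφ, ← integral_const_mul, ← integral_sub]
  · congr 1
    ext ξ
    push_cast
    ring
  · exact (integrable_pairSymbol g₁ g₂).const_mul _
  · refine (integrable_pairSymbol g₁ g₂).bdd_mul (c := spectralTail c φ 0)
      (Complex.measurable_ofReal.comp (measurable_spectralTail_abs hc)).aestronglyMeasurable
      (Eventually.of_forall fun ξ => ?_)
    rw [Complex.norm_real, Real.norm_of_nonneg (spectralTail_nonneg hc _)]
    exact antitone_spectralTail hc (abs_nonneg ξ)

end

section

/-! ### Convergence to the limit -/

variable {Ω : Type*} [MeasurableSpace Ω] {P : Measure Ω} {W : (ℝ × ℝ → ℝ) → Ω → ℝ}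
  {φ : 𝓢(ℝ, ℝ)} {c : ℝ}

/-! #### Centred complex Gaussian variables -/

/-- With w = z̄X, (Re w)² = Re(w(w + w̄))/2. The law of a centred complex Gaussian thus requires
E[X²] in addition to E|X|². -/
lemma integral_inner_sq {X : Ω → ℂ} (hX : MemLp X 2 P) (z : ℂ) :
    ∫ ω, (inner ℝ z (X ω)) ^ 2 ∂P
      = (((z * starRingEnd ℂ z) * (∫ ω, X ω * starRingEnd ℂ (X ω) ∂P)
        + starRingEnd ℂ z ^ 2 * ∫ ω, X ω * X ω ∂P) / 2).re := by
  have h1 : Integrable (fun ω => X ω * starRingEnd ℂ (X ω)) P := hX.integrable_mul hX.star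
  have h2 : Integrable (fun ω => X ω * X ω) P := hX.integrable_mul hX
  have h3 : Integrable (fun ω => (z * starRingEnd ℂ z) * (X ω * starRingEnd ℂ (X ω))
      + starRingEnd ℂ z ^ 2 * (X ω * X ω)) P :=
    integrable_fun_add (h1.const_mul _) (h2.const_mul _)
  rw [← integral_const_mul, ← integral_const_mul, ← integral_add (h1.const_mul _) (h2.const_mul _),
    ← integral_div, ← RCLike.re_eq_complex_re, ← integral_re (h3.div_const 2)]
  congr 1
  ext ω
  rw [Complex.inner, RCLike.re_eq_complex_re]
  have e : (z * starRingEnd ℂ z) * (X ω * starRingEnd ℂ (X ω)) + starRingEnd ℂ z ^ 2 * (X ω * X ω)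
      = (starRingEnd ℂ z * X ω)
        * ((starRingEnd ℂ z * X ω) + starRingEnd ℂ (starRingEnd ℂ z * X ω)) := by
    rw [map_mul, Complex.conj_conj]
    ring
  rw [e, Complex.add_conj, mul_comm (starRingEnd ℂ z * X ω), mul_comm (starRingEnd ℂ z) (X ω),
    Complex.div_ofNat_re, Complex.re_ofReal_mul]
  ring

lemma charFun_map_of_centred [IsProbabilityMeasure P] {X : Ω → ℂ} (hX : HasGaussianLaw X P)
    (h0 : ∫ ω, X ω ∂P = 0) (z : ℂ) :
    charFun (P.map X) z = Complex.exp (-(((((z * starRingEnd ℂ z)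
      * (∫ ω, X ω * starRingEnd ℂ (X ω) ∂P)
        + starRingEnd ℂ z ^ 2 * ∫ ω, X ω * X ω ∂P) / 2).re : ℝ) : ℂ) / 2) := by
  have hm : ∫ ω, inner ℝ z (X ω) ∂P = 0 := by
    rw [integral_inner hX.integrable, h0, inner_zero_right]
  rw [hX.charFun_map_eq, variance_of_integral_eq_zero
    (hX.aemeasurable.const_inner) hm, hm, integral_inner_sq hX.memLp_two]
  congr 1
  push_cast
  ring

/-- Centred complex Gaussian variables converge in law if their covariances and
pseudo-covariances do. -/
lemma tendstoInDistribution_of_centred [IsProbabilityMeasure P] {X : ℝ≥0 → Ω → ℂ} {Z : Ω → ℂ}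
    (hX : ∀ t, HasGaussianLaw (X t) P) (hX0 : ∀ t, ∫ ω, X t ω ∂P = 0)
    (hZ : HasGaussianLaw Z P) (hZ0 : ∫ ω, Z ω ∂P = 0)
    (h1 : Tendsto (fun t => ∫ ω, X t ω * starRingEnd ℂ (X t ω) ∂P) atTop
      (𝓝 (∫ ω, Z ω * starRingEnd ℂ (Z ω) ∂P)))
    (h2 : Tendsto (fun t => ∫ ω, X t ω * X t ω ∂P) atTop (𝓝 (∫ ω, Z ω * Z ω ∂P))) :
    TendstoInDistribution X atTop Z (fun _ => P) P where
  forall_aemeasurable t := (hX t).aemeasurable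
  aemeasurable_limit := hZ.aemeasurable
  tendsto := by
    -- Lévy's continuity theorem is applied along an arbitrary sequence of times tending to
    -- infinity.
    refine tendsto_of_seq_tendsto fun t ht => ?_
    refine ProbabilityMeasure.tendsto_of_tendsto_charFun fun z => ?_
    change Tendsto (fun n => charFun (P.map (X (t n))) z) atTop (𝓝 (charFun (P.map Z) z))
    rw [charFun_map_of_centred hZ hZ0]
    simp only [charFun_map_of_centred (hX _) (hX0 _)]
    refine (Complex.continuous_exp.tendsto _).comp ?_
    refine Tendsto.div_const (Tendsto.neg ?_) 2
    refine (Complex.continuous_ofReal.tendsto _).comp ((Complex.continuous_re.tendsto _).comp ?_)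
    exact (((h1.comp ht).const_mul _).add ((h2.comp ht).const_mul _)).div_const 2

/-! #### Conjugate observables -/

/-- The complex conjugate of a Schwartz function. -/
def conjSchwartz (g : 𝓢(ℝ, ℂ)) : 𝓢(ℝ, ℂ) :=
  SchwartzMap.postcompCLM (𝕜 := ℝ) (Complex.conjCLE : ℂ →L[ℝ] ℂ) g

lemma conjSchwartz_apply (g : 𝓢(ℝ, ℂ)) (x : ℝ) : conjSchwartz g x = starRingEnd ℂ (g x) := rfl

lemma conj_fourierInv_conjSchwartz (g : 𝓢(ℝ, ℂ)) (ξ : ℝ) :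
    starRingEnd ℂ (𝓕⁻ (conjSchwartz g : ℝ → ℂ) ξ) = 𝓕⁻ (g : ℝ → ℂ) (-ξ) := by
  rw [fourierInv_eq_integral, fourierInv_eq_integral, ← integral_conj]
  congr 1
  ext x
  rw [map_mul, conjSchwartz_apply, Complex.conj_conj, ← Complex.exp_conj, map_mul,
    Complex.conj_I, Complex.conj_ofReal]
  congr 2
  push_cast
  ring

omit [MeasurableSpace Ω] in
lemma pairing_conjSchwartz (u : ℝ → ℝ → Ω → ℝ) (t : ℝ) (g : 𝓢(ℝ, ℂ)) (ω : Ω) :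
    pairing u t (conjSchwartz g) ω = starRingEnd ℂ (pairing u t g ω) := by
  rw [pairing, pairing, ← integral_conj]
  congr 1
  ext x
  rw [conjSchwartz_apply, map_mul, Complex.conj_ofReal]

/-! #### The covariances -/

lemma isAmplitude_limit_fourierInv (hc : 0 < c) (hφ : ∫ x, φ x = 0) (g : 𝓢(ℝ, ℂ)) :
    IsAmplitude (limitAmplitude φ c (𝓕⁻ (g : ℝ → ℂ))) := by
  obtain ⟨C, -, hC⟩ := exists_fourierInv_le g
  exact isAmplitude_limitAmplitude hc hφ (continuous_fourierInv_schwartz g).measurable hC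

/-- Replacing g₂ by its conjugate converts the sesquilinear isometry into the bilinear covariance,
at the cost of evaluating 𝓕⁻g₂ at the opposite frequency. -/
lemma limitAmplitude_mul_conj (g₁ g₂ : 𝓢(ℝ, ℂ)) (p : ℝ × ℝ) :
    limitAmplitude φ c (𝓕⁻ (g₁ : ℝ → ℂ)) p
        * starRingEnd ℂ (limitAmplitude φ c (𝓕⁻ (conjSchwartz g₂ : ℝ → ℂ)) p)
      = (powerSpectrum φ p.2 : ℂ) * pairSymbol g₁ g₂ (freq c p.1 p.2) := by
  rw [limitAmplitude, limitAmplitude, map_mul, conj_fourierInv_conjSchwartz, pairSymbol,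
    powerSpectrum, ← Complex.normSq_eq_norm_sq, ← Complex.mul_conj]
  ring

lemma integrable_powerSpectrum_mul_pairSymbol (hc : 0 < c) (hφ : ∫ x, φ x = 0)
    (g₁ g₂ : 𝓢(ℝ, ℂ)) :
    Integrable (fun p : ℝ × ℝ => (powerSpectrum φ p.2 : ℂ) * pairSymbol g₁ g₂ (freq c p.1 p.2))
      spaceTime := by
  simp only [← limitAmplitude_mul_conj]
  exact integrable_mul_conj (isAmplitude_limit_fourierInv hc hφ g₁).memLp
    (isAmplitude_limit_fourierInv hc hφ (conjSchwartz g₂)).memLp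

lemma IsLimitPotential.integral_distribution_mul [IsProbabilityMeasure P] {V : ℝ → Ω → ℝ}
    (hV : IsLimitPotential P W φ c V) (hW : IsWhiteNoise P W) (hc : 0 < c) (hφ : ∫ x, φ x = 0)
    (g₁ g₂ : 𝓢(ℝ, ℂ)) :
    ∫ ω, potentialDistribution (fun x => V x ω) g₁ * potentialDistribution (fun x => V x ω) g₂ ∂P
      = ∫ s in Ioi (0 : ℝ), ∫ k, (powerSpectrum φ k : ℂ) * pairSymbol g₁ g₂ (freq c s k) := by
  have h := hW.integral_spectralNoise_mul_conj (isAmplitude_limit_fourierInv hc hφ g₁)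
    (isAmplitude_limit_fourierInv hc hφ (conjSchwartz g₂))
  simp only [limitAmplitude_mul_conj] at h
  have hi := integrable_powerSpectrum_mul_pairSymbol hc hφ g₁ g₂
  unfold spaceTime at h hi
  rw [integral_prod _ hi] at h
  rw [← h]
  refine integral_congr_ae ?_
  filter_upwards [hV.distribution_eq hW hc hφ g₁, hV.distribution_eq hW hc hφ (conjSchwartz g₂),
    hV.distribution_conj hW hc hφ] with ω h1 h2 h3
  rw [← h1, ← h2, h3 g₂ _ (conjSchwartz_apply g₂), Complex.conj_conj]

/-- The substitution s ↦ t - s measures time since injection. The covariance at time t becomes the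
truncation to (0, t) of an integral that does not otherwise depend on t. -/
lemma IsSolutionField.integral_pairing_mul [IsProbabilityMeasure P] {U : ℕ → ℝ × ℝ → Ω → ℝ}
    (hU : IsSolutionField P W φ c U) (hW : IsWhiteNoise P W) (hc : 0 < c) {t : ℝ} (ht : 0 ≤ t)
    (g₁ g₂ : 𝓢(ℝ, ℂ)) :
    ∫ ω, pairing (fun t x => U 0 (t, x)) t g₁ ω * pairing (fun t x => U 0 (t, x)) t g₂ ω ∂P
      = ∫ s in (0 : ℝ)..t, ∫ k, (powerSpectrum φ k : ℂ) * pairSymbol g₁ g₂ (freq c s k) := by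
  obtain ⟨a1, e1⟩ := hU.pairing_eq hW hc.le t g₁
  obtain ⟨a2, e2⟩ := hU.pairing_eq hW hc.le t (conjSchwartz g₂)
  have h := hW.integral_spectralNoise_mul_conj a1 a2
  have hi := integrable_mul_conj a1.memLp a2.memLp
  unfold spaceTime at h hi
  have e : ∀ s, ∫ k, solutionAmplitude φ c t (𝓕⁻ (g₁ : ℝ → ℂ)) (s, k)
      * starRingEnd ℂ (solutionAmplitude φ c t (𝓕⁻ (conjSchwartz g₂ : ℝ → ℂ)) (s, k))
      = (Ioc 0 t).indicator (fun s => ∫ k, (powerSpectrum φ k : ℂ)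
        * pairSymbol g₁ g₂ (freq c (t - s) k)) s := by
    intro s
    by_cases hs : 0 < s ∧ s ≤ t
    · rw [indicator_of_mem (mem_Ioc.2 hs)]
      congr 1
      ext k
      rw [solutionAmplitude, solutionAmplitude, if_pos hs, if_pos hs]
      exact limitAmplitude_mul_conj g₁ g₂ (t - s, k)
    · rw [indicator_of_notMem (by simpa using hs)]
      simp only [solutionAmplitude, if_neg hs, zero_mul, integral_zero]
  rw [integral_prod _ hi] at h
  simp only [e] at h
  rw [setIntegral_indicator measurableSet_Ioc, inter_eq_right.2 (fun s hs => hs.1),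
    ← intervalIntegral.integral_of_le ht,
    intervalIntegral.integral_comp_sub_left (fun s => ∫ k, (powerSpectrum φ k : ℂ)
        * pairSymbol g₁ g₂ (freq c s k)), sub_self, sub_zero] at h
  rw [← h]
  refine integral_congr_ae ?_
  filter_upwards [e1, e2] with ω h1 h2
  rw [← h1, ← h2, pairing_conjSchwartz, Complex.conj_conj]

section limit

variable [IsProbabilityMeasure P] {U : ℕ → ℝ × ℝ → Ω → ℝ} {V : ℝ → Ω → ℝ}

/-- The covariances at time t and in the limit have the same absolutely integrable integrand; only
the upper limit of the time integral differs. -/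
lemma tendsto_integral_pairing_mul (hU : IsSolutionField P W φ c U)
    (hV : IsLimitPotential P W φ c V) (hW : IsWhiteNoise P W) (hc : 0 < c) (hφ : ∫ x, φ x = 0)
    (g₁ g₂ : 𝓢(ℝ, ℂ)) :
    Tendsto (fun t : ℝ => ∫ ω, pairing (fun t x => U 0 (t, x)) t g₁ ω
        * pairing (fun t x => U 0 (t, x)) t g₂ ω ∂P) atTop
      (𝓝 (∫ ω, potentialDistribution (fun x => V x ω) g₁
        * potentialDistribution (fun x => V x ω) g₂ ∂P)) := by
  rw [hV.integral_distribution_mul hW hc hφ]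
  have hi := integrable_powerSpectrum_mul_pairSymbol hc hφ g₁ g₂
  unfold spaceTime at hi
  refine (intervalIntegral_tendsto_integral_Ioi 0 hi.integral_prod_left tendsto_id).congr' ?_
  filter_upwards [eventually_ge_atTop 0] with t ht
  exact (hU.integral_pairing_mul hW hc ht g₁ g₂).symm

lemma isGaussianRandomMeasure_distribution (hV : IsLimitPotential P W φ c V)
    (hW : IsWhiteNoise P W) (hc : 0 < c) (hφ : ∫ x, φ x = 0) :
    IsGaussianRandomMeasure P fun ω => potentialDistribution fun x => V x ω where
  gaussian g := (hW.hasGaussianLaw_spectralNoise (isAmplitude_limit_fourierInv hc hφ g)).congr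
    (hV.distribution_eq hW hc hφ g).symm
  mean_zero g := (integral_congr_ae (hV.distribution_eq hW hc hφ g)).trans
    (hW.integral_spectralNoise (isAmplitude_limit_fourierInv hc hφ g))

theorem tendstoInDistribution_pairing (hU : IsSolutionField P W φ c U)
    (hV : IsLimitPotential P W φ c V) (hW : IsWhiteNoise P W) (hc : 0 < c) (hφ : ∫ x, φ x = 0)
    (g : 𝓢(ℝ, ℂ)) :
    TendstoInDistribution (fun t : ℝ≥0 => pairing (fun t x => U 0 (t, x)) t g) atTop
      (fun ω => potentialDistribution (fun x => V x ω) g) (fun _ => P) P := by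
  have hG := isGaussianRandomMeasure_distribution hV hW hc hφ
  have hcoe : Tendsto (fun t : ℝ≥0 => (t : ℝ)) atTop atTop := NNReal.tendsto_coe_atTop.2 tendsto_id
  refine tendstoInDistribution_of_centred (fun t => ?_) (fun t => ?_) (hG.gaussian g)
    (hG.mean_zero g) ?_ ?_
  · obtain ⟨a, e⟩ := hU.pairing_eq hW hc.le t g
    exact (hW.hasGaussianLaw_spectralNoise a).congr e.symm
  · obtain ⟨a, e⟩ := hU.pairing_eq hW hc.le t g
    exact (integral_congr_ae e).trans (hW.integral_spectralNoise a)
  -- Pairing with the conjugate test function yields the conjugate variable, so the bilinear limit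
  -- also gives the Hermitian second moment.
  · have h := (tendsto_integral_pairing_mul hU hV hW hc hφ g (conjSchwartz g)).comp hcoe
    simp only [Function.comp_def, pairing_conjSchwartz] at h
    convert h using 2
    refine integral_congr_ae ?_
    filter_upwards [hV.distribution_conj hW hc hφ] with ω hω
    rw [hω g _ (conjSchwartz_apply g)]
  · exact (tendsto_integral_pairing_mul hU hV hW hc hφ g g).comp hcoe

end limit

end

end DynWhiteNoise

end

/-! ### The main theorem -/

theorem mainTheorem4 {Ω : Type*} [MeasurableSpace Ω] (P : Measure Ω) [IsProbabilityMeasure P]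
    (W : (ℝ × ℝ → ℝ) → Ω → ℝ) (hW : DynWhiteNoise.IsWhiteNoise P W)
    (c : ℝ) (hc : 0 < c)
    (φ : 𝓢(ℝ, ℝ)) (hφ_ne : φ ≠ 0) (hφ_even : ∀ x, φ (-x) = φ x) (hφ_mean : ∫ x, φ x = 0) :
    -- the constant and the correction in the limiting covariance
    0 < DynWhiteNoise.forcingCorrelation φ 0 / (2 * c) ∧
    DynWhiteNoise.forcingCorrelation φ 0 = ∫ x, φ x ^ 2 ∧
    Continuous (DynWhiteNoise.correction c φ) ∧
    ContDiff ℝ (⊤ : ℕ∞) (DynWhiteNoise.correction c φ) ∧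
    (∀ z, DynWhiteNoise.correction c φ (-z) = DynWhiteNoise.correction c φ z) ∧
    ∃ u : ℝ → ℝ → Ω → ℝ,
      -- (i) `u` is a global solution, Gaussian, smooth in `x` and Hölder continuous in `t`
      DynWhiteNoise.IsWeakSolution P W c φ u ∧
      IsGaussianProcess (fun p : ℝ≥0 × ℝ => u p.1 p.2) P ∧
      (∀ᵐ ω ∂P, ∀ t, 0 ≤ t → ContDiff ℝ (⊤ : ℕ∞) (fun x => u t x ω)) ∧
      (∀ᵐ ω ∂P, ∀ x, ∀ α : ℝ≥0, 0 < α → α < 1 / 2 → ∀ T : ℝ,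
        ∃ K : ℝ≥0, HolderOnWith K α (fun t => u t x ω) (Icc 0 T)) ∧
      (∀ t, 0 ≤ t → ∀ g : 𝓢(ℝ, ℂ), MemLp (DynWhiteNoise.pairing u t g) 2 P) ∧
      ∃ uInf : Ω → 𝓢'(ℝ, ℂ),
        -- (ii) `u(t)` converges in law, tested against Schwartz functions, to a real centred
        -- Gaussian random measure
        DynWhiteNoise.IsGaussianRandomMeasure P uInf ∧
        (∀ᵐ ω ∂P, ∀ g h : 𝓢(ℝ, ℂ), (∀ x, h x = starRingEnd ℂ (g x)) →
          uInf ω h = starRingEnd ℂ (uInf ω g)) ∧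
        (∀ g : 𝓢(ℝ, ℂ),
          TendstoInDistribution (fun t : ℝ≥0 => DynWhiteNoise.pairing u t g) atTop
            (fun ω => uInf ω g) (fun _ => P) P) ∧
        -- (iii) the covariance of the limit
        ∀ g₁ g₂ : 𝓢(ℝ, ℂ),
          Tendsto (fun t : ℝ => ∫ ω, DynWhiteNoise.pairing u t g₁ ω * DynWhiteNoise.pairing u t g₂ ω ∂P)
            atTop (𝓝 (∫ ω, uInf ω g₁ * uInf ω g₂ ∂P)) ∧
          ∫ ω, uInf ω g₁ * uInf ω g₂ ∂P = DynWhiteNoise.limitCovariance c φ g₁ g₂ := by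
  have h0 := DynWhiteNoise.forcingCorrelation_zero (φ := φ) hφ_even
  obtain ⟨U, hU⟩ := hW.exists_isSolutionField φ hc.le
  obtain ⟨V, hV⟩ := hW.exists_isLimitPotential hc hφ_mean
  refine ⟨?_, h0, (DynWhiteNoise.contDiff_correction φ hc).continuous,
    DynWhiteNoise.contDiff_correction φ hc, DynWhiteNoise.correction_neg,
    fun t x => U 0 (t, x), ?_, hU.isGaussianProcess hW hc.le, ?_, ?_,
    fun t _ g => hU.memLp_pairing hW hc.le t g,
    fun ω => DynWhiteNoise.potentialDistribution fun x => V x ω,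
    DynWhiteNoise.isGaussianRandomMeasure_distribution hV hW hc hφ_mean,
    hV.distribution_conj hW hc hφ_mean,
    DynWhiteNoise.tendstoInDistribution_pairing hU hV hW hc hφ_mean, fun g₁ g₂ =>
    ⟨DynWhiteNoise.tendsto_integral_pairing_mul hU hV hW hc hφ_mean g₁ g₂, ?_⟩⟩
  · rw [h0]
    have := DynWhiteNoise.integral_sq_pos hφ_ne
    positivity
  · exact {
      locallyIntegrable := Eventually.of_forall fun ω => hU.locallyIntegrableOn ω _
      integrable := fun t _ => hU.ae_integrable_mul_schwartz hW hc.le t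
      integrable_backward := fun g hg t ht => (hU.weak hW hc.le hg ht).mono fun ω h => h.1
      initial := hU.ae_initial hW
      weak := fun g hg t ht => (hU.weak hW hc.le hg ht).mono fun ω h => h.2
      zero_mean := fun t _ χ => hU.tendsto_eLpNorm_integral_dilation hW hc.le hφ_mean t χ }
  · exact (hU.ae_contDiff hW hc.le).mono fun ω h t _ => h 0 t
  · exact Eventually.of_forall fun ω x α _ hα T => hU.exists_holderOnWith ω x hα T
  · rw [hV.integral_distribution_mul hW hc hφ_mean,
      DynWhiteNoise.integral_Ioi_integral_pairSymbol hc hφ_even]
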